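/- Equip $\mathbb{C}^3$ with the Hermitian form $\langle z,w\rangle=z_1\bar w_1+z_2\bar w_2-z_3\bar w_3$, and let $\mathrm{SU}(2,1)$ be the group of complex $3\times3$ matrices of determinant $1$ that preserve it. For an integer $p\ge 2$ put $u=e^{2\pi i/(3p)}$ and $\bar u^{1/2}=e^{-\pi i/(3p)}$. A complex reflection of order $p$ in $\mathrm{SU}(2,1)$, with polar vector $v$ satisfying $\langle v,v\rangle>0$, is the map $$R(z)=e^{-2\pi i/(3p)}\Bigl(z+(e^{2\pi i/p}-1)\frac{\langle z,v\rangle}{\langle v,v\rangle}\,v\Bigr);$$ it preserves the complex geodesic polar to $v$. For elements $a,b$ of a group, the braid length $br(a,b)$ is the least integer $l\ge1$ such that the alternating products $aba\cdots$ and $bab\cdots$ with $l$ factors each are equal. **Theorem.** Let $p\ge2$, let $R_1,R_2,R_3\in\mathrm{SU}(2,1)$ be complex reflections of order $p$, and suppose that there is $S\in\mathrm{SU}(2,1)$ with $$SR_1S^{-1}=R_1R_2R_1^{-1},\quad SR_2S^{-1}=R_1R_3R_1R_3^{-1}R_1^{-1},\quad SR_3S^{-1}=R_1R_3R_1^{-1},\quad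 S^2=R_1R_2R_3.$$ Suppose that $br(R_1,R_3)=n$ and $br(R_1,R_2)=m$ with integers $m,n\ge3$, and that $R_1R_2R_3$ has finite order. Then $(n,m)$ is one of $(3,4)$, $(3,5)$, $(4,3)$, $(5,4)$, $(8,6)$, or $(k,k)$ with $k\ge3$. Moreover, say that $(\rho,\sigma,\tau)$ are parameters of $(R_1,R_2,R_3)$ if there are polar vectors $v_1,v_2,v_3$ of $R_1,R_2,R_3$ with $\langle v_j,v_i\rangle=H_{ij}$, where $$H=\begin{pmatrix}\alpha&\beta_1&\bar\beta_3\\ \bar\beta_1&\alpha&\beta_2\\ \beta_3&\bar\beta_2&\alpha\end{pmatrix},\qquad \alpha=\sqrt{2-u^3-\bar u^3},\quad (\beta_1,\beta_2,\beta_3)=-i\bar u^{1/2}(\rho,\sigma,\tau).$$ Parameters with $\sigma,\tau$ real and non-negative exist, and all such parameters satisfy $\sigma=\tau$, $\sigma^2=\rho+\bar\rho$, $|\rho|=2\cos(k\pi/m)$ for some integer $k$ coprime to $m$ with $0<k<m/2$, and $\sigma=2\cos(l\pi/n)$ for some integer $l$ coprime to $n$ with $0<l<n/2$. If $|\rho|=2\cos(\pi/m)$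 and $\sigma=2\cos(\pi/n)$, then $\rho$ or its complex conjugate (written $\rho$ in the table), together with $s=\rho-1$ and $\sigma=\tau$, is given by the row of $(n,m)$ in the following table: $$\begin{array}{|l|lll|} \hline (n,m)&\rho&s=\rho-1&\sigma=\tau\\ \hline (3,4)&(1+i\sqrt7)/2&e^{2\pi i/7}+e^{4\pi i/7}+e^{-6\pi i/7}&1\\ (3,5)&2e^{2\pi i/5}\cos(\pi/5)&e^{2\pi i/5}+e^{7\pi i/15}+e^{-13\pi i/15}&1\\ (4,3)&1&0&\sqrt2\\ (5,4)&(1+i\sqrt3)(\sqrt5-i\sqrt3)/4&e^{-2\pi i/3}+e^{2\pi i/15}+e^{8\pi i/15}&(1+\sqrt5)/2\\ (8,6)&(1+i)(1-i/\sqrt2)&e^{\pi i/2}+e^{\pi i/12}+e^{-7\pi i/12}&\sqrt{2+\sqrt2}\\ (k,k),\ k\ge 3&2e^{i\pi/k}\cos(\pi/k)&e^{2\pi i/k}&2\cos(\pi/k)\\ \hline \end{array}$$ -/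

import Mathlib

open scoped Matrix ComplexConjugate

noncomputable section

/-- The standard Hermitian form of signature `(2,1)` on `ℂ³`. -/
def herm21 (z w : Fin 3 → ℂ) : ℂ :=
  z 0 * conj (w 0) + z 1 * conj (w 1) - z 2 * conj (w 2)

/-- The group `SU(2,1)` of complex `3 × 3` matrices of determinant one preserving `herm21`. -/
def SU21 : Subgroup (Matrix.SpecialLinearGroup (Fin 3) ℂ) where
  carrier := {A | ∀ z w : Fin 3 → ℂ, herm21 (A.1 *ᵥ z) (A.1 *ᵥ w) = herm21 z w}
  one_mem' := by
    intro z w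
    simp
  mul_mem' := by
    intro A B hA hB z w
    have h := hA (B.1 *ᵥ z) (B.1 *ᵥ w)
    rw [hB z w, Matrix.mulVec_mulVec, Matrix.mulVec_mulVec] at h
    simpa using h
  inv_mem' := by
    intro A hA z w
    have h := hA ((A⁻¹).1 *ᵥ z) ((A⁻¹).1 *ᵥ w)
    have e : A.1 * (A⁻¹).1 = 1 := congrArg Subtype.val (mul_inv_cancel A)
    rw [Matrix.mulVec_mulVec, Matrix.mulVec_mulVec, e, Matrix.one_mulVec, Matrix.one_mulVec] at h
    exact h.symm

/-- `R` is the complex reflection of order `p` (through the angle `φ = 2π/p`) in the complex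
geodesic with polar vector `v`, lifted to `SU(2,1)` by the factor `e^{-iφ/3}`. The vector `v` is
positive, so that its orthogonal complement does project to a complex geodesic. -/
def IsComplexReflection (p : ℕ) (v : Fin 3 → ℂ) (R : SU21) : Prop :=
  0 < (herm21 v v).re ∧
    ∀ z : Fin 3 → ℂ, R.1.1 *ᵥ z =
      Complex.exp (-(2 * Real.pi * Complex.I / (3 * p))) •
        (z + ((Complex.exp (2 * Real.pi * Complex.I / p) - 1) *
          (herm21 z v / herm21 v v)) • v)

/-- The alternating product `a b a ⋯` with `l` factors. -/
def altProd {G : Type*} [Group G] (a b : G) : ℕ → G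
  | 0 => 1
  | l + 1 => a * altProd b a l

/-- The braid length `br(a, b)` exists and equals `l`: the least positive `l` such that
`a b a ⋯ = b a b ⋯` with `l` factors on either side. -/
def HasBraidLength {G : Type*} [Group G] (a b : G) (l : ℕ) : Prop :=
  IsLeast {k : ℕ | 1 ≤ k ∧ altProd a b k = altProd b a k} l

/-- The Hermitian matrix `H` attached to `p` and the parameters `ρ, σ, τ`, with
`α = √(2 - u³ - ū³) = √(2 - 2 cos (2π/p))` and `β₁, β₂, β₃ = -i ū^{1/2} (ρ, σ, τ)`,
where `ū^{1/2} = e^{-πi/(3p)}`. -/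
def hermitianH (p : ℕ) (ρ σ τ : ℂ) : Matrix (Fin 3) (Fin 3) ℂ :=
  let α : ℂ := ((Real.sqrt (2 - 2 * Real.cos (2 * Real.pi / p)) : ℝ) : ℂ)
  let c : ℂ := -Complex.I * Complex.exp (-(Real.pi * Complex.I / (3 * p)))
  !![α, c * ρ, conj (c * τ);
     conj (c * ρ), α, c * σ;
     c * τ, conj (c * σ), α]

/-- `ρ, σ, τ` are parameters of the triple of reflections `R₁, R₂, R₃`: there are polar vectors
`v₁, v₂, v₃` of their mirrors with respect to which the Hermitian form has the matrix `H`, that is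
`⟨v_j, v_i⟩ = H_{ij}`. -/
def HasParameters (p : ℕ) (R₁ R₂ R₃ : SU21) (ρ σ τ : ℂ) : Prop :=
  ∃ v : Fin 3 → Fin 3 → ℂ,
    IsComplexReflection p (v 0) R₁ ∧ IsComplexReflection p (v 1) R₂ ∧
    IsComplexReflection p (v 2) R₃ ∧
    ∀ i j : Fin 3, herm21 (v j) (v i) = hermitianH p ρ σ τ i j

/-- `e^{iπx}`. -/
def expPi (x : ℝ) : ℂ := Complex.exp (((Real.pi * x : ℝ) : ℂ) * Complex.I)

/-- The rows `(n, m)`, `ρ`, `s`, `σ = τ` of the table of parameter values. -/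
def IsTableRow (n m : ℕ) (ρ s : ℂ) (σ : ℝ) : Prop :=
  (n = 3 ∧ m = 4 ∧ ρ = (1 + Complex.I * (Real.sqrt 7 : ℝ)) / 2 ∧
    s = expPi (2 / 7) + expPi (4 / 7) + expPi (-6 / 7) ∧ σ = 1) ∨
  (n = 3 ∧ m = 5 ∧ ρ = 2 * expPi (2 / 5) * (Real.cos (Real.pi / 5) : ℝ) ∧
    s = expPi (2 / 5) + expPi (7 / 15) + expPi (-13 / 15) ∧ σ = 1) ∨
  (n = 4 ∧ m = 3 ∧ ρ = 1 ∧ s = 0 ∧ σ = Real.sqrt 2) ∨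
  (n = 5 ∧ m = 4 ∧
    ρ = (1 + Complex.I * (Real.sqrt 3 : ℝ)) *
      ((Real.sqrt 5 : ℝ) - Complex.I * (Real.sqrt 3 : ℝ)) / 4 ∧
    s = expPi (-2 / 3) + expPi (2 / 15) + expPi (8 / 15) ∧ σ = (1 + Real.sqrt 5) / 2) ∨
  (n = 8 ∧ m = 6 ∧ ρ = (1 + Complex.I) * (1 - Complex.I / (Real.sqrt 2 : ℝ)) ∧
    s = expPi (1 / 2) + expPi (1 / 12) + expPi (-7 / 12) ∧
    σ = Real.sqrt (2 + Real.sqrt 2)) ∨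
  (3 ≤ n ∧ n = m ∧ ρ = 2 * expPi (1 / n) * (Real.cos (Real.pi / n) : ℝ) ∧
    s = expPi (2 / n) ∧ σ = 2 * Real.cos (Real.pi / n))

end

/-! Put `J = R₁⁻¹ S`. The relations give `J R₁ J⁻¹ = R₂` and `J² = R₃`, so `J` is an isometry that
maps the polar line of `R₁` to that of `R₂` and preserves that of `R₃`. Comparing inner products of
normalised polar vectors before and after `J` yields `σ = τ` and `σ² = ρ + ρ̄`
(`parameters_of_sqrt_reflection`).

A reflection is a scalar times `1 + P` with `P` of rank one. The difference of the two alternating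
products of length `l` satisfies a Chebyshev recurrence whose only parameter is the modulus `r` of
the inner product of the polar vectors. Hence the first length at which the products agree is `m`
only if `r = 2 cos (kπ/m)` with `k` coprime to `m` (`exists_eq_two_mul_cos_of_braid`). This gives
`|ρ|` and `σ`.

Since `S² = R₁R₂R₃` has finite order, the eigenvalues of `S = R₁J` are roots of unity. The
eigenvalues of `J` are known up to sign because `J² = R₃`, and the trace of `S` then shows that `ρ -
1 = a + b + c` with roots of unity satisfying `abc = 1` (`exists_sum_of_roots_of_unity`). Taking
twice the real part gives the trace equation `a + b + c + a⁻¹ + b⁻¹ + c⁻¹ = z + z⁻¹` with `z =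
e^{2πil/n}`, while `N = |ρ - 1|²` carries the value of `|ρ|`.

The trace equation is a vanishing sum of eight roots of unity, solved by descent on an order `Q`
that kills all of them (`isTracePair_of_roots_of_unity`). For a prime `p` dividing `Q`, Galois
conjugation splits the relation along the cosets of the `Q/p`-th roots of unity. If `p²` divides
`Q`, every coset sum vanishes. Otherwise the coset sums, after removal of a `p`-th root of unity,
share a common value `V`. Vanishing coset sums either give a known solution or put all terms in the
trivial coset, with `z² = -1` as an extra possibility for `p = 2`. If `V ≠ 0`, at most eight terms
meet all `p` cosets, so `p` is `5` or `7` once `2` and `3` are set aside. The descent ends at sixth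
roots of unity, checked by hand. Each resulting pair `(z + z⁻¹, N)` determines `(n, m)`, and the
real part and modulus determine `ρ` up to conjugation, which gives the table. -/

/-! ### Galois conjugation and splitting of vanishing sums of roots of unity -/

/-- A rational relation between `Q`-th roots of unity is preserved by `x ↦ x ^ t`, `t` coprime
to `Q`. -/
theorem sum_pow_eq_zero_of_coprime {ι : Type*} [Fintype ι] {Q t : ℕ} (hQ : Q ≠ 0)
    (ht : t.Coprime Q) (f : ι → ℤ) (x : ι → ℂ) (hx : ∀ i, x i ^ Q = 1)
    (h : ∑ i, (f i : ℂ) * x i = 0) : ∑ i, (f i : ℂ) * x i ^ t = 0 := by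
  classical
  have : NeZero Q := ⟨hQ⟩
  have hζ := Complex.isPrimitiveRoot_exp Q hQ
  set ζ := Complex.exp (2 * Real.pi * Complex.I / Q) with hζdef
  choose e _ he using fun i => hζ.eq_pow_of_pow_eq_one (hx i)
  let P : Polynomial ℤ := ∑ i, Polynomial.C (f i) * Polynomial.X ^ e i
  have hev : ∀ w : ℂ, Polynomial.aeval w P = ∑ i, (f i : ℂ) * w ^ e i := by
    intro w
    simp [P]
  have h0 : Polynomial.aeval ζ P = 0 := by
    rw [hev, ← h]
    exact Finset.sum_congr rfl fun i _ => by rw [he i]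
  -- The relation says that `P` vanishes at `ζ`. As `ζ` and `ζ ^ t` are both primitive, they share
  -- the cyclotomic polynomial as minimal polynomial, which divides `P`.
  have hdvd : minpoly ℤ ζ ∣ P :=
    minpoly.isIntegrallyClosed_dvd (hζ.isIntegral (Nat.pos_of_ne_zero hQ)) h0
  have hmin : minpoly ℤ ζ = minpoly ℤ (ζ ^ t) := by
    rw [← Polynomial.cyclotomic_eq_minpoly hζ (Nat.pos_of_ne_zero hQ),
      ← Polynomial.cyclotomic_eq_minpoly (hζ.pow_of_coprime t ht) (Nat.pos_of_ne_zero hQ)]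
  rw [hmin] at hdvd
  obtain ⟨g, hg⟩ := hdvd
  have h1 : Polynomial.aeval (ζ ^ t) P = 0 := by
    rw [hg, map_mul, minpoly.aeval, zero_mul]
  rw [hev] at h1
  rw [← h1]
  refine Finset.sum_congr rfl fun i _ => ?_
  rw [← he i, ← pow_mul, ← pow_mul, mul_comm t]

/-- Fourier inversion on `ZMod d` for a finite family of weighted frequencies. -/
theorem card_mul_sum_filter_eq {ι : Type*} [Fintype ι] {d : ℕ} [NeZero d] (χ : ι → ZMod d)
    (g : ι → ℂ) (c : ZMod d) :
    (d : ℂ) * ∑ i, (if χ i = c then g i else 0) =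
      ∑ j : ZMod d, ZMod.stdAddChar (-(j * c)) * ∑ i, g i * ZMod.stdAddChar (j * χ i) := by
  classical
  simp_rw [Finset.mul_sum]
  rw [Finset.sum_comm]
  refine Finset.sum_congr rfl fun i _ => ?_
  have h := AddChar.sum_mulShift (ψ := (ZMod.stdAddChar : AddChar (ZMod d) ℂ)) (χ i - c)
    (ZMod.isPrimitive_stdAddChar d)
  have h2 : ∀ j : ZMod d, ZMod.stdAddChar (-(j * c)) * (g i * ZMod.stdAddChar (j * χ i)) =
      g i * (ZMod.stdAddChar (j * (χ i - c)) : ℂ) := by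
    intro j
    rw [show j * (χ i - c) = -(j * c) + j * χ i by ring, AddChar.map_add_eq_mul]
    ring
  simp_rw [h2]
  rw [← Finset.mul_sum, h]
  by_cases hc : χ i = c
  · simp [hc, ZMod.card, mul_comm]
  · simp [hc, sub_eq_zero]

/-- If all `1 + j q` are coprime to `Q = d q`, a vanishing sum of `Q`-th roots of unity splits
along the cosets of the `q`-th roots of unity. -/
theorem exists_splitting_of_coprime {Q d q : ℕ} [NeZero d] (hQ : Q ≠ 0) (hdq : Q = d * q)
    (hc : ∀ j : ℕ, (1 + j * q).Coprime Q) :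
    ∃ χ : ℂ → ZMod d,
      (∀ x y, x ^ Q = 1 → y ^ Q = 1 → χ (x * y) = χ x + χ y) ∧
      (∀ x, x ^ Q = 1 → (χ x = 0 ↔ x ^ q = 1)) ∧
      ∀ {ι : Type} [Fintype ι] (f : ι → ℤ) (x : ι → ℂ), (∀ i, x i ^ Q = 1) →
        ∑ i, (f i : ℂ) * x i = 0 →
        ∀ c, ∑ i, (if χ (x i) = c then (f i : ℂ) * x i else 0) = 0 := by
  classical
  have : NeZero Q := ⟨hQ⟩
  have hd0 : d ≠ 0 := NeZero.ne d
  have hq0 : q ≠ 0 := by rintro rfl; simp at hdq; exact hQ hdq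
  have hζ := Complex.isPrimitiveRoot_exp Q hQ
  set ζ := Complex.exp (2 * Real.pi * Complex.I / Q) with hζdef
  have hex : ∀ x : ℂ, ∃ e : ℕ, x ^ Q = 1 → ζ ^ e = x := by
    intro x
    by_cases hx : x ^ Q = 1
    · obtain ⟨e, _, he⟩ := hζ.eq_pow_of_pow_eq_one hx
      exact ⟨e, fun _ => he⟩
    · exact ⟨0, fun h => absurd h hx⟩
  choose e he using hex
  have hζq : ∀ k : ℕ, (ζ ^ q) ^ k = ZMod.stdAddChar ((k : ℕ) : ZMod d) := by
    intro k
    have := ZMod.stdAddChar_coe (N := d) (k : ℤ)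
    rw [Int.cast_natCast] at this
    rw [this, hζdef, ← Complex.exp_nat_mul, ← Complex.exp_nat_mul]
    congr 1
    rw [hdq]
    have : (d : ℂ) ≠ 0 := by exact_mod_cast hd0
    have : (q : ℂ) ≠ 0 := by exact_mod_cast hq0
    push_cast
    field_simp
  refine ⟨fun x => (e x : ZMod d), ?_, ?_, ?_⟩
  · intro x y hx hy
    have hxy : (x * y) ^ Q = 1 := by rw [mul_pow, hx, hy, one_mul]
    have h1 : ζ ^ e (x * y) = ζ ^ (e x + e y) := by
      rw [he _ hxy, pow_add, he _ hx, he _ hy]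
    have h2 : e (x * y) ≡ e x + e y [MOD Q] := by
      rw [hζ.eq_orderOf]; exact (hζ.isOfFinOrder hQ).pow_eq_pow_iff_modEq.1 h1
    have h3 : e (x * y) ≡ e x + e y [MOD d] := h2.of_dvd ⟨q, hdq⟩
    have := (ZMod.natCast_eq_natCast_iff _ _ _).2 h3
    push_cast at this
    exact this
  · intro x hx
    rw [ZMod.natCast_eq_zero_iff]
    conv_rhs => rw [← he x hx, ← pow_mul, hζ.pow_eq_one_iff_dvd, hdq]
    exact (mul_dvd_mul_iff_right hq0).symm
  · intro ι _ f x hx h c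
    -- Raising to the power `1 + j q` multiplies each term by the value at its class of the `j`-th
    -- character. Thus every Fourier coefficient of the class sums vanishes.
    have key : ∀ j : ZMod d,
        ∑ i, ((f i : ℂ) * x i) * ZMod.stdAddChar (j * (e (x i) : ZMod d)) = 0 := by
      intro j
      rw [← sum_pow_eq_zero_of_coprime hQ (hc j.val) f x hx h]
      refine Finset.sum_congr rfl fun i _ => ?_
      have : x i ^ (j.val * q) = ZMod.stdAddChar (j * (e (x i) : ZMod d)) := by
        rw [← he (x i) (hx i), ← pow_mul, show e (ζ ^ e (x i)) = e (x i) by rw [he _ (hx i)],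
          show e (x i) * (j.val * q) = q * (j.val * e (x i)) by ring, pow_mul, hζq]
        simp
      rw [pow_add, pow_one, this, mul_assoc]
    have h1 := card_mul_sum_filter_eq (fun i => (e (x i) : ZMod d)) (fun i => (f i : ℂ) * x i) c
    simp only [key, mul_zero, Finset.sum_const_zero] at h1
    have hd : (d : ℂ) ≠ 0 := by exact_mod_cast hd0
    exact (mul_eq_zero.1 h1).resolve_left hd

/-- If the prime `p` divides `Q = p q` exactly once, every `Q`-th root of unity is the product of
a `p`-th root of unity and of its power `x ^ h`, a `q`-th root of unity, and the coset sums of the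
factors `x ^ h` in a vanishing sum all agree. -/
theorem exists_splitting_of_prime {Q p q : ℕ} [Fact p.Prime] (hQ : Q ≠ 0) (hpq : Q = p * q)
    (hcop : p.Coprime q) :
    ∃ (χ : ℂ → ZMod p) (h : ℕ),
      (∀ x y, x ^ Q = 1 → y ^ Q = 1 → χ (x * y) = χ x + χ y) ∧
      (∀ x, x ^ Q = 1 → χ x = 0 → x ^ q = 1) ∧
      (∀ x, x ^ Q = 1 → x = ZMod.stdAddChar (χ x) * x ^ h) ∧
      ∀ {ι : Type} [Fintype ι] (f : ι → ℤ) (x : ι → ℂ), (∀ i, x i ^ Q = 1) →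
        ∑ i, (f i : ℂ) * x i = 0 →
        ∃ V : ℂ, ∀ c, ∑ i, (if χ (x i) = c then (f i : ℂ) * x i ^ h else 0) = V := by
  classical
  have hp : p.Prime := Fact.out
  -- The exponent `h ≡ 0 mod p`, `h ≡ 1 mod q` projects the `Q`-th roots of unity onto the `q`-th
  -- ones.
  obtain ⟨h, hh0, hh1⟩ := Nat.chineseRemainder hcop 0 1
  have hph : p ∣ h := (Nat.modEq_zero_iff_dvd).1 hh0
  have hmod : ∀ {x : ℂ} {k a b : ℕ}, x ^ k = 1 → a ≡ b [MOD k] → x ^ a = x ^ b := by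
    intro x k a b hx hab
    exact pow_eq_pow_of_modEq hab hx
  have hxh : ∀ x : ℂ, x ^ Q = 1 → (x ^ h) ^ q = 1 := by
    intro x hx
    obtain ⟨k, rfl⟩ := hph
    rw [← pow_mul, show p * k * q = Q * k by rw [hpq]; ring, pow_mul, hx, one_pow]
  have hne : ∀ x : ℂ, x ^ Q = 1 → x ≠ 0 := by
    rintro x hx rfl
    rw [zero_pow hQ] at hx
    exact zero_ne_one hx
  have hprim : IsPrimitiveRoot (ZMod.stdAddChar (1 : ZMod p)) p := by
    have := ZMod.stdAddChar_coe (N := p) 1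
    rw [Int.cast_one] at this
    rw [this]
    simpa using Complex.isPrimitiveRoot_exp p hp.ne_zero
  have hex : ∀ x : ℂ, ∃ k : ZMod p, x ^ Q = 1 → x = ZMod.stdAddChar k * x ^ h := by
    intro x
    by_cases hx : x ^ Q = 1
    · have h1 : (x * (x ^ h)⁻¹) ^ p = 1 := by
        rw [mul_pow, inv_pow, ← pow_mul]
        have : x ^ (h * p) = x ^ p := by
          refine hmod hx ?_
          have := (Nat.ModEq.mul_left' p hh1)
          rw [← hpq] at this
          simpa [mul_comm] using this
        rw [this, mul_inv_cancel₀ (pow_ne_zero _ (hne x hx))]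
      obtain ⟨i, _, hi⟩ := hprim.eq_pow_of_pow_eq_one h1
      refine ⟨(i : ZMod p), fun _ => ?_⟩
      have h2 : (ZMod.stdAddChar ((i : ℕ) : ZMod p) : ℂ) = x * (x ^ h)⁻¹ := by
        rw [← hi, ← AddChar.map_nsmul_eq_pow]; simp
      rw [h2, mul_assoc, inv_mul_cancel₀ (pow_ne_zero _ (hne x hx)), mul_one]
    · exact ⟨0, fun h => absurd h hx⟩
  choose χ hχ using hex
  refine ⟨χ, h, ?_, ?_, hχ, ?_⟩
  · intro x y hx hy
    have hxy : (x * y) ^ Q = 1 := by rw [mul_pow, hx, hy, one_mul]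
    apply ZMod.injective_stdAddChar
    rw [AddChar.map_add_eq_mul]
    have h1 := hχ _ hxy
    have h2 := hχ _ hx
    have h3 := hχ _ hy
    have hn : (x * y) ^ h ≠ 0 := pow_ne_zero _ (hne _ hxy)
    apply mul_right_cancel₀ hn
    rw [← h1, mul_pow]
    calc x * y = (ZMod.stdAddChar (χ x) * x ^ h) * (ZMod.stdAddChar (χ y) * y ^ h) := by
          rw [← h2, ← h3]
      _ = _ := by ring
  · intro x hx h0
    have h1 := hχ x hx
    rw [h0, AddChar.map_zero_eq_one, one_mul] at h1
    rw [h1, hxh x hx]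
  · intro ι _ f x hx hsum
    let F : ZMod p → ℂ := fun j =>
      ∑ i, ((f i : ℂ) * x i ^ h) * ZMod.stdAddChar (j * χ (x i))
    -- An exponent `t ≡ j mod p`, `t ≡ 1 mod q` is coprime to `Q` exactly when `j ≠ 0`. Only the
    -- zeroth Fourier coefficient can survive, so all class sums equal `F 0 / p`.
    have hF : ∀ j : ZMod p, j ≠ 0 → F j = 0 := by
      intro j hj
      obtain ⟨t, ht0, ht1⟩ := Nat.chineseRemainder hcop j.val 1
      have htc : t.Coprime Q := by
        rw [hpq]
        refine Nat.Coprime.mul_right ?_ ?_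
        · rw [Nat.coprime_comm, hp.coprime_iff_not_dvd]
          intro hdvd
          have h2 := (Nat.modEq_zero_iff_dvd.2 hdvd).symm.trans ht0
          have h3 := (ZMod.natCast_eq_natCast_iff _ _ _).2 h2
          simp at h3
          exact hj h3.symm
        · have := ht1.gcd_eq
          simpa [Nat.coprime_iff_gcd_eq_one] using this
      have htj : ((t : ℕ) : ZMod p) = j := by
        have h3 := (ZMod.natCast_eq_natCast_iff _ _ _).2 ht0
        simpa using h3
      have h1 := sum_pow_eq_zero_of_coprime hQ htc f x hx hsum
      rw [← h1]
      refine Finset.sum_congr rfl fun i _ => ?_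
      have h2 : x i ^ t = ZMod.stdAddChar (j * χ (x i)) * x i ^ h := by
        conv_lhs => rw [hχ _ (hx i)]
        rw [mul_pow, ← AddChar.map_nsmul_eq_pow, nsmul_eq_mul, htj, hmod (hxh _ (hx i)) ht1,
          pow_one]
      rw [h2]
      ring
    refine ⟨F 0 / p, fun c => ?_⟩
    have h1 := card_mul_sum_filter_eq (fun i => χ (x i)) (fun i => (f i : ℂ) * x i ^ h) c
    rw [Finset.sum_eq_single (0 : ZMod p)] at h1
    · have hp0 : (p : ℂ) ≠ 0 := by exact_mod_cast hp.ne_zero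
      rw [eq_div_iff hp0, mul_comm, h1]
      simp [F]
    · intro j _ hj
      have := hF j hj
      simp only [F] at this
      rw [this, mul_zero]
    · simp

/-! ### The trace equation: vanishing coset sums -/

/-- The part of `x + x⁻¹` in the coset `k`, where `x` lies in the coset `ξ`. -/
noncomputable def classPart {d : ℕ} (k ξ : ZMod d) (x : ℂ) : ℂ :=
  (if ξ = k then x else 0) + (if -ξ = k then x⁻¹ else 0)

theorem classPart_neg_inv {d : ℕ} (k ξ : ZMod d) (x : ℂ) :
    classPart k (-ξ) x⁻¹ = classPart k ξ x := by
  simp [classPart, add_comm]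

theorem classPart_zero_zero {d : ℕ} (x : ℂ) : classPart (0 : ZMod d) 0 x = x + x⁻¹ := by
  simp [classPart]

theorem classPart_of_ne {d : ℕ} {k ξ : ZMod d} (x : ℂ) (h : ξ ≠ k) (h' : -ξ ≠ k) :
    classPart k ξ x = 0 := by
  simp [classPart, h, h']

theorem classPart_self {d : ℕ} {k ξ : ZMod d} (x : ℂ) (h : ξ = k) (h' : -ξ ≠ k) :
    classPart k ξ x = x := by
  simp [classPart, h, h ▸ h']

theorem classPart_neg {d : ℕ} {k ξ : ZMod d} (x : ℂ) (h : ξ ≠ k) (hneg : -ξ = k) :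
    classPart k ξ x = x⁻¹ := by
  simp [classPart, h, hneg]

/-- The possible values of `t = z + z⁻¹` and `N = (a + b + c)(a⁻¹ + b⁻¹ + c⁻¹)` for roots of unity
with `abc = 1` and `a + b + c + a⁻¹ + b⁻¹ + c⁻¹ = z + z⁻¹`. -/
def IsTracePair (t N : ℂ) : Prop :=
  N = 1 ∨ (t = 0 ∧ N = 0) ∨ (t ^ 2 = 2 ∧ N = 2 - t) ∨ (t = -1 ∧ N = 2) ∨
    (t = -1 ∧ (N - 2) ^ 2 + (N - 2) = 1) ∨ (t ^ 2 + t = 1 ∧ N = t ^ 2)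

theorem eq_neg_one_of_add_inv {z : ℂ} (hz : z ≠ 0) (h : z + z⁻¹ = -2) : z = -1 := by
  have h1 : (z + 1) ^ 2 = 0 := by
    have : z * (z + z⁻¹) = z * (-2) := by rw [h]
    rw [mul_add, mul_inv_cancel₀ hz] at this
    linear_combination this
  have := pow_eq_zero_iff (two_ne_zero) |>.1 h1
  linear_combination this

section

variable {a b c z : ℂ}

/-- The cancelling part factors as `(b + c)(bc + 1) = 0`. The first factor leaves `N = a a⁻¹ = 1`;
the second forces `a = -1`, hence `z = -1`. -/
theorem isTracePair_of_cancel (ha : a ≠ 0) (hb : b ≠ 0) (hc : c ≠ 0) (hz : z ≠ 0)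
    (habc : a * b * c = 1) (hz1 : z ≠ -1) (h1 : b + b⁻¹ + (c + c⁻¹) = 0)
    (h2 : a + a⁻¹ = z + z⁻¹) :
    IsTracePair (z + z⁻¹) ((a + b + c) * (a⁻¹ + b⁻¹ + c⁻¹)) := by
  have h3 : (b + c) * (b * c + 1) = 0 := by
    field_simp at h1
    linear_combination h1
  rcases mul_eq_zero.1 h3 with h | h
  · left
    have hbc : b = -c := by linear_combination h
    subst hbc
    field_simp
    ring
  · exfalso
    have ha1 : a = -1 := by linear_combination a * h - habc
    subst ha1
    apply hz1
    apply eq_neg_one_of_add_inv hz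
    rw [← h2]
    norm_num

/-- Multiplying the two equations shows that `ab` is a primitive cube root of unity. Then so is `c`,
which contradicts `c² = -1`. -/
theorem not_sum_eq_of_sq_eq_neg_one (ha : a ≠ 0) (hb : b ≠ 0) (hc : c ≠ 0) (hz : z ≠ 0)
    (habc : a * b * c = 1) (h1 : a + b⁻¹ = z) (h2 : a⁻¹ + b = z⁻¹) (h3 : c + c⁻¹ = 0) : False := by
  subst h1
  have hab : a * b ≠ 0 := mul_ne_zero ha hb
  have hz' : a * b + 1 ≠ 0 := by
    intro h
    apply hz
    field_simp
    linear_combination h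
  have h4 : (a * b) ^ 2 + a * b + 1 = 0 := by
    have : (a + b⁻¹) * (a⁻¹ + b) = 1 := by rw [h2, mul_inv_cancel₀ hz]
    field_simp at this
    linear_combination this
  have h5 : c ^ 2 = -1 := by field_simp at h3; linear_combination h3
  have h6 : 1 + c + c ^ 2 = 0 := by
    linear_combination c ^ 2 * h4 - (a * b * c + 1 + c) * habc
  rw [h5] at h6
  apply hc
  linear_combination h6

variable {p : ℕ} [Fact p.Prime] {α β γ δ : ZMod p}

theorem ne_neg_self_of_ne_zero (hp2 : p ≠ 2) {x : ZMod p} (hx : x ≠ 0) : x ≠ -x := by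
  intro h
  have h1 : (2 : ZMod p) * x = 0 := by linear_combination h
  rcases mul_eq_zero.1 h1 with h2 | h2
  · have h3 : ((2 : ℕ) : ZMod p) = 0 := by exact_mod_cast h2
    rw [ZMod.natCast_eq_zero_iff] at h3
    exact hp2 ((Nat.prime_dvd_prime_iff_eq Fact.out Nat.prime_two).1 h3)
  · exact hx h2

/-- The third class is `-2α`, distinct from `0` and `±α`. So `c` is alone in its class and would
have to vanish. -/
theorem false_of_double_class (hp2 : p ≠ 2) (hc : c ≠ 0) (habc : α + β + γ = 0)
    (H : ∀ k, classPart k α a + classPart k β b + classPart k γ c = classPart k δ z)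
    (hα : α ≠ 0) (hβ : β = α) (hγ : γ ≠ α) (hδ : δ = 0 ∨ δ = α) : False := by
  subst hβ
  have hγ2 : γ = -(2 * β) := by linear_combination habc
  have h2 : (2 * β) ≠ 0 := fun h => ne_neg_self_of_ne_zero hp2 hα (by linear_combination h)
  have hγ0 : γ ≠ 0 := by rw [hγ2]; exact neg_ne_zero.2 h2
  have h3 : -β ≠ γ := fun h => hα (by linear_combination habc + h)
  have h4 : -γ ≠ γ := fun h => ne_neg_self_of_ne_zero hp2 hγ0 h.symm
  have h5 := H γ
  rw [classPart_of_ne a hγ.symm h3, classPart_of_ne b hγ.symm h3, classPart_self c rfl h4] at h5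
  rcases hδ with rfl | rfl
  · rw [classPart_of_ne z hγ0.symm (by simpa using hγ0.symm)] at h5
    exact hc (by linear_combination h5)
  · rw [classPart_of_ne z hγ.symm h3] at h5
    exact hc (by linear_combination h5)

/-- If all three classes agree, then `a + b + c = z` together with its inverse version, so `N = 1`.
Exactly two equal classes are impossible, and a pair of opposite classes leaves `c + c⁻¹ = 0` or `b
+ b⁻¹ = 0`, also impossible. Otherwise `a = z` and the remaining terms cancel. -/
theorem isTracePair_of_class_eq (hp2 : p ≠ 2) (ha : a ≠ 0) (hb : b ≠ 0) (hc : c ≠ 0) (hz : z ≠ 0)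
    (habc : a * b * c = 1) (hz1 : z ≠ -1) (hrel : a + a⁻¹ + (b + b⁻¹) + (c + c⁻¹) = z + z⁻¹)
    (hχ : α + β + γ = 0)
    (H : ∀ k, classPart k α a + classPart k β b + classPart k γ c = classPart k δ z)
    (hδ : δ ≠ 0) (hα : α = δ) :
    IsTracePair (z + z⁻¹) ((a + b + c) * (a⁻¹ + b⁻¹ + c⁻¹)) := by
  subst hα
  have hn := ne_neg_self_of_ne_zero hp2 hδ
  have hn' : -α ≠ α := hn.symm
  have hnn : - -α ≠ -α := by rwa [neg_neg]
  have H' : ∀ k, classPart k α a + classPart k γ c + classPart k β b = classPart k α z := by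
    intro k; rw [← H k]; ring
  have hα0 : α ≠ -0 := by simpa using hδ
  have hα0' : -α ≠ 0 := by simpa using hδ
  by_cases h1 : β = α
  · by_cases h2 : γ = α
    · subst h1
      subst h2
      left
      have e1 := H γ
      have e2 := H (-γ)
      simp only [classPart_self _ rfl hn'] at e1
      simp only [classPart_neg _ hn rfl] at e2
      rw [e1, e2, mul_inv_cancel₀ hz]
    · exact (false_of_double_class hp2 hc hχ H hδ h1 h2 (Or.inr rfl)).elim
  by_cases h2 : γ = α
  · exact (false_of_double_class hp2 hb (by linear_combination hχ) H' hδ h2 h1 (Or.inr rfl)).elim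
  by_cases h3 : β = -α
  · subst h3
    have hγ : γ = 0 := by linear_combination hχ
    subst hγ
    exfalso
    have e1 := H α
    have e2 := H (-α)
    have e3 := H 0
    rw [classPart_self _ rfl hn', classPart_neg b hn' (neg_neg _),
      classPart_of_ne c hδ.symm (by simpa using hδ.symm), classPart_self _ rfl hn', add_zero] at e1
    rw [classPart_neg _ hn rfl, classPart_self b rfl hnn, classPart_of_ne c hα0'.symm
      (by simpa using hδ), classPart_neg _ hn rfl, add_zero] at e2
    rw [classPart_of_ne a hδ hα0', classPart_of_ne b hα0' (by simpa using hδ),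
      classPart_zero_zero, classPart_of_ne z hδ hα0', zero_add, zero_add] at e3
    exact not_sum_eq_of_sq_eq_neg_one ha hb hc hz habc e1 e2 e3
  by_cases h4 : γ = -α
  · subst h4
    have hβ : β = 0 := by linear_combination hχ
    subst hβ
    exfalso
    have e1 := H' α
    have e2 := H' (-α)
    have e3 := H' 0
    rw [classPart_self _ rfl hn', classPart_neg c hn' (neg_neg _),
      classPart_of_ne b hδ.symm (by simpa using hδ.symm), classPart_self _ rfl hn', add_zero] at e1
    rw [classPart_neg _ hn rfl, classPart_self c rfl hnn, classPart_of_ne b hα0'.symm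
      (by simpa using hδ), classPart_neg _ hn rfl, add_zero] at e2
    rw [classPart_of_ne a hδ hα0', classPart_of_ne c hα0' (by simpa using hδ),
      classPart_zero_zero, classPart_of_ne z hδ hα0', zero_add, zero_add] at e3
    exact not_sum_eq_of_sq_eq_neg_one ha hc hb hz (by linear_combination habc) e1 e2 e3
  have e1 := H α
  rw [classPart_self _ rfl hn', classPart_of_ne b h1 (fun h => h3 (neg_eq_iff_eq_neg.1 h)),
    classPart_of_ne c h2 (fun h => h4 (neg_eq_iff_eq_neg.1 h)), classPart_self _ rfl hn',
    add_zero, add_zero] at e1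
  subst e1
  exact isTracePair_of_cancel ha hb hc hz habc hz1 (by linear_combination hrel) rfl

/-- If all three classes agree, then `a + b + c = 0`. Otherwise the class of `a` must contain the
inverse of another term, which makes the third term `-1` and forces `z = -1`, or else `a` is alone
and vanishes. -/
theorem isTracePair_of_class_zero (hp2 : p ≠ 2) (ha : a ≠ 0) (hb : b ≠ 0) (hc : c ≠ 0)
    (hz : z ≠ 0) (habc : a * b * c = 1) (hz1 : z ≠ -1)
    (hrel : a + a⁻¹ + (b + b⁻¹) + (c + c⁻¹) = z + z⁻¹) (hχ : α + β + γ = 0)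
    (H : ∀ k, classPart k α a + classPart k β b + classPart k γ c = classPart k δ z)
    (hδ : δ = 0) (hα : α ≠ 0) :
    IsTracePair (z + z⁻¹) ((a + b + c) * (a⁻¹ + b⁻¹ + c⁻¹)) := by
  subst hδ
  have hn := ne_neg_self_of_ne_zero hp2 hα
  have hn' : -α ≠ α := hn.symm
  have H' : ∀ k, classPart k α a + classPart k γ c + classPart k β b = classPart k 0 z := by
    intro k; rw [← H k]; ring
  have hz0 : ∀ k : ZMod p, k ≠ 0 → classPart k 0 z = 0 := fun k hk =>
    classPart_of_ne z hk.symm (by simpa using hk.symm)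
  have pairing : ∀ {x y : ℂ}, x ≠ 0 → y ≠ 0 → a * x * y = 1 → a + x⁻¹ = 0 →
      a + a⁻¹ + (x + x⁻¹) + (y + y⁻¹) = z + z⁻¹ → False := by
    intro x y hx hy h1 h2 h3
    have hax : a * x = -1 := by field_simp at h2; linear_combination h2
    have hy1 : y = -1 := by rw [hax] at h1; linear_combination -h1
    have hxa : x = -a⁻¹ := by field_simp; linear_combination hax
    apply hz1
    apply eq_neg_one_of_add_inv hz
    rw [← h3, hxa, hy1]
    field_simp
    ring
  by_cases h1 : β = α
  · by_cases h2 : γ = α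
    · subst h1
      subst h2
      right; left
      have e1 := H γ
      have e2 := H (-γ)
      rw [hz0 _ hα] at e1
      rw [hz0 _ (neg_ne_zero.2 hα)] at e2
      simp only [classPart_self _ rfl hn'] at e1
      simp only [classPart_neg _ hn rfl] at e2
      exact ⟨by rw [← hrel]; linear_combination e1 + e2, by rw [e1, zero_mul]⟩
    · exact (false_of_double_class hp2 hc hχ H hα h1 h2 (Or.inl rfl)).elim
  by_cases h2 : γ = α
  · exact (false_of_double_class hp2 hb (by linear_combination hχ) H' hα h2 h1 (Or.inl rfl)).elim
  have e1 := H α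
  rw [hz0 _ hα, classPart_self a rfl hn'] at e1
  by_cases h3 : β = -α
  · have hγ : γ = 0 := by linear_combination hχ - h3
    rw [classPart_neg b h1 (by rw [h3, neg_neg]),
      classPart_of_ne c (by rw [hγ]; exact hα.symm) (by rw [hγ, neg_zero]; exact hα.symm),
      add_zero] at e1
    exact (pairing hb hc habc e1 hrel).elim
  by_cases h4 : γ = -α
  · have hβ : β = 0 := by linear_combination hχ - h4
    rw [classPart_neg c h2 (by rw [h4, neg_neg]),
      classPart_of_ne b (by rw [hβ]; exact hα.symm) (by rw [hβ, neg_zero]; exact hα.symm),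
      add_zero] at e1
    exact (pairing hc hb (by linear_combination habc) e1 (by linear_combination hrel)).elim
  rw [classPart_of_ne b h1 (fun h => h3 (neg_eq_iff_eq_neg.1 h)),
    classPart_of_ne c h2 (fun h => h4 (neg_eq_iff_eq_neg.1 h)), add_zero, add_zero] at e1
  exact (ha e1).elim

/-- If the coset sums vanish for an odd prime and not all terms lie in the trivial coset, the
trace equation is one of the known ones. -/
theorem isTracePair_of_vanishing_classes (hp2 : p ≠ 2) (ha : a ≠ 0) (hb : b ≠ 0) (hc : c ≠ 0)
    (hz : z ≠ 0) (habc : a * b * c = 1) (hz1 : z ≠ -1)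
    (hrel : a + a⁻¹ + (b + b⁻¹) + (c + c⁻¹) = z + z⁻¹) (hχ : α + β + γ = 0)
    (H : ∀ k, classPart k α a + classPart k β b + classPart k γ c = classPart k δ z)
    (hne : ¬ (α = 0 ∧ β = 0 ∧ γ = 0 ∧ δ = 0)) :
    IsTracePair (z + z⁻¹) ((a + b + c) * (a⁻¹ + b⁻¹ + c⁻¹)) := by
  have rb : (a + b + c) * (a⁻¹ + b⁻¹ + c⁻¹) = (b + c + a) * (b⁻¹ + c⁻¹ + a⁻¹) := by ring
  have rc : (a + b + c) * (a⁻¹ + b⁻¹ + c⁻¹) = (c + a + b) * (c⁻¹ + a⁻¹ + b⁻¹) := by ring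
  have Hb : ∀ k, classPart k β b + classPart k γ c + classPart k α a = classPart k δ z := by
    intro k; rw [← H k]; ring
  have Hc : ∀ k, classPart k γ c + classPart k α a + classPart k β b = classPart k δ z := by
    intro k; rw [← H k]; ring
  by_cases hδ : δ = 0
  · by_cases hα : α = 0
    · have hβ : β ≠ 0 := by
        intro hβ
        exact hne ⟨hα, hβ, by linear_combination hχ - hα - hβ, hδ⟩
      rw [rb]
      exact isTracePair_of_class_zero hp2 hb hc ha hz (by linear_combination habc) hz1
        (by linear_combination hrel) (by linear_combination hχ) Hb hδ hβ
    · exact isTracePair_of_class_zero hp2 ha hb hc hz habc hz1 hrel hχ H hδ hα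
  · have hn := ne_neg_self_of_ne_zero hp2 hδ
    -- Cyclic permutations of `a, b, c` and the exchange of `z` with `z⁻¹` reduce to the case where
    -- `a` and `z` share a class. If no such match exists, `z` is alone in its class.
    have key : ∀ (w : ℂ) (ε : ZMod p), w ≠ 0 → w ≠ -1 → w + w⁻¹ = z + z⁻¹ → ε ≠ 0 →
        (∀ k, classPart k ε w = classPart k δ z) → (α = ε ∨ β = ε ∨ γ = ε) →
        IsTracePair (z + z⁻¹) ((a + b + c) * (a⁻¹ + b⁻¹ + c⁻¹)) := by
      intro w ε hw hw1 hwz hε hk h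
      rw [← hwz]
      rcases h with h | h | h
      · exact isTracePair_of_class_eq hp2 ha hb hc hw habc hw1 (by rw [hwz]; exact hrel) hχ
          (fun k => by rw [hk]; exact H k) hε h
      · rw [rb]
        exact isTracePair_of_class_eq hp2 hb hc ha hw (by linear_combination habc) hw1
          (by rw [hwz, ← hrel]; ring) (show β + γ + α = 0 by linear_combination hχ)
          (fun k => by rw [hk]; exact Hb k) hε h
      · rw [rc]
        exact isTracePair_of_class_eq hp2 hc ha hb hw (by linear_combination habc) hw1
          (by rw [hwz, ← hrel]; ring) (show γ + α + β = 0 by linear_combination hχ)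
          (fun k => by rw [hk]; exact Hc k) hε h
    by_cases h1 : α = δ ∨ β = δ ∨ γ = δ
    · exact key z δ hz hz1 rfl hδ (fun _ => rfl) h1
    by_cases h2 : α = -δ ∨ β = -δ ∨ γ = -δ
    · refine key z⁻¹ (-δ) (inv_ne_zero hz) ?_ ?_ (neg_ne_zero.2 hδ)
        (fun k => classPart_neg_inv k δ z) h2
      · intro h
        apply hz1
        rw [inv_eq_iff_eq_inv] at h
        rw [h]; norm_num
      · rw [inv_inv, add_comm]
    push Not at h1 h2
    have e1 := H δ
    rw [classPart_of_ne a h1.1 (fun h => h2.1 (neg_eq_iff_eq_neg.1 h)),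
      classPart_of_ne b h1.2.1 (fun h => h2.2.1 (neg_eq_iff_eq_neg.1 h)),
      classPart_of_ne c h1.2.2 (fun h => h2.2.2 (neg_eq_iff_eq_neg.1 h)),
      classPart_self z rfl hn.symm] at e1
    exact (hz (by linear_combination -e1)).elim

end

/-! ### The trace equation: constant nonzero coset sums -/

/-- With a nonzero common sum no class is empty. This list and the next one give the class patterns
that meet all of them, the class of `c` being `-(α + β)`. -/
theorem zmod_five_cover : ∀ α β δ : ZMod 5,
    (∀ k, (α = k ∨ -α = k) ∨ (β = k ∨ -β = k) ∨ (-(α + β) = k ∨ α + β = k) ∨ (δ = k ∨ -δ = k)) →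
    (α ≠ 0 ∧ β = -α ∧ (δ = 2 * α ∨ -δ = 2 * α)) ∨
    (β ≠ 0 ∧ α = 0 ∧ (δ = 2 * β ∨ -δ = 2 * β)) ∨
    (α ≠ 0 ∧ β = 0 ∧ (δ = 2 * α ∨ -δ = 2 * α)) ∨
    (α ≠ 0 ∧ β = α ∧ δ = 0) ∨ (α ≠ 0 ∧ -(α + β) = α ∧ δ = 0) ∨
    (β ≠ 0 ∧ -(α + β) = β ∧ δ = 0) := by
  decide

theorem zmod_seven_cover : ∀ α β δ : ZMod 7,
    (∀ k, (α = k ∨ -α = k) ∨ (β = k ∨ -β = k) ∨ (-(α + β) = k ∨ α + β = k) ∨ (δ = k ∨ -δ = k)) →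
    α ≠ 0 ∧ δ = 0 ∧ (β = 2 * α ∨ β = 4 * α) := by
  decide

/-- These inequalities decide every condition in `classPart` at the classes where the constant-sum
equations are read off. -/
theorem zmod_five_ne : ∀ α : ZMod 5, α ≠ 0 → -α ≠ 0 ∧ 2 * α ≠ 0 ∧ -(2 * α) ≠ 0 ∧ α ≠ -α ∧
    -α ≠ α ∧ α ≠ 2 * α ∧ 2 * α ≠ α ∧ -α ≠ 2 * α ∧ 2 * α ≠ -α ∧ 2 * α ≠ -(2 * α) ∧
    -(2 * α) ≠ 2 * α ∧ α ≠ -(2 * α) ∧ -(2 * α) ≠ α ∧ 0 ≠ α ∧ 0 ≠ -α ∧ 0 ≠ 2 * α ∧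
    0 ≠ -(2 * α) ∧ -α ≠ -(2 * α) ∧ -(2 * α) ≠ -α := by
  decide

theorem zmod_seven_ne : ∀ α : ZMod 7, α ≠ 0 → -α ≠ 0 ∧ 2 * α ≠ 0 ∧ -(2 * α) ≠ 0 ∧ 4 * α ≠ 0 ∧
    -(4 * α) ≠ 0 ∧ α ≠ -α ∧ -α ≠ α ∧ 2 * α ≠ α ∧ -(2 * α) ≠ α ∧ 4 * α ≠ α ∧ -(4 * α) ≠ α ∧
    2 * α ≠ -α ∧ -(2 * α) ≠ -α ∧ 4 * α ≠ -α ∧ -(4 * α) ≠ -α ∧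
    α ≠ 2 * α ∧ -α ≠ 2 * α ∧ -(2 * α) ≠ 2 * α ∧ 4 * α ≠ 2 * α ∧ -(4 * α) ≠ 2 * α ∧
    α ≠ 4 * α ∧ -α ≠ 4 * α ∧ 2 * α ≠ 4 * α ∧ -(2 * α) ≠ 4 * α ∧ -(4 * α) ≠ 4 * α ∧
    0 ≠ α ∧ 0 ≠ -α ∧ 0 ≠ 2 * α ∧ 0 ≠ 4 * α := by
  decide

theorem stdAddChar_pow_card {d : ℕ} [NeZero d] (x : ZMod d) :
    (ZMod.stdAddChar x : ℂ) ^ d = 1 := by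
  rw [← AddChar.map_nsmul_eq_pow, nsmul_eq_mul, ZMod.natCast_self, zero_mul,
    AddChar.map_zero_eq_one]

theorem stdAddChar_ne_one {d : ℕ} [NeZero d] {x : ZMod d} (hx : x ≠ 0) :
    (ZMod.stdAddChar x : ℂ) ≠ 1 := by
  intro h
  apply hx
  apply ZMod.injective_stdAddChar
  rw [h, AddChar.map_zero_eq_one]

theorem sum_pow_five {g : ℂ} (h5 : g ^ 5 = 1) (h1 : g ≠ 1) :
    1 + g + g ^ 2 + g ^ 3 + g ^ 4 = 0 := by
  have : (g - 1) * (1 + g + g ^ 2 + g ^ 3 + g ^ 4) = 0 := by linear_combination h5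
  exact (mul_eq_zero.1 this).resolve_left (sub_ne_zero.2 h1)

section

variable {a b c z V : ℂ}

/-- The class equations force `V = -1`, `z = 1` and `a = b = c` with `a² + a + 1 = 0`. Up to that
common cube root of unity the sum is `g + g⁻¹ + 1`; this is the source of `(5, 4)`. -/
theorem isTracePair_five_of_pair {g : ℂ} (hg5 : g ^ 5 = 1) (hg1 : g ≠ 1) (ha : a ≠ 0) (hb : b ≠ 0)
    (hc : c ≠ 0) (hz : z ≠ 0) (habc : a * b * c = 1) (e1 : a + b⁻¹ = V) (e2 : a⁻¹ + b = V)
    (e3 : -z = V) (e4 : -z⁻¹ = V) (e0 : c + c⁻¹ = V) :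
    IsTracePair (g ^ 2 * z + (g ^ 2 * z)⁻¹)
      ((g * a + g⁻¹ * b + c) * ((g * a)⁻¹ + (g⁻¹ * b)⁻¹ + c⁻¹)) := by
  have hg : g ≠ 0 := by rintro rfl; norm_num at hg5
  have hV : V ^ 2 = 1 := by
    have : (-z) * (-z⁻¹) = 1 := by field_simp
    rw [e3, e4] at this
    linear_combination this
  have hV0 : V ≠ 0 := by rintro rfl; norm_num at hV
  have f1 : a * b + 1 = V * b := by rw [← e1]; field_simp
  have f2 : a * b + 1 = V * a := by rw [← e2]; field_simp; ring
  have hba : b = a := mul_left_cancel₀ hV0 (by rw [← f1, ← f2])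
  subst hba
  have h3 : b ^ 3 = -V := by linear_combination (V + b) * f1 + b * hV
  have hcb : c = -V * b := by
    have h4 : b ^ 3 * c = b := by linear_combination b * habc
    rw [h3] at h4
    linear_combination (-V) * h4 - c * hV
  have f0 : c ^ 2 + 1 = V * c := by rw [← e0]; field_simp
  have hV1 : V = -1 := by
    have : (V + 1) * b = 0 := by
      rw [hcb] at f0
      linear_combination f0 - f1 + (-b ^ 2 - b) * hV
    have := (mul_eq_zero.1 this).resolve_right hb
    linear_combination this
  subst hV1
  have hz' : z = 1 := by linear_combination -e3
  have hcb' : c = b := by rw [hcb]; ring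
  subst hz' hcb'
  have hs := sum_pow_five hg5 hg1
  have gi : g⁻¹ = g ^ 4 := by field_simp; linear_combination -hg5
  have gi2 : (g ^ 2)⁻¹ = g ^ 3 := by field_simp; linear_combination -hg5
  right; right; right; right; right
  constructor
  · rw [mul_one, gi2]
    linear_combination hs + (g + 2) * hg5
  · rw [mul_one, gi2, mul_inv, mul_inv, inv_inv, gi]
    field_simp
    linear_combination (g ^ 4 + g + 1 - g ^ 2 - g ^ 3) * hs

/-- The class equations force `ab = c = V = 1`, so `z + z⁻¹ = -1` and `N - 2 = g² + g⁻²`; this is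
the source of `(3, 5)`. -/
theorem isTracePair_five_of_double {g : ℂ} (hg5 : g ^ 5 = 1) (hg1 : g ≠ 1) (ha : a ≠ 0)
    (hb : b ≠ 0) (hc : c ≠ 0) (hV0 : V ≠ 0) (habc : a * b * c = 1)
    (e1 : a + b = V) (e2 : a⁻¹ + b⁻¹ = V) (e3 : c = V) (e0 : -(z + z⁻¹) = V) :
    IsTracePair (z + z⁻¹)
      ((g * a + g * b + (g ^ 2)⁻¹ * c) * ((g * a)⁻¹ + (g * b)⁻¹ + ((g ^ 2)⁻¹ * c)⁻¹)) := by
  have hg : g ≠ 0 := by rintro rfl; norm_num at hg5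
  have hab : a * b = 1 := by
    apply mul_left_cancel₀ hV0
    have : b + a = V * (a * b) := by rw [← e2]; field_simp
    linear_combination e1 - this
  have hc1 : c = 1 := by rw [hab] at habc; linear_combination habc
  have hV1 : V = 1 := by rw [← e3, hc1]
  subst hV1
  subst hc1
  have hs := sum_pow_five hg5 hg1
  have gi : g⁻¹ = g ^ 4 := by field_simp; linear_combination -hg5
  have gi2 : (g ^ 2)⁻¹ = g ^ 3 := by field_simp; linear_combination -hg5
  right; right; right; right; left
  refine ⟨by linear_combination -e0, ?_⟩
  have hN : (g * a + g * b + (g ^ 2)⁻¹ * 1) * ((g * a)⁻¹ + (g * b)⁻¹ + ((g ^ 2)⁻¹ * 1)⁻¹) - 2 =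
      g ^ 3 + g ^ 2 := by
    have i1 : g * a + g * b + (g ^ 2)⁻¹ * 1 = g + g ^ 3 := by
      rw [gi2]; linear_combination g * e1
    have i2 : (g * a)⁻¹ + (g * b)⁻¹ + ((g ^ 2)⁻¹ * 1)⁻¹ = g ^ 4 + g ^ 2 := by
      rw [mul_inv, mul_inv, mul_one, inv_inv, gi]
      linear_combination g ^ 4 * e2
    rw [i1, i2]
    linear_combination (g ^ 2 + 2) * hg5
  rw [hN]
  linear_combination hs + (g + 2) * hg5

/-- Constant nonzero coset sums only occur for the primes `5` and `7`. -/
theorem isTracePair_of_constant_classes {p : ℕ} [hp : Fact p.Prime] {α β γ δ : ZMod p}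
    (hp2 : p ≠ 2) (hp3 : p ≠ 3) (ha : a ≠ 0) (hb : b ≠ 0) (hc : c ≠ 0) (hz : z ≠ 0)
    (hV0 : V ≠ 0) (habc : a * b * c = 1) (hχ : α + β + γ = 0)
    (H : ∀ k, classPart k α a + classPart k β b + classPart k γ c - classPart k δ z = V)
    {A B C Z : ℂ} (hA : A = ZMod.stdAddChar α * a) (hB : B = ZMod.stdAddChar β * b)
    (hC : C = ZMod.stdAddChar γ * c) (hZ : Z = ZMod.stdAddChar δ * z) :
    IsTracePair (Z + Z⁻¹) ((A + B + C) * (A⁻¹ + B⁻¹ + C⁻¹)) := by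
  have hγ : γ = -(α + β) := by linear_combination hχ
  have hcov : ∀ k, (α = k ∨ -α = k) ∨ (β = k ∨ -β = k) ∨ (-(α + β) = k ∨ α + β = k) ∨
      (δ = k ∨ -δ = k) := by
    intro k
    by_contra hk
    push Not at hk
    apply hV0
    rw [← H k, classPart_of_ne a hk.1.1 hk.1.2, classPart_of_ne b hk.2.1.1 hk.2.1.2,
      classPart_of_ne c (by rw [hγ]; exact hk.2.2.1.1) (by rw [hγ, neg_neg]; exact hk.2.2.1.2),
      classPart_of_ne z hk.2.2.2.1 hk.2.2.2.2]
    ring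
  -- The eight classes of the terms exhaust `ZMod p`.
  have hp8 : p ≤ 8 := by
    have h1 : (Finset.univ : Finset (ZMod p)) ⊆
        {α, -α, β, -β, -(α + β), α + β, δ, -δ} := by
      intro k _
      have := hcov k
      simp only [Finset.mem_insert, Finset.mem_singleton]
      tauto
    have h2 := Finset.card_le_card h1
    rw [Finset.card_univ, ZMod.card] at h2
    exact h2.trans <| (Finset.card_insert_le _ _).trans <| Nat.succ_le_succ <|
      (Finset.card_insert_le _ _).trans <| Nat.succ_le_succ Finset.card_le_six
  have hp57 : p = 5 ∨ p = 7 := by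
    have := hp.out
    interval_cases p <;> first | (exfalso; revert this; norm_num; done) | tauto
  have Einv : ∀ x : ZMod p, (ZMod.stdAddChar (-x) : ℂ) = (ZMod.stdAddChar x)⁻¹ := fun x => by
    rw [AddChar.map_neg_eq_inv]
  have E2 : ∀ x : ZMod p, (ZMod.stdAddChar (2 * x) : ℂ) = (ZMod.stdAddChar x) ^ 2 := fun x => by
    rw [two_mul, AddChar.map_add_eq_mul, sq]
  have E0 : (ZMod.stdAddChar (0 : ZMod p) : ℂ) = 1 := AddChar.map_zero_eq_one _
  rcases hp57 with rfl | rfl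
  · have pair : ∀ (α δ : ZMod 5) (a b c z : ℂ), α ≠ 0 → a ≠ 0 → b ≠ 0 → c ≠ 0 → z ≠ 0 →
        a * b * c = 1 → δ = 2 * α →
        (∀ k, classPart k α a + classPart k (-α) b + classPart k 0 c - classPart k δ z = V) →
        IsTracePair ((ZMod.stdAddChar δ * z) + (ZMod.stdAddChar δ * z)⁻¹)
          ((ZMod.stdAddChar α * a + ZMod.stdAddChar (-α) * b + c) *
          ((ZMod.stdAddChar α * a)⁻¹ + (ZMod.stdAddChar (-α) * b)⁻¹ + c⁻¹)) := by
      intro α δ a b c z hα ha hb hc hz habc hδ H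
      subst hδ
      rw [Einv, E2]
      obtain ⟨n1, n2, n3, n4, n5, n6, n7, n8, n9, n10, n11, n12, n13, n14, n15, n16, n17, n18,
        n19⟩ := zmod_five_ne α hα
      refine isTracePair_five_of_pair (V := V) (stdAddChar_pow_card α) (stdAddChar_ne_one hα)
        ha hb hc hz habc ?_ ?_ ?_ ?_ ?_
      · rw [← H α]; simp only [classPart, neg_neg, neg_zero]; simp [*]
      · rw [← H (-α)]; simp only [classPart, neg_neg, neg_zero]; simp [*]
      · rw [← H (2 * α)]; simp only [classPart, neg_neg, neg_zero]; simp [*]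
      · rw [← H (-(2 * α))]; simp only [classPart, neg_neg, neg_zero]; simp [*]
      · rw [← H 0]; simp only [classPart, neg_neg, neg_zero]; simp [*]
    have pair' : ∀ (α δ : ZMod 5) (a b c z : ℂ), α ≠ 0 → a ≠ 0 → b ≠ 0 → c ≠ 0 → z ≠ 0 →
        a * b * c = 1 → (δ = 2 * α ∨ -δ = 2 * α) →
        (∀ k, classPart k α a + classPart k (-α) b + classPart k 0 c - classPart k δ z = V) →
        IsTracePair ((ZMod.stdAddChar δ * z) + (ZMod.stdAddChar δ * z)⁻¹)
          ((ZMod.stdAddChar α * a + ZMod.stdAddChar (-α) * b + c) *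
          ((ZMod.stdAddChar α * a)⁻¹ + (ZMod.stdAddChar (-α) * b)⁻¹ + c⁻¹)) := by
      intro α δ a b c z hα ha hb hc hz habc hδ H
      rcases hδ with hδ | hδ
      · exact pair α δ a b c z hα ha hb hc hz habc hδ H
      · have h1 := pair α (-δ) a b c z⁻¹ hα ha hb hc (inv_ne_zero hz) habc hδ
          (fun k => by rw [classPart_neg_inv]; exact H k)
        rw [Einv δ, ← mul_inv, inv_inv, add_comm] at h1
        exact h1
    have double : ∀ (α γ : ZMod 5) (a b c z : ℂ), α ≠ 0 → a ≠ 0 → b ≠ 0 → c ≠ 0 →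
        a * b * c = 1 → γ = -(2 * α) →
        (∀ k, classPart k α a + classPart k α b + classPart k γ c - classPart k 0 z = V) →
        IsTracePair (z + z⁻¹)
          ((ZMod.stdAddChar α * a + ZMod.stdAddChar α * b + ZMod.stdAddChar γ * c) *
          ((ZMod.stdAddChar α * a)⁻¹ + (ZMod.stdAddChar α * b)⁻¹ +
            (ZMod.stdAddChar γ * c)⁻¹)) := by
      intro α γ a b c z hα ha hb hc habc hγ H
      subst hγ
      rw [Einv, E2]
      obtain ⟨n1, n2, n3, n4, n5, n6, n7, n8, n9, n10, n11, n12, n13, n14, n15, n16, n17, n18,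
        n19⟩ := zmod_five_ne α hα
      refine isTracePair_five_of_double (V := V) (stdAddChar_pow_card α) (stdAddChar_ne_one hα)
        ha hb hc hV0 habc ?_ ?_ ?_ ?_
      · rw [← H α]; simp only [classPart, neg_neg, neg_zero]; simp [*]
      · rw [← H (-α)]; simp only [classPart, neg_neg, neg_zero]; simp [*]
      · rw [← H (-(2 * α))]; simp only [classPart, neg_neg, neg_zero]; simp [*]
      · rw [← H 0]; simp only [classPart, neg_neg, neg_zero]; simp [*]
    rcases zmod_five_cover α β δ hcov with ⟨h1, h2, h3⟩ | ⟨h1, h2, h3⟩ | ⟨h1, h2, h3⟩ |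
      ⟨h1, h2, h3⟩ | ⟨h1, h2, h3⟩ | ⟨h1, h2, h3⟩
    · have hγ0 : γ = 0 := by rw [hγ, h2]; ring
      subst h2 hγ0
      rw [E0, one_mul] at hC
      rw [hA, hB, hC, hZ]
      exact pair' α δ a b c z h1 ha hb hc hz habc h3 H
    · have hγ0 : γ = -β := by rw [hγ, h2]; ring
      subst h2 hγ0
      rw [E0, one_mul] at hA
      rw [hA, hB, hC, hZ]
      convert pair' β δ b c a z h1 hb hc ha hz (by linear_combination habc) h3
        (fun k => by rw [← H k]; ring) using 1
      ring
    · have hγ0 : γ = -α := by rw [hγ, h2]; ring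
      subst h2 hγ0
      rw [E0, one_mul] at hB
      rw [hA, hB, hC, hZ]
      convert pair' α δ a c b z h1 ha hc hb hz (by linear_combination habc) h3
        (fun k => by rw [← H k]; ring) using 1
      ring
    · subst h2 h3
      rw [E0, one_mul] at hZ
      rw [hA, hB, hC, hZ]
      exact double β γ a b c z h1 ha hb hc habc (by rw [hγ]; ring) H
    · rw [← hγ] at h2
      subst h2 h3
      rw [E0, one_mul] at hZ
      rw [hA, hB, hC, hZ]
      convert double γ β a c b z h1 ha hc hb (by linear_combination habc)
        (by linear_combination hχ) (fun k => by rw [← H k]; ring) using 1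
      ring
    · rw [← hγ] at h2
      subst h2 h3
      rw [E0, one_mul] at hZ
      rw [hA, hB, hC, hZ]
      convert double γ α b c a z h1 hb hc ha (by linear_combination habc)
        (by linear_combination hχ) (fun k => by rw [← H k]; ring) using 1
      ring
  · have main : ∀ (α β γ : ZMod 7) (a b c z : ℂ), α ≠ 0 → a ≠ 0 → b ≠ 0 → c ≠ 0 →
        a * b * c = 1 → β = 2 * α → γ = 4 * α →
        (∀ k, classPart k α a + classPart k β b + classPart k γ c - classPart k 0 z = V) →
        IsTracePair (z + z⁻¹)
          ((ZMod.stdAddChar α * a + ZMod.stdAddChar β * b + ZMod.stdAddChar γ * c) *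
          ((ZMod.stdAddChar α * a)⁻¹ + (ZMod.stdAddChar β * b)⁻¹ +
            (ZMod.stdAddChar γ * c)⁻¹)) := by
      intro α β γ a b c z hα ha hb hc habc hβ hγ H
      have hg7 := stdAddChar_pow_card α
      have hg1 := stdAddChar_ne_one hα
      have E4 : (ZMod.stdAddChar (4 * α) : ℂ) = (ZMod.stdAddChar α) ^ 4 := by
        rw [show 4 * α = 2 * (2 * α) by ring, E2, E2]; ring
      subst hβ hγ
      rw [E2, E4]
      generalize (ZMod.stdAddChar α : ℂ) = g at hg7 hg1
      obtain ⟨n1, n2, n3, n4, n5, n6, n7, n8, n9, n10, n11, n12, n13, n14, n15, n16, n17, n18,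
        n19, n20, n21, n22, n23, n24, n25, n26, n27, n28, n29⟩ := zmod_seven_ne α hα
      -- Each nonzero class modulo `7` holds a single term. Both `a` and `a⁻¹` equal `V`, so `V² =
      -- 1`, and `abc = 1` selects `V = 1`. The sum becomes `g + g² + g⁴`, the source of `(3, 4)`.
      have e1 : a = V := by
        rw [← H α]; simp only [classPart, neg_zero]; simp [*]
      have e2 : a⁻¹ = V := by
        rw [← H (-α)]; simp only [classPart, neg_zero]; simp [*]
      have e3 : b = V := by
        rw [← H (2 * α)]; simp only [classPart, neg_zero]; simp [*]
      have e4 : c = V := by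
        rw [← H (4 * α)]; simp only [classPart, neg_zero]; simp [*]
      have e0 : -(z + z⁻¹) = V := by
        rw [← H 0]; simp only [classPart, neg_zero]; simp [*]
      have hV2 : V * V = 1 := by
        nth_rewrite 1 [← e1]; rw [← e2, mul_inv_cancel₀ ha]
      have hV1 : V = 1 := by
        rw [e1, e3, e4, hV2] at habc; linear_combination habc
      rw [hV1] at e1 e3 e4 e0
      subst e1 e3 e4
      have hg : g ≠ 0 := by rintro rfl; norm_num at hg7
      have hs : 1 + g + g ^ 2 + g ^ 3 + g ^ 4 + g ^ 5 + g ^ 6 = 0 := by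
        have : (g - 1) * (1 + g + g ^ 2 + g ^ 3 + g ^ 4 + g ^ 5 + g ^ 6) = 0 := by
          linear_combination hg7
        exact (mul_eq_zero.1 this).resolve_left (sub_ne_zero.2 hg1)
      have gi : g⁻¹ = g ^ 6 := by field_simp; linear_combination -hg7
      have gi2 : (g ^ 2)⁻¹ = g ^ 5 := by field_simp; linear_combination -hg7
      have gi4 : (g ^ 4)⁻¹ = g ^ 3 := by field_simp; linear_combination -hg7
      right; right; right; left
      refine ⟨by linear_combination -e0, ?_⟩
      rw [mul_one, mul_one, mul_one, gi, gi2, gi4]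
      linear_combination hs + (g ^ 3 + g ^ 2 + g + 3) * hg7
    obtain ⟨h1, h2, h3 | h3⟩ := zmod_seven_cover α β δ hcov
    · subst h2
      rw [E0, one_mul] at hZ
      rw [hA, hB, hC, hZ]
      have h7 : (7 : ZMod 7) = 0 := rfl
      exact main α β γ a b c z h1 ha hb hc habc h3
        (by linear_combination hχ - h3 - α * h7) H
    · subst h2
      rw [E0, one_mul] at hZ
      rw [hA, hB, hC, hZ]
      have h7 : (7 : ZMod 7) = 0 := rfl
      convert main α γ β a c b z h1 ha hc hb (by linear_combination habc)
        (by linear_combination hχ - h3 - α * h7) h3 (fun k => by rw [← H k]; ring) using 1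
      ring

end

/-! ### The trace equation: descent on the order -/

theorem inv_pow_eq_one {x : ℂ} {Q : ℕ} (hx : x ^ Q = 1) : x⁻¹ ^ Q = 1 := by
  rw [inv_pow, hx, inv_one]

theorem map_inv_of_additive {Q d : ℕ} (hQ : Q ≠ 0) {χ : ℂ → ZMod d}
    (hadd : ∀ x y, x ^ Q = 1 → y ^ Q = 1 → χ (x * y) = χ x + χ y) {x : ℂ} (hx : x ^ Q = 1) :
    χ x⁻¹ = -χ x := by
  have hx0 : x ≠ 0 := by rintro rfl; rw [zero_pow hQ] at hx; exact zero_ne_one hx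
  have h1 := hadd 1 1 (one_pow Q) (one_pow Q)
  have h2 := hadd x x⁻¹ hx (inv_pow_eq_one hx)
  rw [mul_inv_cancel₀ hx0] at h2
  rw [mul_one] at h1
  linear_combination -h1 - h2

theorem map_add_add_of_additive {Q d : ℕ} {χ : ℂ → ZMod d}
    (hadd : ∀ x y, x ^ Q = 1 → y ^ Q = 1 → χ (x * y) = χ x + χ y) {a b c : ℂ} (ha : a ^ Q = 1)
    (hb : b ^ Q = 1) (hc : c ^ Q = 1) (habc : a * b * c = 1) : χ a + χ b + χ c = 0 := by
  have h1 := hadd 1 1 (one_pow Q) (one_pow Q)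
  rw [mul_one] at h1
  have h2 := hadd (a * b) c (by rw [mul_pow, ha, hb, one_mul]) hc
  rw [habc, hadd a b ha hb] at h2
  linear_combination -h1 - h2

section

variable {a b c z : ℂ} {Q d q : ℕ}

theorem exists_class_relation [NeZero d] (hQ : Q ≠ 0) (hdq : Q = d * q)
    (hcop : ∀ j : ℕ, (1 + j * q).Coprime Q) (ha : a ^ Q = 1) (hb : b ^ Q = 1) (hc : c ^ Q = 1)
    (hz : z ^ Q = 1) (hrel : a + a⁻¹ + (b + b⁻¹) + (c + c⁻¹) = z + z⁻¹) :
    ∃ χ : ℂ → ZMod d,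
      (∀ x y, x ^ Q = 1 → y ^ Q = 1 → χ (x * y) = χ x + χ y) ∧
      (∀ x, x ^ Q = 1 → (χ x = 0 ↔ x ^ q = 1)) ∧
      ∀ k, classPart k (χ a) a + classPart k (χ b) b + classPart k (χ c) c =
        classPart k (χ z) z := by
  obtain ⟨χ, hadd, hker, hsplit⟩ := exists_splitting_of_coprime hQ hdq hcop
  refine ⟨χ, hadd, hker, fun k => ?_⟩
  have h := hsplit (ι := Fin 8) ![1, 1, 1, 1, 1, 1, -1, -1]
    ![a, a⁻¹, b, b⁻¹, c, c⁻¹, z, z⁻¹] (by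
      intro i
      fin_cases i <;> simp [ha, hb, hc, hz]) (by
      simp [Fin.sum_univ_eight]
      linear_combination hrel) k
  simp only [Fin.sum_univ_eight, Matrix.cons_val] at h
  simp only [map_inv_of_additive hQ hadd ha, map_inv_of_additive hQ hadd hb,
    map_inv_of_additive hQ hadd hc, map_inv_of_additive hQ hadd hz] at h
  simp only [classPart]
  push_cast at h
  simp only [one_mul, neg_mul] at h
  have e1 : (if χ z = k then -z else 0) = -(if χ z = k then z else 0) := by split_ifs <;> simp
  have e2 : (if -χ z = k then -z⁻¹ else 0) = -(if -χ z = k then z⁻¹ else 0) := by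
    split_ifs <;> simp
  rw [e1, e2] at h
  linear_combination h

/-- The step of the descent at an odd prime. -/
theorem isTracePair_or_descend_odd {p : ℕ} [hp : Fact p.Prime] (hQ : Q ≠ 0) (hpq : Q = p * q)
    (hp2 : p ≠ 2) (hp3 : p ≠ 3 ∨ p ∣ q) (ha : a ^ Q = 1) (hb : b ^ Q = 1) (hc : c ^ Q = 1)
    (hz : z ^ Q = 1) (habc : a * b * c = 1) (hz1 : z ≠ -1)
    (hrel : a + a⁻¹ + (b + b⁻¹) + (c + c⁻¹) = z + z⁻¹) :
    IsTracePair (z + z⁻¹) ((a + b + c) * (a⁻¹ + b⁻¹ + c⁻¹)) ∨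
      (a ^ q = 1 ∧ b ^ q = 1 ∧ c ^ q = 1 ∧ z ^ q = 1) := by
  have hne : ∀ {x : ℂ}, x ^ Q = 1 → x ≠ 0 := by
    rintro x hx rfl
    rw [zero_pow hQ] at hx
    exact zero_ne_one hx
  by_cases hdvd : p ∣ q
  · have hcop : ∀ j : ℕ, (1 + j * q).Coprime Q := by
      intro j
      rw [hpq]
      refine Nat.Coprime.mul_right ?_ (by simp)
      obtain ⟨q', rfl⟩ := hdvd
      rw [show 1 + j * (p * q') = 1 + j * q' * p by ring]
      simp
    obtain ⟨χ, hadd, hker, H⟩ := exists_class_relation hQ hpq hcop ha hb hc hz hrel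
    by_cases h0 : χ a = 0 ∧ χ b = 0 ∧ χ c = 0 ∧ χ z = 0
    · right
      exact ⟨(hker a ha).1 h0.1, (hker b hb).1 h0.2.1, (hker c hc).1 h0.2.2.1,
        (hker z hz).1 h0.2.2.2⟩
    · left
      exact isTracePair_of_vanishing_classes hp2 (hne ha) (hne hb) (hne hc) (hne hz) habc hz1 hrel
        (map_add_add_of_additive hadd ha hb hc habc) H h0
  · have hp3' : p ≠ 3 := hp3.resolve_right hdvd
    have hcop : p.Coprime q := (hp.out.coprime_iff_not_dvd).2 hdvd
    obtain ⟨χ, h, hadd, hker, hdec, hsplit⟩ := exists_splitting_of_prime hQ hpq hcop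
    by_cases h0 : χ a = 0 ∧ χ b = 0 ∧ χ c = 0 ∧ χ z = 0
    · right
      exact ⟨hker a ha h0.1, hker b hb h0.2.1, hker c hc h0.2.2.1, hker z hz h0.2.2.2⟩
    left
    obtain ⟨V, hV⟩ := hsplit (ι := Fin 8) ![1, 1, 1, 1, 1, 1, -1, -1]
      ![a, a⁻¹, b, b⁻¹, c, c⁻¹, z, z⁻¹] (by
        intro i
        fin_cases i <;> simp [ha, hb, hc, hz]) (by
        simp [Fin.sum_univ_eight]
        linear_combination hrel)
    have H : ∀ k, classPart k (χ a) (a ^ h) + classPart k (χ b) (b ^ h) +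
        classPart k (χ c) (c ^ h) - classPart k (χ z) (z ^ h) = V := by
      intro k
      have h := hV k
      simp only [Fin.sum_univ_eight, Matrix.cons_val] at h
      simp only [map_inv_of_additive hQ hadd ha, map_inv_of_additive hQ hadd hb,
        map_inv_of_additive hQ hadd hc, map_inv_of_additive hQ hadd hz] at h
      simp only [classPart]
      push_cast at h
      simp only [one_mul, neg_mul, inv_pow] at h
      have e1 : ∀ (P : Prop) [Decidable P] (x : ℂ),
          (if P then -x else 0) = -(if P then x else 0) := by
        intro P _ x; split_ifs <;> simp
      rw [e1, e1] at h
      linear_combination h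
    have hχ := map_add_add_of_additive hadd ha hb hc habc
    by_cases hV0 : V = 0
    · subst hV0
      -- Within the class `k` the removed `p`-th root of unity is constant, so vanishing of the
      -- reduced class sums is vanishing of the original ones.
      have hE : ∀ (k : ZMod p) {x : ℂ}, x ^ Q = 1 →
          classPart k (χ x) x = ZMod.stdAddChar k * classPart k (χ x) (x ^ h) := by
        intro k x hx
        have h1 := hdec x hx
        have h2 : x⁻¹ = ZMod.stdAddChar (-χ x) * (x ^ h)⁻¹ := by
          conv_lhs => rw [h1]
          rw [mul_inv, AddChar.map_neg_eq_inv]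
        simp only [classPart, mul_add, mul_ite, mul_zero]
        congr 1
        · split_ifs with hk
          · rw [← hk]; exact h1
          · rfl
        · split_ifs with hk
          · rw [← hk]; exact h2
          · rfl
      refine isTracePair_of_vanishing_classes hp2 (hne ha) (hne hb) (hne hc) (hne hz) habc hz1 hrel
        hχ (fun k => ?_) h0
      rw [hE k ha, hE k hb, hE k hc, hE k hz]
      linear_combination ZMod.stdAddChar k * H k
    · exact isTracePair_of_constant_classes hp2 hp3' (pow_ne_zero h (hne ha))
        (pow_ne_zero h (hne hb)) (pow_ne_zero h (hne hc)) (pow_ne_zero h (hne hz)) hV0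
        (by rw [← mul_pow, ← mul_pow, habc, one_pow]) hχ H (hdec a ha) (hdec b hb) (hdec c hc)
        (hdec z hz)

/-- Here `y² = ab = c⁻¹` and `c² = -1`, so `y` is a primitive eighth root of unity and `N = 2 + y³ +
y⁻³ = 2 - (y + y⁻¹)`. This is the source of `(8, 6)`. -/
theorem isTracePair_of_sum_eq {y : ℂ} (ha : a ≠ 0) (hb : b ≠ 0) (hc : c ≠ 0) (hy : y ≠ 0)
    (habc : a * b * c = 1) (h1 : a + b = y) (h2 : a⁻¹ + b⁻¹ = y⁻¹) (h3 : c + c⁻¹ = 0) :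
    IsTracePair (y + y⁻¹) ((a + b + c) * (a⁻¹ + b⁻¹ + c⁻¹)) := by
  have hc2 : c ^ 2 = -1 := by field_simp at h3; linear_combination h3
  have hy2 : y ^ 2 = a * b := by
    field_simp at h2
    rw [← h1] at h2 ⊢
    linear_combination h2
  have hyc : y ^ 2 * c = 1 := by rw [hy2]; exact habc
  have hyi : y⁻¹ = y * c := by field_simp; linear_combination -hyc
  have hci : c⁻¹ = y ^ 2 := by field_simp; linear_combination -hyc
  right; right; left
  constructor
  · rw [hyi]
    rw [hci] at h3
    linear_combination (2 + c) * hyc + h3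
  · rw [h1, h2, hci, hyi]
    rw [hci] at h3
    linear_combination hyc * (2 + y) + y * h3 - y * hyc + y * hc2

/-- Modulo `4` the classes of `a, b, z` are odd and that of `c` is even. The sums over the classes
`1` and `3` therefore relate one of `a^{±1}`, one of `b^{±1}` and one of `z^{±1}`: up to inversion,
either `a + b = z` or the impossible `a + b⁻¹ = z`. -/
theorem isTracePair_of_four_dvd_div_two (hQ : Q ≠ 0) (hdq : Q = 4 * q) (hq : 2 ∣ q)
    (ha : a ^ Q = 1) (hb : b ^ Q = 1) (hc : c ^ Q = 1) (hz : z ^ Q = 1) (habc : a * b * c = 1)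
    (ha2 : a ^ (2 * q) ≠ 1) (hb2 : b ^ (2 * q) ≠ 1) (hc2 : c ^ (2 * q) = 1)
    (hz2 : z ^ (2 * q) ≠ 1) (hci : c + c⁻¹ = 0)
    (hrel : a + a⁻¹ + (b + b⁻¹) + (c + c⁻¹) = z + z⁻¹) :
    IsTracePair (z + z⁻¹) ((a + b + c) * (a⁻¹ + b⁻¹ + c⁻¹)) := by
  have hne : ∀ {x : ℂ}, x ^ Q = 1 → x ≠ 0 := by
    rintro x hx rfl
    rw [zero_pow hQ] at hx
    exact zero_ne_one hx
  have hcop : ∀ j : ℕ, (1 + j * q).Coprime Q := by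
    intro j
    rw [hdq]
    refine Nat.Coprime.mul_right ?_ (by simp)
    obtain ⟨q', rfl⟩ := hq
    rw [show 1 + j * (2 * q') = 1 + j * q' * 2 by ring, show 4 = 2 ^ 2 by norm_num]
    exact Nat.Coprime.pow_right 2 (by simp)
  obtain ⟨χ, hadd, hker, H⟩ := exists_class_relation hQ hdq hcop ha hb hc hz hrel
  have hχ := map_add_add_of_additive hadd ha hb hc habc
  have hdouble : ∀ {x : ℂ}, x ^ Q = 1 → (χ x + χ x = 0 ↔ x ^ (2 * q) = 1) := by
    intro x hx
    rw [← hadd x x hx hx, hker (x * x) (by rw [mul_pow, hx, one_mul]), pow_mul, sq]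
  have hodd : ∀ k : ZMod 4, k + k ≠ 0 → k = 1 ∨ k = 3 := by decide
  have hα := hodd _ (fun h => ha2 ((hdouble ha).1 h))
  have hβ := hodd _ (fun h => hb2 ((hdouble hb).1 h))
  have hδ := hodd _ (fun h => hz2 ((hdouble hz).1 h))
  have hγ : χ c = 0 ∨ χ c = 2 := by
    have : ∀ k : ZMod 4, k + k = 0 → k = 0 ∨ k = 2 := by decide
    exact this _ ((hdouble hc).2 hc2)
  have c11 : ∀ x, classPart (1 : ZMod 4) 1 x = x := fun x => classPart_self x rfl (by decide)
  have c13 : ∀ x, classPart (1 : ZMod 4) 3 x = x⁻¹ := fun x =>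
    classPart_neg x (by decide) (by decide)
  have c33 : ∀ x, classPart (3 : ZMod 4) 3 x = x := fun x => classPart_self x rfl (by decide)
  have c31 : ∀ x, classPart (3 : ZMod 4) 1 x = x⁻¹ := fun x =>
    classPart_neg x (by decide) (by decide)
  have cγ1 : classPart (1 : ZMod 4) (χ c) c = 0 := by
    rcases hγ with h | h <;> rw [h] <;> exact classPart_of_ne _ (by decide) (by decide)
  have cγ3 : classPart (3 : ZMod 4) (χ c) c = 0 := by
    rcases hγ with h | h <;> rw [h] <;> exact classPart_of_ne _ (by decide) (by decide)
  have H1 := H 1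
  have H3 := H 3
  rw [cγ1, add_zero] at H1
  rw [cγ3, add_zero] at H3
  have hzi : z⁻¹ + z⁻¹⁻¹ = z + z⁻¹ := by rw [inv_inv, add_comm]
  have done := fun {y : ℂ} (hy : y ≠ 0) (h1 : a + b = y) (h2 : a⁻¹ + b⁻¹ = y⁻¹) =>
    isTracePair_of_sum_eq (hne ha) (hne hb) (hne hc) hy habc h1 h2 hci
  have contra := fun {y : ℂ} (hy : y ≠ 0) (h1 : a + b⁻¹ = y) (h2 : a⁻¹ + b = y⁻¹) =>
    not_sum_eq_of_sq_eq_neg_one (hne ha) (hne hb) (hne hc) hy habc h1 h2 hci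
  have hz0 := hne hz
  have hz0' := inv_ne_zero hz0
  rcases hα with hα | hα <;> rcases hβ with hβ | hβ <;> rcases hδ with hδ | hδ <;>
    simp only [hα, hβ, hδ, c11, c13, c31, c33] at H1 H3
  · exact done hz0 H1 H3
  · rw [← hzi]; exact done hz0' H1 (by rw [inv_inv]; exact H3)
  · exact (contra hz0 H1 H3).elim
  · exact (contra hz0' H1 (by rw [inv_inv]; exact H3)).elim
  · exact (contra hz0' H3 (by rw [inv_inv]; exact H1)).elim
  · exact (contra hz0 H3 H1).elim
  · rw [← hzi]; exact done hz0' H3 (by rw [inv_inv]; exact H1)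
  · exact done hz0 H3 H1

/-- The step of the descent at the prime two. -/
theorem isTracePair_or_descend_two (hQ : Q ≠ 0) (hdq : Q = 2 * q) (hq : 2 ∣ q)
    (ha : a ^ Q = 1) (hb : b ^ Q = 1) (hc : c ^ Q = 1) (hz : z ^ Q = 1) (habc : a * b * c = 1)
    (hz1 : z ≠ -1) (hrel : a + a⁻¹ + (b + b⁻¹) + (c + c⁻¹) = z + z⁻¹) :
    IsTracePair (z + z⁻¹) ((a + b + c) * (a⁻¹ + b⁻¹ + c⁻¹)) ∨
      (a ^ q = 1 ∧ b ^ q = 1 ∧ c ^ q = 1 ∧ (z ^ q = 1 ∨ z ^ 2 = -1)) := by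
  have hne : ∀ {x : ℂ}, x ^ Q = 1 → x ≠ 0 := by
    rintro x hx rfl
    rw [zero_pow hQ] at hx
    exact zero_ne_one hx
  have hcop : ∀ j : ℕ, (1 + j * q).Coprime Q := by
    intro j
    rw [hdq]
    refine Nat.Coprime.mul_right ?_ (by simp)
    obtain ⟨q', rfl⟩ := hq
    rw [show 1 + j * (2 * q') = 1 + j * q' * 2 by ring]
    simp
  obtain ⟨χ, hadd, hker, H⟩ := exists_class_relation hQ hdq hcop ha hb hc hz hrel
  have hχ := map_add_add_of_additive hadd ha hb hc habc
  have c00 : ∀ x, classPart (0 : ZMod 2) 0 x = x + x⁻¹ := fun x => classPart_zero_zero x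
  have c01 : ∀ x, classPart (0 : ZMod 2) 1 x = 0 := fun x =>
    classPart_of_ne x (by decide) (by decide)
  have c10 : ∀ x, classPart (1 : ZMod 2) 0 x = 0 := fun x =>
    classPart_of_ne x (by decide) (by decide)
  have H0 := H 0
  have H1 := H 1
  have hz0 := hne hz
  have sq_neg_one : ∀ {x : ℂ}, x ≠ 0 → x + x⁻¹ = 0 → x ^ 2 = -1 := by
    intro x hx h
    field_simp at h
    linear_combination h
  have main : ∀ a b c : ℂ, a ^ Q = 1 → b ^ Q = 1 → c ^ Q = 1 → a * b * c = 1 →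
      a + a⁻¹ + (b + b⁻¹) + (c + c⁻¹) = z + z⁻¹ → χ a = 1 → χ b = 1 → χ c = 0 →
      (∀ k, classPart k (χ a) a + classPart k (χ b) b + classPart k (χ c) c =
        classPart k (χ z) z) →
      IsTracePair (z + z⁻¹) ((a + b + c) * (a⁻¹ + b⁻¹ + c⁻¹)) := by
    intro a b c ha hb hc habc hrel hα hβ hγ H
    have H0 := H 0
    have hz2 : ∀ k : ZMod 2, k = 0 ∨ k = 1 := by decide
    rcases hz2 (χ z) with hδ | hδ
    · rw [hα, hβ, hγ, hδ, c00, c00, c01, c01, zero_add, zero_add] at H0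
      have h1 : a + a⁻¹ + (b + b⁻¹) = 0 := by linear_combination hrel - H0
      have h2 := isTracePair_of_cancel (hne hc) (hne ha) (hne hb) hz0
        (by linear_combination habc) hz1 h1 H0
      convert h2 using 1
      ring
    · rw [hα, hβ, hγ, hδ, c00, c01, c01, c01, zero_add, zero_add] at H0
      have hcq : c ^ q = 1 := (hker c hc).1 hγ
      have hc2 := sq_neg_one (hne hc) H0
      -- Since `c` has order `4`, the order `Q` is divisible by `8`. This permits a finer splitting
      -- into four classes.
      have h4 : 4 ∣ q := by
        have h5 : orderOf c = 4 := by
          refine orderOf_eq_prime_pow (p := 2) (n := 1) ?_ ?_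
          · rw [pow_one, hc2]; norm_num
          · rw [show 2 ^ (1 + 1) = 2 * 2 by norm_num, pow_mul, hc2]; norm_num
        rw [← h5]
        exact orderOf_dvd_of_pow_eq_one hcq
      obtain ⟨r, hr⟩ := h4
      have hq2 : q = 2 * (2 * r) := by rw [hr]; ring
      have hn : ∀ {x : ℂ}, x ^ Q = 1 → χ x = 1 → x ^ (2 * (2 * r)) ≠ 1 := by
        intro x hx h1 h
        rw [← hq2, ← hker x hx, h1] at h
        exact one_ne_zero h
      exact isTracePair_of_four_dvd_div_two hQ (q := 2 * r) (by rw [hdq, hr]; ring)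
        (dvd_mul_right 2 r) ha hb hc hz habc (hn ha hα) (hn hb hβ) (by rw [← hq2]; exact hcq)
        (hn hz hδ) H0 hrel
  have cases : ∀ α β γ : ZMod 2, α + β + γ = 0 → (α = 0 ∧ β = 0 ∧ γ = 0) ∨
      (α = 1 ∧ β = 1 ∧ γ = 0) ∨ (β = 1 ∧ γ = 1 ∧ α = 0) ∨ (γ = 1 ∧ α = 1 ∧ β = 0) := by decide
  rcases cases _ _ _ hχ with ⟨h1, h2, h3⟩ | ⟨h1, h2, h3⟩ | ⟨h1, h2, h3⟩ | ⟨h1, h2, h3⟩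
  · right
    refine ⟨(hker a ha).1 h1, (hker b hb).1 h2, (hker c hc).1 h3, ?_⟩
    have hz2 : ∀ k : ZMod 2, k = 0 ∨ k = 1 := by decide
    rcases hz2 (χ z) with hδ | hδ
    · exact Or.inl ((hker z hz).1 hδ)
    · right
      -- The trivial class now contains all of `a, b, c` and not `z`, so both sides of the trace
      -- equation vanish. This is why the induction carries the alternative `z² = -1`.
      rw [h1, h2, h3, hδ, c00, c00, c00, c01] at H0
      exact sq_neg_one hz0 (by rw [← hrel, H0])
  · exact Or.inl (main a b c ha hb hc habc hrel h1 h2 h3 H)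
  · left
    convert main b c a hb hc ha (by linear_combination habc) (by linear_combination hrel) h1 h2 h3
      (fun k => by rw [← H k]; ring) using 1
    ring
  · left
    convert main c a b hc ha hb (by linear_combination habc) (by linear_combination hrel) h1 h2 h3
      (fun k => by rw [← H k]; ring) using 1
    ring

/-- Here `w` is a primitive sixth root of unity, `a'` and `b'` stand for the inverses, and `a' b'`
plays the part of `c`. A finite check suffices. -/
theorem trace_pair_of_sixth_roots {w t a a' b b' : ℂ} (hw : w ^ 2 = w - 1)
    (ht : t = 1 ∨ t = -1 ∨ t = 0)
    (ha : (a = 1 ∧ a' = 1) ∨ (a = -1 ∧ a' = -1) ∨ (a = w ∧ a' = 1 - w) ∨ (a = -w ∧ a' = w - 1) ∨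
      (a = w - 1 ∧ a' = -w) ∨ (a = 1 - w ∧ a' = w))
    (hb : (b = 1 ∧ b' = 1) ∨ (b = -1 ∧ b' = -1) ∨ (b = w ∧ b' = 1 - w) ∨ (b = -w ∧ b' = w - 1) ∨
      (b = w - 1 ∧ b' = -w) ∨ (b = 1 - w ∧ b' = w))
    (h : a + a' + (b + b') + (a' * b' + a * b) = t) :
    (a + b + a' * b') * (a' + b' + a * b) = 1 ∨
      (t = 0 ∧ (a + b + a' * b') * (a' + b' + a * b) = 0) := by
  rcases ha with ⟨rfl, rfl⟩ | ⟨rfl, rfl⟩ | ⟨rfl, rfl⟩ | ⟨rfl, rfl⟩ | ⟨rfl, rfl⟩ | ⟨rfl, rfl⟩ <;>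
  rcases hb with ⟨rfl, rfl⟩ | ⟨rfl, rfl⟩ | ⟨rfl, rfl⟩ | ⟨rfl, rfl⟩ | ⟨rfl, rfl⟩ | ⟨rfl, rfl⟩ <;>
  rcases ht with rfl | rfl | rfl <;> grind

theorem isTracePair_of_pow_six (ha : a ^ 6 = 1) (hb : b ^ 6 = 1) (habc : a * b * c = 1)
    (hz : z ^ 6 = 1 ∨ z ^ 2 = -1) (hz0 : z ≠ 1) (hz1 : z ≠ -1)
    (hrel : a + a⁻¹ + (b + b⁻¹) + (c + c⁻¹) = z + z⁻¹) :
    IsTracePair (z + z⁻¹) ((a + b + c) * (a⁻¹ + b⁻¹ + c⁻¹)) := by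
  have hne : ∀ {x : ℂ}, x ^ 6 = 1 → x ≠ 0 := by
    rintro x hx rfl
    norm_num at hx
  obtain ⟨w, hw⟩ : ∃ w : ℂ, w ^ 2 = w - 1 := by
    obtain ⟨w, hw⟩ := IsAlgClosed.exists_pow_nat_eq (-3 : ℂ) (n := 2) (by norm_num)
    exact ⟨(1 + w) / 2, by linear_combination hw / 4⟩
  have six : ∀ {x : ℂ}, x ^ 6 = 1 → (x = 1 ∧ x⁻¹ = 1) ∨ (x = -1 ∧ x⁻¹ = -1) ∨
      (x = w ∧ x⁻¹ = 1 - w) ∨ (x = -w ∧ x⁻¹ = w - 1) ∨ (x = w - 1 ∧ x⁻¹ = -w) ∨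
      (x = 1 - w ∧ x⁻¹ = w) := by
    intro x hx
    have hinv : ∀ {y : ℂ}, x * y = 1 → x⁻¹ = y := fun h =>
      inv_eq_of_mul_eq_one_right h
    have h1 : (x - 1) * ((x + 1) *
        ((x - w) * ((x + w) * ((x - (w - 1)) * (x - (1 - w)))))) = 0 := by
      have e1 : (x - w) * (x - (1 - w)) = x ^ 2 - x + 1 := by linear_combination -hw
      have e2 : (x + w) * (x - (w - 1)) = x ^ 2 + x + 1 := by linear_combination -hw
      calc _ = (x - 1) * (x + 1) * (((x - w) * (x - (1 - w))) * ((x + w) * (x - (w - 1)))) := by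
            ring
        _ = 0 := by rw [e1, e2]; linear_combination hx
    simp only [mul_eq_zero] at h1
    rcases h1 with h | h | h | h | h | h
    · have hx1 : x = 1 := by linear_combination h
      exact Or.inl ⟨hx1, hinv (by rw [hx1]; ring)⟩
    · have hx1 : x = -1 := by linear_combination h
      exact Or.inr (Or.inl ⟨hx1, hinv (by rw [hx1]; ring)⟩)
    · have hx1 : x = w := by linear_combination h
      exact Or.inr (Or.inr (Or.inl ⟨hx1, hinv (by rw [hx1]; linear_combination -hw)⟩))
    · have hx1 : x = -w := by linear_combination h
      exact Or.inr (Or.inr (Or.inr (Or.inl ⟨hx1, hinv (by rw [hx1]; linear_combination -hw)⟩)))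
    · have hx1 : x = w - 1 := by linear_combination h
      exact Or.inr (Or.inr (Or.inr (Or.inr (Or.inl
        ⟨hx1, hinv (by rw [hx1]; linear_combination -hw)⟩))))
    · have hx1 : x = 1 - w := by linear_combination h
      exact Or.inr (Or.inr (Or.inr (Or.inr (Or.inr
        ⟨hx1, hinv (by rw [hx1]; linear_combination -hw)⟩))))
  have ht : z + z⁻¹ = 1 ∨ z + z⁻¹ = -1 ∨ z + z⁻¹ = 0 := by
    rcases hz with hz | hz
    · rcases six hz with h | h | h | h | h | h
      · exact absurd h.1 hz0
      · exact absurd h.1 hz1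
      · left; linear_combination h.1 + h.2
      · right; left; linear_combination h.1 + h.2
      · right; left; linear_combination h.1 + h.2
      · left; linear_combination h.1 + h.2
    · right; right
      have : z ≠ 0 := by rintro rfl; norm_num at hz
      field_simp
      linear_combination hz
  have ha0 := hne ha
  have hb0 := hne hb
  have hc : c = a⁻¹ * b⁻¹ := by field_simp; linear_combination habc
  have hci : c⁻¹ = a * b := by rw [hc]; field_simp
  rw [hci, hc] at hrel ⊢
  rcases trace_pair_of_sixth_roots hw ht (six ha) (six hb) hrel with h | h
  · exact Or.inl h
  · exact Or.inr (Or.inl h)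

/-- **Classification of the trace equation.** Roots of unity with `abc = 1`, `z ≠ ±1` and
`a + b + c + a⁻¹ + b⁻¹ + c⁻¹ = z + z⁻¹` belong to one of finitely many families. -/
theorem isTracePair_of_roots_of_unity (Q : ℕ) (hQ : Q ≠ 0) (h2Q : 2 ∣ Q) :
    ∀ a b c z : ℂ, a ^ Q = 1 → b ^ Q = 1 → c ^ Q = 1 → (z ^ Q = 1 ∨ z ^ 2 = -1) →
      a * b * c = 1 → z ≠ 1 → z ≠ -1 → a + a⁻¹ + (b + b⁻¹) + (c + c⁻¹) = z + z⁻¹ →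
      IsTracePair (z + z⁻¹) ((a + b + c) * (a⁻¹ + b⁻¹ + c⁻¹)) := by
  induction Q using Nat.strong_induction_on with
  | _ Q ih =>
  intro a b c z ha hb hc hz habc hz0 hz1 hrel
  -- An odd prime factor can be removed unless it is `3` and divides `Q` exactly once.
  by_cases hodd : ∃ p q : ℕ, p.Prime ∧ p ≠ 2 ∧ Q = p * q ∧ (p ≠ 3 ∨ p ∣ q)
  · obtain ⟨p, q, hp, hp2, hpq, hp3⟩ := hodd
    have : Fact p.Prime := ⟨hp⟩
    have hq0 : q ≠ 0 := by rintro rfl; exact hQ (by rw [hpq, mul_zero])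
    -- The root `z` may only satisfy `z² = -1`, so the step is made among `4Q`-th roots of unity. As
    -- `p` is odd, `gcd(Q, 4q) = q` brings the conclusion back to order `q`.
    have h4 : ∀ {x : ℂ}, x ^ Q = 1 → x ^ (4 * Q) = 1 := by
      intro x hx; rw [mul_comm, pow_mul, hx, one_pow]
    have hz4 : z ^ (4 * Q) = 1 := by
      rcases hz with hz | hz
      · exact h4 hz
      · rw [show 4 * Q = 2 * (2 * Q) by ring, pow_mul, hz, pow_mul]; norm_num
    have hdesc : ∀ {x : ℂ}, x ^ Q = 1 → x ^ (4 * q) = 1 → x ^ q = 1 := by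
      intro x h1 h2
      have h3 : x ^ Nat.gcd Q (4 * q) = 1 := pow_gcd_eq_one.2 ⟨h1, h2⟩
      have h5 : Nat.gcd Q (4 * q) = q := by
        rw [hpq, Nat.gcd_mul_right]
        have : Nat.Coprime p 4 := by
          rw [show 4 = 2 ^ 2 by norm_num]
          exact Nat.Coprime.pow_right 2 ((Nat.coprime_primes hp Nat.prime_two).2 hp2)
        rw [this, one_mul]
      rwa [h5] at h3
    rcases isTracePair_or_descend_odd (p := p) (Q := 4 * Q) (q := 4 * q) (by omega)
      (by rw [hpq]; ring) hp2 (hp3.imp_right fun h => h.mul_left 4) (h4 ha) (h4 hb) (h4 hc) hz4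
      habc hz1 hrel with h | ⟨h1, h2, h3, h5⟩
    · exact h
    · refine ih q ?_ hq0 ?_ a b c z (hdesc ha h1) (hdesc hb h2) (hdesc hc h3)
        (hz.imp_left fun h => hdesc h h5) habc hz0 hz1 hrel
      · rw [hpq]
        have := hp.two_le
        have := Nat.pos_of_ne_zero hq0
        nlinarith
      · rw [hpq] at h2Q
        exact ((Nat.Prime.dvd_mul Nat.prime_two).1 h2Q).resolve_left fun h =>
          hp2 ((Nat.prime_dvd_prime_iff_eq Nat.prime_two hp).1 h).symm
  obtain ⟨q, hq⟩ := h2Q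
  by_cases hq2 : 2 ∣ q
  · have hzQ : z ^ Q = 1 := by
      rcases hz with hz | hz
      · exact hz
      · obtain ⟨r, rfl⟩ := hq2
        rw [hq, pow_mul, hz, pow_mul]; norm_num
    rcases isTracePair_or_descend_two hQ hq hq2 ha hb hc hzQ habc hz1 hrel with
      h | ⟨h1, h2, h3, h4⟩
    · exact h
    · exact ih q (by omega) (by omega) hq2 a b c z h1 h2 h3 h4 habc hz0 hz1 hrel
  -- With `q` odd and no removable odd prime left, `Q` is `2` or `6`.
  have hq3 : q ∣ 3 := by
    by_cases h1 : q = 1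
    · rw [h1]; exact one_dvd 3
    obtain ⟨r, hr, hrq⟩ := Nat.exists_prime_and_dvd h1
    have hr2 : r ≠ 2 := fun h => hq2 (h ▸ hrq)
    obtain ⟨k, hk⟩ := hrq
    have hr3 : r = 3 := by
      by_contra h3
      exact hodd ⟨r, 2 * k, hr, hr2, by rw [hq, hk]; ring, Or.inl h3⟩
    subst hr3
    have hk1 : k = 1 := by
      by_contra hk1
      obtain ⟨s, hs, hsk⟩ := Nat.exists_prime_and_dvd hk1
      have hs2 : s ≠ 2 := fun h => hq2 (by rw [hk, ← h]; exact hsk.mul_left 3)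
      obtain ⟨l, hl⟩ := hsk
      by_cases hs3 : s = 3
      · exact hodd ⟨3, 2 * k, hr, hr2, by rw [hq, hk]; ring,
          Or.inr (by rw [hl, hs3]; exact ⟨2 * l, by ring⟩)⟩
      · exact hodd ⟨s, 2 * (3 * l), hs, hs2, by rw [hq, hk, hl]; ring, Or.inl hs3⟩
    rw [hk, hk1]
  obtain ⟨k, hk⟩ := hq3
  have h6 : ∀ {x : ℂ}, x ^ Q = 1 → x ^ 6 = 1 := by
    intro x hx
    have h : 6 = Q * k := by
      rw [hq, mul_assoc, ← hk]
      norm_num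
    rw [h, pow_mul, hx, one_pow]
  exact isTracePair_of_pow_six (h6 ha) (h6 hb) habc (hz.imp_left h6) hz0 hz1 hrel

end

/-! ### Braid relations between two quadratic elements of an algebra -/

/-- The alternating product `a b a ⋯` with `l` factors in a monoid. -/
def altMul {M : Type*} [Monoid M] (a b : M) : ℕ → M
  | 0 => 1
  | l + 1 => a * altMul b a l

theorem map_altProd {G M : Type*} [Group G] [Monoid M] (f : G →* M) (a b : G) (l : ℕ) :
    f (altProd a b l) = altMul (f a) (f b) l := by
  induction l generalizing a b with
  | zero => simp [altProd, altMul]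
  | succ l ih => simp [altProd, altMul, ih]

theorem altMul_add_two {M : Type*} [Monoid M] (a b : M) (l : ℕ) :
    altMul a b (l + 2) = a * b * altMul a b l := by
  simp [altMul, mul_assoc]

theorem altMul_smul {A : Type*} [Ring A] [Algebra ℂ A] (s : ℂ) (a b : A) (l : ℕ) :
    altMul (s • a) (s • b) l = s ^ l • altMul a b l := by
  induction l generalizing a b with
  | zero => simp [altMul]
  | succ l ih => simp [altMul, ih, smul_smul, pow_succ]

/-- The Chebyshev sequence with `S₀ = 1`, `S₁ = r`, `Sₙ₊₂ = r Sₙ₊₁ - Sₙ`. -/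
def chebSeq (r : ℝ) : ℕ → ℝ
  | 0 => 1
  | 1 => r
  | n + 2 => r * chebSeq r (n + 1) - chebSeq r n

theorem chebSeq_add_four (r : ℝ) (n : ℕ) :
    chebSeq r (n + 4) = (r ^ 2 - 2) * chebSeq r (n + 2) - chebSeq r n := by
  have h1 : chebSeq r (n + 4) = r * chebSeq r (n + 3) - chebSeq r (n + 2) := rfl
  have h2 : chebSeq r (n + 3) = r * chebSeq r (n + 2) - chebSeq r (n + 1) := rfl
  have h3 : chebSeq r (n + 2) = r * chebSeq r (n + 1) - chebSeq r n := rfl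
  rw [h1, h2]
  linear_combination h3

theorem chebSeq_pos {r : ℝ} (hr : 2 ≤ r) (n : ℕ) : 0 < chebSeq r n := by
  have key : ∀ n, 0 < chebSeq r n ∧ chebSeq r n ≤ chebSeq r (n + 1) := by
    intro n
    induction n with
    | zero => exact ⟨by simp [chebSeq], by simp [chebSeq]; linarith⟩
    | succ n ih =>
      obtain ⟨h1, h2⟩ := ih
      have h3 : 0 < chebSeq r (n + 1) := lt_of_lt_of_le h1 h2
      refine ⟨h3, ?_⟩
      have h4 : chebSeq r (n + 1 + 1) = r * chebSeq r (n + 1) - chebSeq r n := rfl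
      rw [h4]
      nlinarith
  exact (key n).1

theorem chebSeq_two_mul_cos (θ : ℝ) (n : ℕ) :
    chebSeq (2 * Real.cos θ) n * Real.sin θ = Real.sin ((n + 1) * θ) := by
  have key : ∀ n : ℕ, chebSeq (2 * Real.cos θ) n * Real.sin θ = Real.sin ((n + 1) * θ) ∧
      chebSeq (2 * Real.cos θ) (n + 1) * Real.sin θ = Real.sin ((n + 2) * θ) := by
    intro n
    induction n with
    | zero =>
      simp [chebSeq, Real.sin_two_mul]
      ring
    | succ n ih =>
      obtain ⟨h1, h2⟩ := ih
      refine ⟨by rw [h2]; push_cast; ring_nf, ?_⟩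
      have h4 : chebSeq (2 * Real.cos θ) (n + 1 + 1) =
        2 * Real.cos θ * chebSeq (2 * Real.cos θ) (n + 1) - chebSeq (2 * Real.cos θ) n := rfl
      rw [h4, sub_mul, mul_assoc, h1, h2]
      have e1 : ((n + 1 : ℕ) + 2 : ℝ) * θ = (n + 2) * θ + θ := by push_cast; ring
      have e2 : ((n : ℝ) + 1) * θ = (n + 2) * θ - θ := by ring
      rw [e1, e2, Real.sin_add, Real.sin_sub]
      ring
  exact (key n).1

/-- The difference of the two alternating products of `1 + P` and `1 + Q` with `l` factors. -/
def braidDiff {A : Type*} [Ring A] (P Q : A) (l : ℕ) : A :=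
  altMul (1 + P) (1 + Q) l - altMul (1 + Q) (1 + P) l

/-- Modulo the right ideal generated by `P` and `Q` the product is `1`. The recurrence below uses a
left annihilator of this ideal. -/
theorem altMul_one_add_mem {A : Type*} [Ring A] (P Q : A) (l : ℕ) :
    ∃ X Y : A, altMul (1 + P) (1 + Q) l = 1 + P * X + Q * Y := by
  induction l generalizing P Q with
  | zero => exact ⟨0, 0, by simp [altMul]⟩
  | succ l ih =>
    obtain ⟨X, Y, h⟩ := ih Q P
    refine ⟨1 + Q * X + P * Y + Y, X, ?_⟩
    rw [altMul, h]
    noncomm_ring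

section

variable {A : Type*} [Ring A] [Algebra ℂ A] {P Q : A} {ω : ℂ} {r : ℝ}

/-- For reflections with independent polar vectors, `(1 + P)(1 + Q)` has trace `ω(2 - r²)` and
determinant `ω²` on their span. The corresponding quadratic polynomial `E` annihilates `P` and `Q`
from the left, so `E` times an alternating product is `E` itself. As `E` is symmetric in `P` and
`Q`, it cancels in the difference. -/
theorem braidDiff_add_four (hPP : P * P = (ω - 1) • P) (hQQ : Q * Q = (ω - 1) • Q)
    (hPQP : P * Q * P = (-ω * r ^ 2 : ℂ) • P) (hQPQ : Q * P * Q = (-ω * r ^ 2 : ℂ) • Q) (l : ℕ) :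
    braidDiff P Q (l + 4) =
      (ω * (2 - r ^ 2) : ℂ) • braidDiff P Q (l + 2) - (ω ^ 2) • braidDiff P Q l := by
  set t : ℂ := ω * (2 - r ^ 2) with ht
  have hPP' : ∀ W, W * P * P = (ω - 1) • (W * P) := fun W => by
    rw [mul_assoc, hPP, mul_smul_comm]
  have hQQ' : ∀ W, W * Q * Q = (ω - 1) • (W * Q) := fun W => by
    rw [mul_assoc, hQQ, mul_smul_comm]
  have hE : ∀ (P Q : A), P * P = (ω - 1) • P → Q * Q = (ω - 1) • Q →
      P * Q * P = (-ω * r ^ 2 : ℂ) • P → Q * P * Q = (-ω * r ^ 2 : ℂ) • Q →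
      (((1 + P) * (1 + Q)) * ((1 + P) * (1 + Q)) - t • ((1 + P) * (1 + Q)) + (ω ^ 2) • 1) * P = 0 ∧
      (((1 + P) * (1 + Q)) * ((1 + P) * (1 + Q)) - t • ((1 + P) * (1 + Q)) +
        (ω ^ 2) • 1) * Q = 0 := by
    intro P Q hPP hQQ hPQP hQPQ
    have hPP' : ∀ W, W * P * P = (ω - 1) • (W * P) := fun W => by
      rw [mul_assoc, hPP, mul_smul_comm]
    have hQQ' : ∀ W, W * Q * Q = (ω - 1) • (W * Q) := fun W => by
      rw [mul_assoc, hQQ, mul_smul_comm]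
    constructor
    · simp only [mul_add, add_mul, sub_mul, one_mul, mul_one, smul_mul_assoc, smul_add,
        ← mul_assoc, hPP, hQQ, hPP', hQQ', hPQP, hQPQ]
      rw [ht]
      module
    · simp only [mul_add, add_mul, sub_mul, one_mul, mul_one, smul_mul_assoc, smul_add,
        ← mul_assoc, hPP, hQQ, hQQ', hPQP, hQPQ]
      rw [ht]
      module
  obtain ⟨X, Y, h1⟩ := altMul_one_add_mem P Q l
  obtain ⟨X', Y', h2⟩ := altMul_one_add_mem Q P l
  obtain ⟨f1, f2⟩ := hE P Q hPP hQQ hPQP hQPQ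
  obtain ⟨f3, f4⟩ := hE Q P hQQ hPP hQPQ hPQP
  set E := ((1 + P) * (1 + Q)) * ((1 + P) * (1 + Q)) - t • ((1 + P) * (1 + Q)) + (ω ^ 2) • (1 : A)
    with hEdef
  set E' := ((1 + Q) * (1 + P)) * ((1 + Q) * (1 + P)) - t • ((1 + Q) * (1 + P)) + (ω ^ 2) • (1 : A)
    with hEdef'
  have hEE : E = E' := by
    rw [hEdef, hEdef']
    simp only [mul_add, add_mul, one_mul, mul_one, smul_mul_assoc, smul_add,
      ← mul_assoc, hPP, hQQ, hPP', hQQ', hPQP, hQPQ]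
    rw [ht]
    module
  have g1 : E * altMul (1 + P) (1 + Q) l = E := by
    rw [h1, mul_add, mul_add, ← mul_assoc, ← mul_assoc, f1, f2, zero_mul, zero_mul, mul_one,
      add_zero, add_zero]
  have g2 : E' * altMul (1 + Q) (1 + P) l = E' := by
    rw [h2, mul_add, mul_add, ← mul_assoc, ← mul_assoc, f3, f4, zero_mul, zero_mul, mul_one,
      add_zero, add_zero]
  have g3 : E * altMul (1 + P) (1 + Q) l - E' * altMul (1 + Q) (1 + P) l = 0 := by
    rw [g1, g2, hEE, sub_self]
  rw [← sub_eq_zero, ← g3]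
  simp only [braidDiff, altMul_add_two (1 + P) (1 + Q) (l + 2),
    altMul_add_two (1 + Q) (1 + P) (l + 2), altMul_add_two (1 + P) (1 + Q) l,
    altMul_add_two (1 + Q) (1 + P) l, hEdef, hEdef']
  simp only [add_mul _ _ (altMul (1 + P) (1 + Q) l), add_mul _ _ (altMul (1 + Q) (1 + P) l),
    sub_mul, smul_mul_assoc, one_mul, smul_sub, mul_assoc]
  abel

theorem braidDiff_odd (hPP : P * P = (ω - 1) • P) (hQQ : Q * Q = (ω - 1) • Q)
    (hPQP : P * Q * P = (-ω * r ^ 2 : ℂ) • P) (hQPQ : Q * P * Q = (-ω * r ^ 2 : ℂ) • Q) (j : ℕ) :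
    braidDiff P Q (2 * j + 1) = ((-ω) ^ j * chebSeq r (2 * j) : ℂ) • braidDiff P Q 1 := by
  have key : ∀ j : ℕ,
      braidDiff P Q (2 * j + 1) = ((-ω) ^ j * chebSeq r (2 * j) : ℂ) • braidDiff P Q 1 ∧
      braidDiff P Q (2 * j + 3) =
        ((-ω) ^ (j + 1) * chebSeq r (2 * j + 2) : ℂ) • braidDiff P Q 1 := by
    intro j
    induction j with
    | zero =>
      refine ⟨by simp [chebSeq], ?_⟩
      simp only [braidDiff, altMul, chebSeq, mul_add, add_mul, one_mul, mul_one, ← mul_assoc, hPP,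
        hQQ, hPQP, hQPQ]
      push_cast
      module
    | succ j ih =>
      refine ⟨ih.2, ?_⟩
      rw [show 2 * (j + 1) + 3 = (2 * j + 1) + 4 by ring,
        braidDiff_add_four hPP hQQ hPQP hQPQ, show 2 * j + 1 + 2 = 2 * j + 3 by ring, ih.1, ih.2,
        show 2 * (j + 1) + 2 = 2 * j + 4 by ring, chebSeq_add_four]
      push_cast
      module
  exact (key j).1

/-- The factor `r` on the left avoids a division: the odd-indexed Chebyshev values start at `r`
instead of `1`. -/
theorem braidDiff_even (hPP : P * P = (ω - 1) • P) (hQQ : Q * Q = (ω - 1) • Q)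
    (hPQP : P * Q * P = (-ω * r ^ 2 : ℂ) • P) (hQPQ : Q * P * Q = (-ω * r ^ 2 : ℂ) • Q) (j : ℕ) :
    (r : ℂ) • braidDiff P Q (2 * j + 2) =
      ((-ω) ^ j * chebSeq r (2 * j + 1) : ℂ) • braidDiff P Q 2 := by
  have key : ∀ j : ℕ,
      (r : ℂ) • braidDiff P Q (2 * j + 2) =
        ((-ω) ^ j * chebSeq r (2 * j + 1) : ℂ) • braidDiff P Q 2 ∧
      (r : ℂ) • braidDiff P Q (2 * j + 4) =
        ((-ω) ^ (j + 1) * chebSeq r (2 * j + 3) : ℂ) • braidDiff P Q 2 := by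
    intro j
    induction j with
    | zero =>
      refine ⟨by simp [chebSeq], ?_⟩
      have h0 : braidDiff P Q 0 = 0 := by simp [braidDiff, altMul]
      rw [show 2 * 0 + 4 = 0 + 4 by ring, braidDiff_add_four hPP hQQ hPQP hQPQ, h0]
      simp only [chebSeq]
      push_cast
      module
    | succ j ih =>
      refine ⟨ih.2, ?_⟩
      rw [show 2 * (j + 1) + 4 = (2 * j + 2) + 4 by ring,
        braidDiff_add_four hPP hQQ hPQP hQPQ, smul_sub, smul_comm, smul_comm (r : ℂ) (ω ^ 2),
        show 2 * j + 2 + 2 = 2 * j + 4 by ring, ih.1, ih.2,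
        show 2 * (j + 1) + 3 = 2 * j + 1 + 4 by ring, chebSeq_add_four]
      push_cast
      module
  exact (key j).1

/-- If the alternating products of `1 + P` and `1 + Q` first agree at length `m ≥ 3`, then
`r = 2 cos (kπ/m)` with `k` coprime to `m`. -/
theorem exists_eq_two_mul_cos_of_braid (hω : ω ≠ 0) (hr : 0 ≤ r) (hPP : P * P = (ω - 1) • P)
    (hQQ : Q * Q = (ω - 1) • Q) (hPQP : P * Q * P = (-ω * r ^ 2 : ℂ) • P)
    (hQPQ : Q * P * Q = (-ω * r ^ 2 : ℂ) • Q) (hr0 : r ≠ 0) {m : ℕ} (hm : 3 ≤ m)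
    (hmin : ∀ l, 1 ≤ l → l < m → braidDiff P Q l ≠ 0) (hbr : braidDiff P Q m = 0) :
    ∃ k : ℕ, 0 < k ∧ 2 * k < m ∧ k.Coprime m ∧ r = 2 * Real.cos (k * Real.pi / m) := by
  have hD1 := hmin 1 le_rfl (by omega)
  have hD2 := hmin 2 (by omega) (by omega)
  have hrC : (r : ℂ) ≠ 0 := by exact_mod_cast hr0
  -- As `m ≥ 3`, the differences of lengths `1` and `2` are nonzero, so a difference vanishes
  -- exactly with its Chebyshev factor. Length `l + 1` corresponds to index `l`.
  have hiff : ∀ l : ℕ, braidDiff P Q (l + 1) = 0 ↔ chebSeq r l = 0 := by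
    intro l
    rcases Nat.even_or_odd' l with ⟨j, rfl | rfl⟩
    · rw [braidDiff_odd hPP hQQ hPQP hQPQ, smul_eq_zero, or_iff_left hD1, mul_eq_zero,
        or_iff_right (pow_ne_zero _ (neg_ne_zero.2 hω)), Complex.ofReal_eq_zero]
    · rw [← smul_eq_zero_iff_right hrC, show 2 * j + 1 + 1 = 2 * j + 2 by ring,
        braidDiff_even hPP hQQ hPQP hQPQ, smul_eq_zero, or_iff_left hD2, mul_eq_zero,
        or_iff_right (pow_ne_zero _ (neg_ne_zero.2 hω)), Complex.ofReal_eq_zero]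
  obtain ⟨m', rfl⟩ : ∃ m', m = m' + 1 := ⟨m - 1, by omega⟩
  have hS := (hiff m').1 hbr
  have hr2 : r < 2 := by
    by_contra h
    exact (chebSeq_pos (not_lt.1 h) m').ne' hS
  have hrpos : 0 < r := lt_of_le_of_ne hr (Ne.symm hr0)
  set θ := Real.arccos (r / 2) with hθ
  have hcos : r = 2 * Real.cos θ := by
    rw [hθ, Real.cos_arccos (by linarith) (by linarith)]; ring
  have hθ0 : 0 < θ := Real.arccos_pos.2 (by linarith)
  have hθ1 : θ < Real.pi / 2 := Real.arccos_lt_pi_div_two.2 (by linarith)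
  have hsin : Real.sin θ ≠ 0 := (Real.sin_pos_of_pos_of_lt_pi hθ0 (by linarith [Real.pi_pos])).ne'
  have hiff2 : ∀ l : ℕ, braidDiff P Q (l + 1) = 0 ↔ Real.sin ((l + 1) * θ) = 0 := by
    intro l
    rw [hiff, ← chebSeq_two_mul_cos, ← hcos, mul_eq_zero, or_iff_left hsin]
  obtain ⟨k, hk⟩ := Real.sin_eq_zero_iff.1 ((hiff2 m').1 hbr)
  have hmpos : (0 : ℝ) < (m' : ℝ) + 1 := by positivity
  have hk0 : 0 < k := by
    have : (0 : ℝ) < k * Real.pi := by rw [hk]; positivity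
    have := (pos_iff_pos_of_mul_pos this).2 Real.pi_pos
    exact_mod_cast this
  lift k to ℕ using hk0.le
  have hk' : (k : ℝ) * Real.pi = (m' + 1) * θ := by exact_mod_cast hk
  have hθk : θ = k * Real.pi / (m' + 1) := by rw [hk']; field_simp
  have hk0' : 0 < k := by exact_mod_cast hk0
  refine ⟨k, hk0', ?_, ?_, ?_⟩
  · have h1 : (k : ℝ) * Real.pi < (m' + 1) * (Real.pi / 2) := by
      rw [hk']; exact mul_lt_mul_of_pos_left hθ1 hmpos
    have h2 : (2 * k : ℝ) < m' + 1 := by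
      have := Real.pi_pos
      by_contra h
      push Not at h
      nlinarith
    exact_mod_cast h2
  -- A common factor `g` of `k` and `m` would give `sin ((m/g) θ) = 0`, hence a shorter braid
  -- relation.
  · by_contra hg
    set g := Nat.gcd k (m' + 1) with hgdef
    have hg1 : g ≠ 1 := hg
    obtain ⟨k₁, hk₁⟩ : g ∣ k := Nat.gcd_dvd_left _ _
    obtain ⟨m₁, hm₁⟩ : g ∣ m' + 1 := Nat.gcd_dvd_right _ _
    have hg0 : g ≠ 0 := by intro h; rw [h, zero_mul] at hm₁; omega
    have hm0 : m₁ ≠ 0 := by rintro rfl; omega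
    obtain ⟨m₂, rfl⟩ : ∃ m₂, m₁ = m₂ + 1 := ⟨m₁ - 1, by omega⟩
    have hlt : m₂ + 1 < m' + 1 := by
      rw [hm₁]
      have : 2 ≤ g := by omega
      nlinarith
    refine hmin (m₂ + 1) (by omega) hlt ((hiff2 m₂).2 ?_)
    have e : ((m₂ : ℝ) + 1) * θ = k₁ * Real.pi := by
      have hgR : (g : ℝ) ≠ 0 := by exact_mod_cast hg0
      apply mul_left_cancel₀ hgR
      have h1 : (g : ℝ) * (m₂ + 1) = m' + 1 := by exact_mod_cast hm₁.symm
      have h2 : (g : ℝ) * k₁ = k := by exact_mod_cast hk₁.symm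
      rw [← mul_assoc, h1, ← mul_assoc, h2, hk']
    rw [e]
    exact Real.sin_nat_mul_pi k₁
  · rw [hcos, hθk]
    push_cast
    rfl

end

/-! ### The Hermitian form and normalised reflections -/

theorem herm21_smul_left (s : ℂ) (z w : Fin 3 → ℂ) : herm21 (s • z) w = s * herm21 z w := by
  simp [herm21]; ring

theorem herm21_conj (z w : Fin 3 → ℂ) : conj (herm21 z w) = herm21 w z := by
  simp [herm21]; ring

theorem herm21_smul_right (s : ℂ) (z w : Fin 3 → ℂ) :
    herm21 z (s • w) = conj s * herm21 z w := by
  simp [herm21]; ring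

theorem herm21_add_right (z w w' : Fin 3 → ℂ) :
    herm21 z (w + w') = herm21 z w + herm21 z w' := by
  simp [herm21]; ring

theorem herm21_self_im (v : Fin 3 → ℂ) : herm21 v v = ((herm21 v v).re : ℂ) := by
  have := herm21_conj v v
  rw [Complex.conj_eq_iff_real] at this
  obtain ⟨r, hr⟩ := this
  rw [hr, Complex.ofReal_re]

/-- The row vector of the linear form `z ↦ ⟨z, v⟩`. -/
noncomputable def dualVec (v : Fin 3 → ℂ) : Fin 3 → ℂ := ![conj (v 0), conj (v 1), -conj (v 2)]

theorem dotProduct_dualVec (z v : Fin 3 → ℂ) : z ⬝ᵥ dualVec v = herm21 z v := by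
  simp [dotProduct, Fin.sum_univ_three, dualVec, herm21]; ring

/-- `u^{1/2} = e^{πi/(3p)}`. -/
noncomputable def sqrtU (p : ℕ) : ℂ := Complex.exp (Real.pi * Complex.I / (3 * p))

/-- `α = √(2 - 2 cos (2π/p))`. -/
noncomputable def alphaH (p : ℕ) : ℝ := Real.sqrt (2 - 2 * Real.cos (2 * Real.pi / p))

section

variable {p : ℕ}

theorem sqrtU_ne_zero : sqrtU p ≠ 0 := Complex.exp_ne_zero _

theorem sqrtU_eq : sqrtU p = Complex.exp ((Real.pi / (3 * p) : ℝ) * Complex.I) := by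
  rw [sqrtU]
  congr 1
  push_cast
  ring

theorem norm_sqrtU : ‖sqrtU p‖ = 1 := by
  rw [sqrtU_eq, Complex.norm_exp_ofReal_mul_I]

theorem conj_sqrtU : conj (sqrtU p) = (sqrtU p)⁻¹ :=
  (Complex.inv_eq_conj norm_sqrtU).symm

theorem exp_neg_eq_sqrtU : Complex.exp (-(2 * Real.pi * Complex.I / (3 * p))) =
    (sqrtU p)⁻¹ ^ 2 := by
  rw [sqrtU, ← Complex.exp_neg, ← Complex.exp_nat_mul]
  congr 1
  push_cast
  ring

theorem exp_neg_half_eq_sqrtU : Complex.exp (-(Real.pi * Complex.I / (3 * p))) =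
    (sqrtU p)⁻¹ := by
  rw [sqrtU, ← Complex.exp_neg]

theorem exp_eq_sqrtU_pow (hp : 2 ≤ p) :
    Complex.exp (2 * Real.pi * Complex.I / p) = sqrtU p ^ 6 := by
  rw [sqrtU, ← Complex.exp_nat_mul]
  congr 1
  have : (p : ℂ) ≠ 0 := by exact_mod_cast (by omega : p ≠ 0)
  push_cast
  field_simp
  norm_num

theorem alphaH_eq (hp : 2 ≤ p) : alphaH p = 2 * Real.sin (Real.pi / p) := by
  have hp0 : (2 : ℝ) ≤ p := by exact_mod_cast hp
  have h1 : 2 - 2 * Real.cos (2 * Real.pi / p) = (2 * Real.sin (Real.pi / p)) ^ 2 := by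
    rw [show 2 * Real.pi / p = 2 * (Real.pi / p) by ring, Real.cos_two_mul, Real.cos_sq']
    ring
  rw [alphaH, h1, Real.sqrt_sq]
  have := Real.sin_nonneg_of_nonneg_of_le_pi (x := Real.pi / p) (by positivity)
    (div_le_self Real.pi_pos.le (by linarith))
  positivity

theorem alphaH_pos (hp : 2 ≤ p) : 0 < alphaH p := by
  rw [alphaH_eq hp]
  have hp0 : (2 : ℝ) ≤ p := by exact_mod_cast hp
  have := Real.sin_pos_of_pos_of_lt_pi (x := Real.pi / p) (by positivity)
    (div_lt_self Real.pi_pos (by linarith))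
  positivity

/-- This is `e^{2iθ} - 1 = 2i e^{iθ} sin θ` at `θ = π/p`. It shows why `⟨v, v⟩ = α` is the
convenient normalisation: the rank one part then has coefficient `i u^{3/2}`. -/
theorem sqrtU_pow_six_sub_one (hp : 2 ≤ p) :
    sqrtU p ^ 6 - 1 = Complex.I * sqrtU p ^ 3 * alphaH p := by
  have h3 : sqrtU p ^ 3 = Complex.exp ((Real.pi / p : ℝ) * Complex.I) := by
    rw [sqrtU, ← Complex.exp_nat_mul]
    congr 1
    have : (p : ℂ) ≠ 0 := by exact_mod_cast (by omega : p ≠ 0)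
    push_cast
    field_simp
  rw [show sqrtU p ^ 6 = (sqrtU p ^ 3) ^ 2 by ring, h3, alphaH_eq hp, Complex.exp_mul_I]
  have h1 := Complex.sin_sq_add_cos_sq ((Real.pi / p : ℝ) : ℂ)
  push_cast at h1 ⊢
  linear_combination h1 - Complex.sin (Real.pi / p) ^ 2 * Complex.I_sq

theorem sqrtU_pow_six_ne_one (hp : 2 ≤ p) : sqrtU p ^ 6 ≠ 1 := by
  intro h
  have h1 := sqrtU_pow_six_sub_one hp
  rw [h, sub_self] at h1
  have h2 : (alphaH p : ℂ) ≠ 0 := by exact_mod_cast (alphaH_pos hp).ne'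
  exact mul_ne_zero (mul_ne_zero Complex.I_ne_zero (pow_ne_zero 3 sqrtU_ne_zero)) h2 h1.symm

/-- The rank one part of the reflection with normalised polar vector `v`. -/
noncomputable def reflPart (p : ℕ) (v : Fin 3 → ℂ) : Matrix (Fin 3) (Fin 3) ℂ :=
  (Complex.I * sqrtU p ^ 3) • Matrix.vecMulVec v (dualVec v)

theorem reflPart_mulVec (v z : Fin 3 → ℂ) :
    reflPart p v *ᵥ z = (Complex.I * sqrtU p ^ 3 * herm21 z v) • v := by
  rw [reflPart, Matrix.smul_mulVec, Matrix.vecMulVec_mulVec, dotProduct_comm, dotProduct_dualVec]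
  ext i
  simp
  ring

theorem trace_reflPart (v : Fin 3 → ℂ) :
    (reflPart p v).trace = Complex.I * sqrtU p ^ 3 * herm21 v v := by
  rw [reflPart, Matrix.trace_smul, Matrix.trace_vecMulVec, dotProduct_dualVec, smul_eq_mul]

theorem coe_eq_of_isComplexReflection (hp : 2 ≤ p) {v : Fin 3 → ℂ} {R : SU21}
    (h : IsComplexReflection p v R) (hv : herm21 v v = alphaH p) :
    R.1.1 = ((sqrtU p)⁻¹ ^ 2) • (1 + reflPart p v) := by
  apply Matrix.ext_of_mulVec_single
  intro i
  rw [h.2, exp_neg_eq_sqrtU, exp_eq_sqrtU_pow hp, Matrix.smul_mulVec, Matrix.add_mulVec,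
    Matrix.one_mulVec, reflPart_mulVec, sqrtU_pow_six_sub_one hp, hv]
  have h2 : (alphaH p : ℂ) ≠ 0 := by exact_mod_cast (alphaH_pos hp).ne'
  congr 3
  field_simp

/-! ### Rescaling of polar vectors and existence of parameters. -/

theorem IsComplexReflection.smul {v : Fin 3 → ℂ} {R : SU21}
    (h : IsComplexReflection p v R) {s : ℂ} (hs : s ≠ 0) : IsComplexReflection p (s • v) R := by
  have hn : herm21 (s • v) (s • v) = (Complex.normSq s : ℂ) * herm21 v v := by
    rw [herm21_smul_left, herm21_smul_right, ← mul_assoc, Complex.mul_conj]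
  refine ⟨?_, fun z => ?_⟩
  · rw [hn, Complex.re_ofReal_mul]
    exact mul_pos (Complex.normSq_pos.2 hs) h.1
  · rw [h.2, hn, herm21_smul_right, smul_smul]
    have h0 : herm21 v v ≠ 0 := by
      intro h0
      have := h.1
      rw [h0] at this
      simp at this
    have hs' : conj s ≠ 0 := (map_ne_zero _).2 hs
    congr 3
    rw [← Complex.mul_conj]
    field_simp

theorem exists_normalised (hp : 2 ≤ p) {R : SU21} (h : ∃ v, IsComplexReflection p v R) :
    ∃ v, IsComplexReflection p v R ∧ herm21 v v = alphaH p := by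
  obtain ⟨v, hv⟩ := h
  have hα := alphaH_pos hp
  set s : ℝ := Real.sqrt (alphaH p / (herm21 v v).re) with hs
  have hs0 : 0 < s := Real.sqrt_pos.2 (div_pos hα hv.1)
  refine ⟨(s : ℂ) • v, hv.smul (by exact_mod_cast hs0.ne'), ?_⟩
  rw [herm21_smul_left, herm21_smul_right, Complex.conj_ofReal, herm21_self_im v]
  have h1 : s * s = alphaH p / (herm21 v v).re := Real.mul_self_sqrt (div_pos hα hv.1).le
  have h2 : s * (s * (herm21 v v).re) = alphaH p := by
    rw [← mul_assoc, h1, div_mul_cancel₀ _ hv.1.ne']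
  exact_mod_cast h2

theorem exists_phase (v w : Fin 3 → ℂ) {d : ℂ} (hd : ‖d‖ = 1) :
    ∃ e : ℂ, ‖e‖ = 1 ∧ ∃ τ : ℝ, 0 ≤ τ ∧ herm21 (e • v) w = d * τ := by
  by_cases h : herm21 v w = 0
  · exact ⟨1, by simp, 0, le_rfl, by rw [herm21_smul_left, h]; simp⟩
  · have hn : (‖herm21 v w‖ : ℂ) ≠ 0 := by exact_mod_cast (norm_ne_zero_iff.2 h)
    refine ⟨d * ‖herm21 v w‖ / herm21 v w, ?_, ‖herm21 v w‖, norm_nonneg _, ?_⟩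
    · rw [norm_div, norm_mul, hd, one_mul, Complex.norm_real, norm_norm,
        div_self (norm_ne_zero_iff.2 h)]
    · rw [herm21_smul_left]
      field_simp

theorem norm_neg_I_mul_inv_sqrtU : ‖-Complex.I * (sqrtU p)⁻¹‖ = 1 := by
  rw [norm_mul, norm_inv, norm_sqrtU]
  simp

theorem exists_parameters (hp : 2 ≤ p) {R₁ R₂ R₃ : SU21} (hR₁ : ∃ v, IsComplexReflection p v R₁)
    (hR₂ : ∃ v, IsComplexReflection p v R₂) (hR₃ : ∃ v, IsComplexReflection p v R₃) :
    ∃ (ρ : ℂ) (σ τ : ℝ), 0 ≤ σ ∧ 0 ≤ τ ∧ HasParameters p R₁ R₂ R₃ ρ σ τ := by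
  obtain ⟨w₁, h₁, n₁⟩ := exists_normalised hp hR₁
  obtain ⟨w₂, h₂, n₂⟩ := exists_normalised hp hR₂
  obtain ⟨v₃, h₃, n₃⟩ := exists_normalised hp hR₃
  set c : ℂ := -Complex.I * (sqrtU p)⁻¹ with hc
  have hc1 : ‖c‖ = 1 := norm_neg_I_mul_inv_sqrtU
  have hc0 : c ≠ 0 := norm_ne_zero_iff.1 (by rw [hc1]; exact one_ne_zero)
  -- The phases of two vectors suffice. With `v₃` fixed, they make `τ` and `σ` non-negative, and `ρ`
  -- is then read off from the remaining product. The conjugate of `c` occurs because `⟨v₂, v₃⟩` is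
  -- the entry `conj (c * σ)` of `H`.
  obtain ⟨e₁, he₁, τ, hτ, hτ'⟩ := exists_phase w₁ v₃ hc1
  obtain ⟨e₂, he₂, σ, hσ, hσ'⟩ := exists_phase w₂ v₃ (d := conj c) (by rw [RCLike.norm_conj, hc1])
  have hn : ∀ {e : ℂ} {w : Fin 3 → ℂ}, ‖e‖ = 1 → herm21 w w = alphaH p →
      herm21 (e • w) (e • w) = alphaH p := by
    intro e w he hw
    rw [herm21_smul_left, herm21_smul_right, ← mul_assoc, Complex.mul_conj,
      Complex.normSq_eq_norm_sq, he, hw]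
    simp
  have hne : ∀ {e : ℂ}, ‖e‖ = 1 → e ≠ 0 := fun he =>
    norm_ne_zero_iff.1 (by rw [he]; exact one_ne_zero)
  refine ⟨herm21 (e₂ • w₂) (e₁ • w₁) / c, σ, τ, hσ, hτ, ![e₁ • w₁, e₂ • w₂, v₃],
    h₁.smul (hne he₁), h₂.smul (hne he₂), h₃, ?_⟩
  have hα : ((Real.sqrt (2 - 2 * Real.cos (2 * Real.pi / p)) : ℝ) : ℂ) = alphaH p := rfl
  simp only [hermitianH, exp_neg_half_eq_sqrtU, ← hc, hα]
  have hρ : c * (herm21 (e₂ • w₂) (e₁ • w₁) / c) = herm21 (e₂ • w₂) (e₁ • w₁) := by field_simp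
  rw [hρ]
  have hσ'' : conj (c * (σ : ℂ)) = herm21 (e₂ • w₂) v₃ := by
    rw [hσ', map_mul, Complex.conj_ofReal]
  intro i j
  fin_cases i <;> fin_cases j <;>
    simp only [Matrix.of_apply, Matrix.cons_val', Matrix.cons_val, Fin.zero_eta, Fin.mk_one,
      Fin.reduceFinMk, Fin.isValue]
  · exact hn he₁ n₁
  · exact (herm21_conj _ _).symm.trans (by rw [hτ'])
  · exact (herm21_conj _ _).symm
  · exact hn he₂ n₂
  · rw [← herm21_conj, ← hσ'', Complex.conj_conj]
  · exact hτ'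
  · exact hσ''.symm
  · exact n₃

end

/-! ### Braid lengths of reflections and the square root of a reflection -/

/-- The inclusion of `SU(2,1)` in the matrix ring. -/
noncomputable def su21ToMatrix : SU21 →* Matrix (Fin 3) (Fin 3) ℂ where
  toFun R := R.1.1
  map_one' := rfl
  map_mul' _ _ := rfl

theorem su21ToMatrix_injective : Function.Injective su21ToMatrix := fun _ _ h =>
  Subtype.ext (Subtype.ext h)

section

variable {p : ℕ}

theorem reflPart_mul_self (hp : 2 ≤ p) {v : Fin 3 → ℂ} (hv : herm21 v v = alphaH p) :
    reflPart p v * reflPart p v = (sqrtU p ^ 6 - 1) • reflPart p v := by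
  apply Matrix.ext_of_mulVec_single
  intro i
  rw [← Matrix.mulVec_mulVec, Matrix.smul_mulVec, reflPart_mulVec, reflPart_mulVec,
    herm21_smul_left, hv, smul_smul, sqrtU_pow_six_sub_one hp]
  congr 1
  ring

theorem reflPart_mul_mul (v w : Fin 3 → ℂ) :
    reflPart p v * reflPart p w * reflPart p v =
      (-sqrtU p ^ 6 * (‖herm21 v w‖ : ℂ) ^ 2) • reflPart p v := by
  apply Matrix.ext_of_mulVec_single
  intro i
  have h1 : herm21 v w * herm21 w v = (‖herm21 v w‖ : ℂ) ^ 2 := by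
    rw [← herm21_conj v w, Complex.mul_conj, Complex.normSq_eq_norm_sq]
    push_cast
    rfl
  rw [← Matrix.mulVec_mulVec, ← Matrix.mulVec_mulVec, Matrix.smul_mulVec, reflPart_mulVec,
    reflPart_mulVec, reflPart_mulVec, herm21_smul_left, herm21_smul_left, smul_smul, ← h1]
  congr 1
  linear_combination (Complex.I * sqrtU p ^ 9 * herm21 v w * herm21 w v *
    herm21 (Pi.single i 1) v) * Complex.I_sq

/-- The braid length of two reflections determines the modulus of the product of their normalised
polar vectors up to Galois conjugation. -/
theorem exists_norm_eq_two_mul_cos (hp : 2 ≤ p) {v w : Fin 3 → ℂ} {A B : SU21}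
    (hA : IsComplexReflection p v A) (hB : IsComplexReflection p w B)
    (hv : herm21 v v = alphaH p) (hw : herm21 w w = alphaH p) {m : ℕ} (hm : 3 ≤ m)
    (hbr : HasBraidLength A B m) :
    herm21 v w ≠ 0 ∧ ∃ k : ℕ, 0 < k ∧ 2 * k < m ∧ k.Coprime m ∧
      ‖herm21 v w‖ = 2 * Real.cos (k * Real.pi / m) := by
  have hA' := coe_eq_of_isComplexReflection hp hA hv
  have hB' := coe_eq_of_isComplexReflection hp hB hw
  have hiff : ∀ l, altProd A B l = altProd B A l ↔
      braidDiff (reflPart p v) (reflPart p w) l = 0 := by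
    intro l
    have e1 : su21ToMatrix A = ((sqrtU p)⁻¹ ^ 2) • (1 + reflPart p v) := hA'
    have e2 : su21ToMatrix B = ((sqrtU p)⁻¹ ^ 2) • (1 + reflPart p w) := hB'
    have hs : ((sqrtU p)⁻¹ ^ 2) ^ l ≠ 0 := pow_ne_zero _ (pow_ne_zero _ (inv_ne_zero sqrtU_ne_zero))
    rw [← su21ToMatrix_injective.eq_iff, map_altProd, map_altProd, e1, e2, altMul_smul,
      altMul_smul, braidDiff, sub_eq_zero]
    exact ⟨fun h => smul_right_injective _ hs h, fun h => by rw [h]⟩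
  have hmin : ∀ l, 1 ≤ l → l < m → braidDiff (reflPart p v) (reflPart p w) l ≠ 0 := by
    intro l h1 h2 h3
    exact absurd (hbr.2 ⟨h1, (hiff l).2 h3⟩) (not_le.2 h2)
  -- Orthogonal polar vectors give commuting reflections, whose braid length is less than `3`.
  have h0 : herm21 v w ≠ 0 := by
    intro h0
    have h0' : herm21 w v = 0 := by rw [← herm21_conj, h0, map_zero]
    refine hmin 2 (by omega) (by omega) ?_
    have hz : ∀ a b : Fin 3 → ℂ, herm21 b a = 0 → reflPart p a * reflPart p b = 0 := by
      intro a b hab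
      apply Matrix.ext_of_mulVec_single
      intro i
      rw [← Matrix.mulVec_mulVec, reflPart_mulVec, reflPart_mulVec, herm21_smul_left, hab,
        Matrix.zero_mulVec]
      simp
    simp only [braidDiff, altMul, mul_one]
    simp only [mul_add, add_mul, one_mul, mul_one, hz v w h0', hz w v h0]
    abel
  refine ⟨h0, exists_eq_two_mul_cos_of_braid (P := reflPart p v) (Q := reflPart p w)
    (pow_ne_zero 6 (sqrtU_ne_zero (p := p))) (norm_nonneg _) (reflPart_mul_self hp hv)
    (reflPart_mul_self hp hw) (reflPart_mul_mul v w) ?_ (norm_ne_zero_iff.2 h0) hm hmin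
    ((hiff m).1 hbr.1.2)⟩
  rw [reflPart_mul_mul w v, ← herm21_conj v w, RCLike.norm_conj]

/-- The characteristic polynomial of a `3 × 3` matrix. -/
theorem det_smul_one_sub (t : ℂ) (M : Matrix (Fin 3) (Fin 3) ℂ) :
    (t • (1 : Matrix (Fin 3) (Fin 3) ℂ) - M).det =
      t ^ 3 - M.trace * t ^ 2 + (M.trace ^ 2 - (M * M).trace) / 2 * t - M.det := by
  simp [Matrix.det_fin_three, Matrix.trace_fin_three, Matrix.mul_apply, Fin.sum_univ_three]
  ring

theorem det_smul_one_sub_eq_zero {t : ℂ} {M : Matrix (Fin 3) (Fin 3) ℂ} {v : Fin 3 → ℂ}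
    (hv : v ≠ 0) (h : M *ᵥ v = t • v) : (t • (1 : Matrix (Fin 3) (Fin 3) ℂ) - M).det = 0 := by
  apply Matrix.exists_mulVec_eq_zero_iff.1
  exact ⟨v, hv, by rw [Matrix.sub_mulVec, Matrix.smul_mulVec, Matrix.one_mulVec, h, sub_self]⟩

/-- A polar vector is an eigenvector of its reflection, and every such eigenvector is polar. -/
theorem one_add_reflPart_mulVec_self (hp : 2 ≤ p) {v : Fin 3 → ℂ} (hv : herm21 v v = alphaH p) :
    (1 + reflPart p v) *ᵥ v = sqrtU p ^ 6 • v := by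
  rw [Matrix.add_mulVec, Matrix.one_mulVec, reflPart_mulVec, hv, ← sqrtU_pow_six_sub_one hp,
    sub_smul, one_smul]
  abel

theorem exists_smul_of_eigenvector (hp : 2 ≤ p) {v w : Fin 3 → ℂ}
    (h : (1 + reflPart p v) *ᵥ w = sqrtU p ^ 6 • w) : ∃ s : ℂ, w = s • v := by
  rw [Matrix.add_mulVec, Matrix.one_mulVec, reflPart_mulVec] at h
  have h1 : (sqrtU p ^ 6 - 1) • w = (Complex.I * sqrtU p ^ 3 * herm21 w v) • v := by
    rw [sub_smul, one_smul, ← h]; abel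
  have h0 : sqrtU p ^ 6 - 1 ≠ 0 := sub_ne_zero.2 (sqrtU_pow_six_ne_one hp)
  exact ⟨(sqrtU p ^ 6 - 1)⁻¹ * (Complex.I * sqrtU p ^ 3 * herm21 w v), by
    rw [← smul_smul, ← h1, smul_smul, inv_mul_cancel₀ h0, one_smul]⟩

end

/-! ### The trace of the symmetry `S` -/

section

variable {p : ℕ} {v₁ v₂ v₃ : Fin 3 → ℂ} {M : Matrix (Fin 3) (Fin 3) ℂ} {ρ : ℂ} {σ τ : ℝ}

theorem ne_zero_of_herm21_self (hp : 2 ≤ p) {v : Fin 3 → ℂ} (hv : herm21 v v = alphaH p) :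
    v ≠ 0 := by
  rintro rfl
  have h : herm21 0 0 = 0 := by simp [herm21]
  rw [h] at hv
  exact (alphaH_pos hp).ne (by exact_mod_cast hv)

/-- An isometry `M` with `M² = R₃` that conjugates `R₁` to `R₂` permutes the polar vectors up to
sign, and forces the relations between the parameters. -/
theorem parameters_of_sqrt_reflection (hp : 2 ≤ p) (n₁ : herm21 v₁ v₁ = alphaH p)
    (n₂ : herm21 v₂ v₂ = alphaH p) (n₃ : herm21 v₃ v₃ = alphaH p)
    (hiso : ∀ z w, herm21 (M *ᵥ z) (M *ᵥ w) = herm21 z w)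
    (hMM : M * M = ((sqrtU p)⁻¹ ^ 2) • (1 + reflPart p v₃))
    (h12 : M * (1 + reflPart p v₁) = (1 + reflPart p v₂) * M)
    (e21 : herm21 v₂ v₁ = -Complex.I * (sqrtU p)⁻¹ * ρ)
    (e13 : herm21 v₁ v₃ = -Complex.I * (sqrtU p)⁻¹ * τ)
    (e23 : herm21 v₂ v₃ = Complex.I * sqrtU p * σ) (hσ : 0 ≤ σ) (hτ : 0 ≤ τ) (hτ0 : τ ≠ 0) :
    σ = τ ∧ conj ρ = -ρ + σ ^ 2 ∧ ∃ ε : ℂ, (ε = 1 ∨ ε = -1) ∧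
      M *ᵥ v₃ = (ε * sqrtU p ^ 2) • v₃ ∧ M *ᵥ v₁ = (-ε) • v₂ := by
  have hx0 := sqrtU_ne_zero (p := p)
  have hxc := conj_sqrtU (p := p)
  have hα0 : (alphaH p : ℂ) ≠ 0 := by exact_mod_cast (alphaH_pos hp).ne'
  set x := sqrtU p with hx
  have hv₃ := ne_zero_of_herm21_self hp n₃
  -- An intertwiner of two reflections maps the eigenline spanned by one polar vector to that of the
  -- other.
  obtain ⟨c₁, hc₁⟩ : ∃ s : ℂ, M *ᵥ v₁ = s • v₂ := by
    apply exists_smul_of_eigenvector hp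
    rw [Matrix.mulVec_mulVec, ← h12, ← Matrix.mulVec_mulVec, one_add_reflPart_mulVec_self hp n₁,
      Matrix.mulVec_smul]
  have hR3 : (1 + reflPart p v₃) = x ^ 2 • (M * M) := by
    rw [hMM, smul_smul, inv_pow, mul_inv_cancel₀ (pow_ne_zero 2 hx0), one_smul]
  obtain ⟨c₃, hc₃⟩ : ∃ s : ℂ, M *ᵥ v₃ = s • v₃ := by
    apply exists_smul_of_eigenvector hp
    have hcomm : (1 + reflPart p v₃) * M = M * (1 + reflPart p v₃) := by
      rw [hR3, smul_mul_assoc, mul_smul_comm, mul_assoc]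
    rw [Matrix.mulVec_mulVec, hcomm, ← Matrix.mulVec_mulVec, one_add_reflPart_mulVec_self hp n₃,
      Matrix.mulVec_smul]
  have hc₃sq : c₃ ^ 2 = x ^ 4 := by
    have h1 : (M * M) *ᵥ v₃ = (c₃ ^ 2) • v₃ := by
      rw [← Matrix.mulVec_mulVec, hc₃, Matrix.mulVec_smul, hc₃, smul_smul, sq]
    rw [hMM, Matrix.smul_mulVec, one_add_reflPart_mulVec_self hp n₃, smul_smul] at h1
    have h2 := smul_left_injective ℂ hv₃ h1
    rw [← h2, ← hx]
    field_simp
  obtain ⟨ε, hε, hc₃ε⟩ : ∃ ε : ℂ, (ε = 1 ∨ ε = -1) ∧ c₃ = ε * x ^ 2 := by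
    have h1 : (c₃ - x ^ 2) * (c₃ + x ^ 2) = 0 := by linear_combination hc₃sq
    rcases mul_eq_zero.1 h1 with h | h
    · exact ⟨1, Or.inl rfl, by linear_combination h⟩
    · exact ⟨-1, Or.inr rfl, by linear_combination h⟩
  have hεc : conj ε = ε := by rcases hε with rfl | rfl <;> simp
  have hε2 : ε * ε = 1 := by rcases hε with rfl | rfl <;> norm_num
  -- Invariance of `⟨v₁, v₃⟩` under `M`. Its modulus gives `σ = τ`, and then `τ ≠ 0` gives `c₁ =
  -- -ε`.
  have hrel : (τ : ℂ) = -ε * c₁ * σ := by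
    have h1 := hiso v₁ v₃
    rw [hc₁, hc₃, herm21_smul_left, herm21_smul_right, e13, e23, hc₃ε, map_mul, map_pow, hεc,
      hxc] at h1
    field_simp at h1
    linear_combination h1
  have hc₁n : ‖c₁‖ = 1 := by
    have h1 := hiso v₁ v₁
    rw [hc₁, herm21_smul_left, herm21_smul_right, n₁, n₂, ← mul_assoc, Complex.mul_conj,
      Complex.normSq_eq_norm_sq] at h1
    have h2 : ((‖c₁‖ ^ 2 : ℝ) : ℂ) = 1 := mul_right_cancel₀ hα0 (by rw [h1, one_mul])
    have h3 : ‖c₁‖ ^ 2 = 1 := by exact_mod_cast h2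
    exact (pow_eq_one_iff_of_nonneg (norm_nonneg _) two_ne_zero).1 h3
  have hεn : ‖ε‖ = 1 := by rcases hε with rfl | rfl <;> simp
  have hστ : σ = τ := by
    have h1 := congrArg norm hrel
    rw [norm_mul, norm_mul, norm_neg, hεn, hc₁n, one_mul, one_mul, Complex.norm_real,
      Complex.norm_real, Real.norm_of_nonneg hσ, Real.norm_of_nonneg hτ] at h1
    exact h1.symm
  subst hστ
  have hσC : (σ : ℂ) ≠ 0 := by exact_mod_cast hτ0
  have hc₁ε : c₁ = -ε := by
    have h1 : (1 : ℂ) = -ε * c₁ := mul_right_cancel₀ hσC (by rw [one_mul]; exact hrel)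
    linear_combination ε * h1 - c₁ * hε2
  refine ⟨rfl, ?_, ε, hε, by rw [hc₃, hc₃ε], by rw [hc₁, hc₁ε]⟩
  -- Since `v₂ = -ε M v₁`, the image `M v₂` is `-ε M² v₁`, which is known from `M² = R₃`. Invariance
  -- of `⟨v₁, v₂⟩` then yields `ρ + ρ̄ = σ²`.
  have hMv₂ : M *ᵥ v₂ = (-ε) • ((x⁻¹ ^ 2) • (v₁ + (Complex.I * x ^ 3 * herm21 v₁ v₃) • v₃)) := by
    have h1 : (M * M) *ᵥ v₁ = (-ε) • (M *ᵥ v₂) := by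
      rw [← Matrix.mulVec_mulVec, hc₁, hc₁ε, Matrix.mulVec_smul]
    rw [hMM, Matrix.smul_mulVec, Matrix.add_mulVec, Matrix.one_mulVec, reflPart_mulVec, ← hx] at h1
    rw [h1, smul_smul, show -ε * -ε = 1 by linear_combination hε2, one_smul]
  have h1 := hiso v₁ v₂
  rw [hMv₂, hc₁, hc₁ε, herm21_smul_left, herm21_smul_right, herm21_smul_right, herm21_add_right,
    herm21_smul_right, ← herm21_conj v₂ v₁, e21, e13, e23] at h1
  simp only [map_mul, map_neg, map_pow, map_inv₀, Complex.conj_I, hxc, hεc, Complex.conj_ofReal,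
    inv_inv] at h1
  have hI : Complex.I ≠ 0 := Complex.I_ne_zero
  have key : Complex.I * x * (conj ρ + ρ - σ ^ 2) = 0 := by
    field_simp at h1
    field_simp
    grind [Complex.I_sq]
  have := (mul_eq_zero.1 key).resolve_left (mul_ne_zero hI hx0)
  linear_combination this

/-! ### Trace and eigenvalues of `S`. -/

theorem trace_reflection_mul :
    (((sqrtU p)⁻¹ ^ 2) • (1 + reflPart p v₁) * M).trace =
      (sqrtU p)⁻¹ ^ 2 * (M.trace + Complex.I * sqrtU p ^ 3 * herm21 (M *ᵥ v₁) v₁) := by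
  have h : (reflPart p v₁ * M).trace = Complex.I * sqrtU p ^ 3 * herm21 (M *ᵥ v₁) v₁ := by
    rw [Matrix.trace_mul_comm, reflPart, mul_smul_comm, Matrix.trace_smul, Matrix.mul_vecMulVec,
      Matrix.trace_vecMulVec, dotProduct_dualVec, smul_eq_mul]
  rw [smul_mul_assoc, Matrix.trace_smul, add_mul, one_mul, Matrix.trace_add, h, smul_eq_mul]

theorem exists_eigenvalues (S : Matrix (Fin 3) (Fin 3) ℂ) :
    ∃ a b c : ℂ, S.charpoly.roots = {a, b, c} ∧ S.trace = a + b + c ∧ S.det = a * b * c := by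
  have hcard : Multiset.card S.charpoly.roots = 3 := by
    rw [IsAlgClosed.card_roots_eq_natDegree, Matrix.charpoly_natDegree_eq_dim]
    rfl
  obtain ⟨a, b, c, h⟩ := Multiset.card_eq_three.1 hcard
  refine ⟨a, b, c, h, ?_, ?_⟩
  · rw [Matrix.trace_eq_sum_roots_charpoly, h]
    simp [add_assoc]
  · rw [Matrix.det_eq_prod_roots_charpoly, h]
    simp [mul_assoc]

theorem pow_eq_one_of_mem_roots {S : Matrix (Fin 3) (Fin 3) ℂ} {N : ℕ} (hS : S ^ N = 1) {a : ℂ}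
    (ha : a ∈ S.charpoly.roots) : a ^ N = 1 := by
  have h1 := (Polynomial.mem_roots'.1 ha).2
  rw [Polynomial.IsRoot, Matrix.eval_charpoly] at h1
  obtain ⟨v, hv, hv0⟩ := Matrix.exists_mulVec_eq_zero_iff.2 h1
  have h2 : S *ᵥ v = a • v := by
    rw [Matrix.sub_mulVec, sub_eq_zero] at hv0
    rw [← hv0]
    ext i
    simp [Matrix.scalar_apply, Matrix.mulVec_diagonal]
  have h3 : ∀ n : ℕ, (S ^ n) *ᵥ v = (a ^ n) • v := by
    intro n
    induction n with
    | zero => simp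
    | succ n ih =>
      rw [pow_succ, ← Matrix.mulVec_mulVec, h2, Matrix.mulVec_smul, ih, smul_smul, pow_succ']
  have h4 := h3 N
  rw [hS, Matrix.one_mulVec] at h4
  exact (smul_left_injective ℂ hv (by simpa using h4.symm))

/-- `ρ - 1` is a sum of three roots of unity with product one. -/
theorem exists_sum_of_roots_of_unity (hp : 2 ≤ p) (n₃ : herm21 v₃ v₃ = alphaH p) (hdet : M.det = 1)
    (hMM : M * M = ((sqrtU p)⁻¹ ^ 2) • (1 + reflPart p v₃))
    (e21 : herm21 v₂ v₁ = -Complex.I * (sqrtU p)⁻¹ * ρ) {ε : ℂ} (hε : ε = 1 ∨ ε = -1)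
    (hMv₃ : M *ᵥ v₃ = (ε * sqrtU p ^ 2) • v₃) (hMv₁ : M *ᵥ v₁ = (-ε) • v₂)
    {S : Matrix (Fin 3) (Fin 3) ℂ} (hS : S = ((sqrtU p)⁻¹ ^ 2) • (1 + reflPart p v₁) * M)
    (hSdet : S.det = 1) {N : ℕ} (hSN : S ^ N = 1) :
    ∃ a b c : ℂ, a ^ (2 * N) = 1 ∧ b ^ (2 * N) = 1 ∧ c ^ (2 * N) = 1 ∧ a * b * c = 1 ∧
      ρ - 1 = a + b + c := by
  have htr : S.trace = (sqrtU p)⁻¹ ^ 2 * M.trace - ε * ρ := by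
    rw [hS, trace_reflection_mul, hMv₁, herm21_smul_left, e21]
    have hx0 := sqrtU_ne_zero (p := p)
    field_simp
    linear_combination ε * ρ * sqrtU p ^ 2 * Complex.I_sq
  have hpow : ∀ {a : ℂ}, a ∈ S.charpoly.roots → a ^ (2 * N) = 1 := by
    intro a ha
    rw [mul_comm, pow_mul, pow_eq_one_of_mem_roots hSN ha, one_pow]
  have hMMtr : (M * M).trace = 2 * (sqrtU p)⁻¹ ^ 2 + sqrtU p ^ 4 := by
    rw [hMM, Matrix.trace_smul, Matrix.trace_add, trace_reflPart, n₃, ← sqrtU_pow_six_sub_one hp]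
    have hx0 := sqrtU_ne_zero (p := p)
    simp
    field_simp
    ring
  have hv₃ := ne_zero_of_herm21_self hp n₃
  -- The known eigenvalue `ε x²`, the determinant `1` and the trace of `M²` determine the trace of
  -- `M`, up to a sign when `ε = 1`.
  have hchar := det_smul_one_sub_eq_zero hv₃ hMv₃
  rw [det_smul_one_sub, hMMtr, hdet] at hchar
  have hx0 := sqrtU_ne_zero (p := p)
  have hx6 := sqrtU_pow_six_ne_one hp
  obtain ⟨a, b, c, hroots, htrS, hdetS⟩ := exists_eigenvalues S
  rw [hSdet] at hdetS
  generalize hT : M.trace = T at *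
  set x := sqrtU p with hx
  have hxi : x * x⁻¹ = 1 := mul_inv_cancel₀ hx0
  rcases hε with rfl | rfl
  -- For `ε = 1` the other two eigenvalues of `M` are square roots of `x⁻²` with product `x⁻²`, so
  -- they coincide. Their common value is `l`.
  · have hTsq : (T - x ^ 2) ^ 2 = 4 * x⁻¹ ^ 2 := by
      field_simp at hchar ⊢
      grind
    obtain ⟨l, hl⟩ : ∃ l, l = (T - x ^ 2) / 2 := ⟨_, rfl⟩
    have hl2 : l ^ 2 = x⁻¹ ^ 2 := by rw [hl]; linear_combination hTsq / 4
    have hTl : T = x ^ 2 + 2 * l := by rw [hl]; ring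
    have hl0 : l ≠ 0 := by
      rintro rfl
      exact pow_ne_zero 2 (inv_ne_zero hx0) (by rw [← hl2]; ring)
    have hxl : x ^ 2 + l ≠ 0 := by
      intro h
      apply hx6
      have h1 : x ^ 4 = x⁻¹ ^ 2 := by rw [← hl2]; linear_combination (x ^ 2 - l) * h
      calc x ^ 6 = x ^ 4 * x ^ 2 := by ring
        _ = 1 := by rw [h1, ← mul_pow, inv_mul_cancel₀ hx0, one_pow]
    have hinj : ∀ w : Fin 3 → ℂ, M *ᵥ w = (-l) • w → w = 0 := by
      intro w hw
      by_contra hw0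
      have h1 := det_smul_one_sub_eq_zero hw0 hw
      rw [det_smul_one_sub, hMMtr, hdet, hT, hTl] at h1
      have h2 : x ^ 2 * l ^ 2 = 1 := by rw [hl2, ← mul_pow, hxi, one_pow]
      have h3 : (x ^ 2 + l) * (4 * l ^ 2) = 0 := by
        rw [← hl2] at h1
        linear_combination -h1 + h2
      exact mul_ne_zero hxl (mul_ne_zero (by norm_num) (pow_ne_zero 2 hl0)) h3
    -- `(M + l)(M - l) z = (M² - l²) z` is a multiple of `v₃`, and `M + l` is injective and acts on
    -- `v₃` by `x² + l`. Dividing by this scalar gives `g`.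
    have hM : ∀ z : Fin 3 → ℂ, ∃ g : ℂ, M *ᵥ z = l • z + g • v₃ := by
      intro z
      refine ⟨(x ^ 2 + l)⁻¹ * (x⁻¹ ^ 2 * (Complex.I * x ^ 3 * herm21 z v₃)), ?_⟩
      rw [← sub_eq_zero]
      apply hinj
      have h1 : M *ᵥ (M *ᵥ z) = (x⁻¹ ^ 2) • (z + (Complex.I * x ^ 3 * herm21 z v₃) • v₃) := by
        rw [Matrix.mulVec_mulVec, hMM, Matrix.smul_mulVec, Matrix.add_mulVec, Matrix.one_mulVec,
          reflPart_mulVec]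
      rw [Matrix.mulVec_sub, Matrix.mulVec_add, Matrix.mulVec_smul, Matrix.mulVec_smul, hMv₃, h1,
        ← hl2]
      generalize Complex.I * x ^ 3 * herm21 z v₃ = q
      ext i
      simp only [Pi.sub_apply, Pi.add_apply, Pi.smul_apply, smul_eq_mul]
      field_simp
      ring
    -- A covector that kills `v₁` and `v₃` sees `M` as `l` and `R₁` as `x⁻²`, so it is a left
    -- eigenvector of `S` with eigenvalue `x⁻² l`.
    obtain ⟨y, hy0, hy1, hy3⟩ : ∃ y : Fin 3 → ℂ, y ≠ 0 ∧ v₁ ⬝ᵥ y = 0 ∧ v₃ ⬝ᵥ y = 0 := by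
      have h1 : (Matrix.of ![v₁, v₃, v₃]).det = 0 :=
        Matrix.det_zero_of_row_eq (i := 1) (j := 2) (by decide) rfl
      obtain ⟨y, hy, hy0⟩ := Matrix.exists_mulVec_eq_zero_iff.2 h1
      exact ⟨y, hy, congrFun hy0 0, congrFun hy0 1⟩
    have hκ : x⁻¹ ^ 2 * l ∈ S.charpoly.roots := by
      rw [Polynomial.mem_roots (Matrix.charpoly_monic S).ne_zero, Polynomial.IsRoot,
        Matrix.eval_charpoly]
      apply Matrix.exists_vecMul_eq_zero_iff.1
      refine ⟨y, hy0, ?_⟩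
      have h1 : ∀ z : Fin 3 → ℂ, y ⬝ᵥ (S *ᵥ z) = x⁻¹ ^ 2 * l * (y ⬝ᵥ z) := by
        intro z
        obtain ⟨g, hg⟩ := hM z
        rw [hS, ← Matrix.mulVec_mulVec, Matrix.smul_mulVec, Matrix.add_mulVec, Matrix.one_mulVec,
          reflPart_mulVec, dotProduct_smul, dotProduct_add, dotProduct_smul, dotProduct_comm y v₁,
          hy1, hg, dotProduct_add, dotProduct_smul, dotProduct_smul, dotProduct_comm y v₃, hy3]
        simp only [smul_eq_mul]
        ring
      rw [Matrix.vecMul_sub, sub_eq_zero]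
      ext i
      have h2 := h1 (Pi.single i 1)
      rw [Matrix.dotProduct_mulVec] at h2
      simp only [dotProduct_single, mul_one] at h2
      rw [h2]
      simp [Matrix.scalar_apply, Matrix.vecMul_diagonal, mul_comm]
    obtain ⟨k, m₁, m₂, hk, hm₁, hm₂, hsum, hprod⟩ : ∃ k m₁ m₂ : ℂ, k = x⁻¹ ^ 2 * l ∧
        m₁ ∈ S.charpoly.roots ∧ m₂ ∈ S.charpoly.roots ∧ S.trace = k + m₁ + m₂ ∧
        k * m₁ * m₂ = 1 := by
      have hκ' := hκ
      rw [hroots] at hκ' ⊢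
      simp only [Multiset.insert_eq_cons, Multiset.mem_cons, Multiset.mem_singleton] at hκ' ⊢
      rcases hκ' with h | h | h
      · exact ⟨a, b, c, h.symm, by tauto, by tauto, htrS, hdetS.symm⟩
      · exact ⟨b, a, c, h.symm, by tauto, by tauto, by rw [htrS]; ring, by rw [hdetS]; ring⟩
      · exact ⟨c, a, b, h.symm, by tauto, by tauto, by rw [htrS]; ring, by rw [hdetS]; ring⟩
    -- The trace of `S` is `1 + 2k - ρ`, so `ρ - 1 = k - m₁ - m₂`. The two signs cancel in the
    -- product, and the even exponent `2N` absorbs them.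
    refine ⟨k, -m₁, -m₂, hpow (hk ▸ hκ), ?_, ?_, by linear_combination hprod, ?_⟩
    · rw [(even_two_mul N).neg_pow]; exact hpow hm₁
    · rw [(even_two_mul N).neg_pow]; exact hpow hm₂
    · rw [htr, hTl] at hsum
      have h2 : x⁻¹ ^ 2 * x ^ 2 = 1 := by rw [← mul_pow, inv_mul_cancel₀ hx0, one_pow]
      linear_combination -hsum - 2 * hk + h2
  -- For `ε = -1` the other two eigenvalues of `M` are opposite, and `ρ - 1` is the trace of `S`
  -- itself.
  · have hT2 : T = -x ^ 2 := by
      have h1 : (T + x ^ 2) ^ 2 = 0 := by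
        field_simp at hchar
        grind
      have := (pow_eq_zero_iff two_ne_zero).1 h1
      linear_combination this
    refine ⟨a, b, c, hpow (by rw [hroots]; simp), hpow (by rw [hroots]; simp),
      hpow (by rw [hroots]; simp), hdetS.symm, ?_⟩
    rw [← htrS, htr, hT2]
    have h2 : x⁻¹ ^ 2 * x ^ 2 = 1 := by rw [← mul_pow, inv_mul_cancel₀ hx0, one_pow]
    linear_combination h2

end

/-! ### Reading off the braid lengths -/

/-- Both angles lie in `[0, π]`, where the cosine is injective, and a fraction in lowest terms
determines its denominator. -/
theorem den_eq_of_cos_eq {l n a b : ℕ} (hl : 0 < l) (hln : 2 * l < n) (hc : l.Coprime n)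
    (ha : 0 < a) (hab : 2 * a < b) (hc' : a.Coprime b)
    (h : Real.cos (2 * (l * Real.pi / n)) = Real.cos (2 * (a * Real.pi / b))) : n = b := by
  have mem : ∀ {x y : ℕ}, 0 < x → 2 * x < y → 2 * ((x : ℝ) * Real.pi / y) ∈ Set.Icc 0 Real.pi := by
    intro x y hx hxy
    have hy : (0 : ℝ) < y := by exact_mod_cast (by omega : 0 < y)
    have h1 : (2 * x : ℝ) < y := by exact_mod_cast hxy
    refine ⟨by positivity, ?_⟩
    rw [← mul_div_assoc, div_le_iff₀ hy]
    nlinarith [Real.pi_pos]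
  have h1 := Real.injOn_cos (mem hl hln) (mem ha hab) h
  have hn : (n : ℝ) ≠ 0 := by exact_mod_cast (by omega : n ≠ 0)
  have hb : (b : ℝ) ≠ 0 := by exact_mod_cast (by omega : b ≠ 0)
  have h2 : (l : ℝ) * b = a * n := by
    field_simp at h1
    linarith
  have h3 : l * b = a * n := by exact_mod_cast h2
  apply Nat.dvd_antisymm
  · exact hc.symm.dvd_of_dvd_mul_left ⟨a, by rw [h3]; ring⟩
  · exact hc'.symm.dvd_of_dvd_mul_left ⟨l, by rw [← h3]; ring⟩

theorem cos_two_pi_div_five :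
    Real.cos (2 * ((1 : ℕ) * Real.pi / (5 : ℕ))) = (Real.sqrt 5 - 1) / 4 := by
  rw [Real.cos_two_mul, show ((1 : ℕ) : ℝ) * Real.pi / (5 : ℕ) = Real.pi / 5 by push_cast; ring,
    Real.cos_pi_div_five]
  have := Real.sq_sqrt (show (0 : ℝ) ≤ 5 by norm_num)
  linear_combination this / 8

theorem cos_four_pi_div_five :
    Real.cos (2 * ((2 : ℕ) * Real.pi / (5 : ℕ))) = -(1 + Real.sqrt 5) / 4 := by
  rw [show 2 * (((2 : ℕ) : ℝ) * Real.pi / (5 : ℕ)) = Real.pi - Real.pi / 5 by push_cast; ring,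
    Real.cos_pi_sub, Real.cos_pi_div_five]
  ring

section

variable {l n : ℕ}

theorem den_eq_three (hl : 0 < l) (hln : 2 * l < n) (hc : l.Coprime n)
    (h : 2 * Real.cos (2 * (l * Real.pi / n)) = -1) : n = 3 := by
  refine den_eq_of_cos_eq hl hln hc (a := 1) (b := 3) (by norm_num) (by norm_num) (by norm_num) ?_
  rw [Real.cos_two_mul (((1 : ℕ) : ℝ) * Real.pi / (3 : ℕ)),
    show ((1 : ℕ) : ℝ) * Real.pi / (3 : ℕ) = Real.pi / 3 by push_cast; ring, Real.cos_pi_div_three]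
  linarith

theorem den_eq_four (hl : 0 < l) (hln : 2 * l < n) (hc : l.Coprime n)
    (h : 2 * Real.cos (2 * (l * Real.pi / n)) = 0) : n = 4 := by
  refine den_eq_of_cos_eq hl hln hc (a := 1) (b := 4) (by norm_num) (by norm_num) (by norm_num) ?_
  rw [show 2 * (((1 : ℕ) : ℝ) * Real.pi / (4 : ℕ)) = Real.pi / 2 by push_cast; ring,
    Real.cos_pi_div_two]
  linarith

theorem den_eq_five (hl : 0 < l) (hln : 2 * l < n) (hc : l.Coprime n)
    (h : (2 * Real.cos (2 * (l * Real.pi / n))) ^ 2 + 2 * Real.cos (2 * (l * Real.pi / n)) = 1) :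
    n = 5 := by
  have h5 := Real.sq_sqrt (show (0 : ℝ) ≤ 5 by norm_num)
  have h1 : (Real.cos (2 * (l * Real.pi / n)) - (Real.sqrt 5 - 1) / 4) *
      (Real.cos (2 * (l * Real.pi / n)) - -(1 + Real.sqrt 5) / 4) = 0 := by
    linear_combination h / 4 - h5 / 16
  rcases mul_eq_zero.1 h1 with h2 | h2
  · exact den_eq_of_cos_eq hl hln hc (a := 1) (b := 5) (by norm_num) (by norm_num) (by norm_num)
      (by rw [cos_two_pi_div_five]; linarith)
  · exact den_eq_of_cos_eq hl hln hc (a := 2) (b := 5) (by norm_num) (by norm_num) (by norm_num)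
      (by rw [cos_four_pi_div_five]; linarith)

theorem den_eq_six (hl : 0 < l) (hln : 2 * l < n) (hc : l.Coprime n)
    (h : 2 * Real.cos (2 * (l * Real.pi / n)) = 1) : n = 6 := by
  refine den_eq_of_cos_eq hl hln hc (a := 1) (b := 6) (by norm_num) (by norm_num) (by norm_num) ?_
  rw [show 2 * (((1 : ℕ) : ℝ) * Real.pi / (6 : ℕ)) = Real.pi / 3 by push_cast; ring,
    Real.cos_pi_div_three]
  linarith

theorem den_eq_eight (hl : 0 < l) (hln : 2 * l < n) (hc : l.Coprime n)
    (h : (2 * Real.cos (2 * (l * Real.pi / n))) ^ 2 = 2) : n = 8 := by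
  have h2' := Real.sq_sqrt (show (0 : ℝ) ≤ 2 by norm_num)
  have h1 : (Real.cos (2 * (l * Real.pi / n)) - Real.sqrt 2 / 2) *
      (Real.cos (2 * (l * Real.pi / n)) + Real.sqrt 2 / 2) = 0 := by
    linear_combination h / 4 - h2' / 4
  rcases mul_eq_zero.1 h1 with h2 | h2
  · refine den_eq_of_cos_eq hl hln hc (a := 1) (b := 8) (by norm_num) (by norm_num) (by norm_num) ?_
    rw [show 2 * (((1 : ℕ) : ℝ) * Real.pi / (8 : ℕ)) = Real.pi / 4 by push_cast; ring,
      Real.cos_pi_div_four]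
    linarith
  · refine den_eq_of_cos_eq hl hln hc (a := 3) (b := 8) (by norm_num) (by norm_num) (by norm_num) ?_
    rw [show 2 * (((3 : ℕ) : ℝ) * Real.pi / (8 : ℕ)) = Real.pi - Real.pi / 4 by push_cast; ring,
      Real.cos_pi_sub, Real.cos_pi_div_four]
    linarith

end

/-- In the application `t = σ² - 2` and `W = |ρ|² - 2`, so that `|ρ - 1|² = 1 + W - t`. Each family
of `IsTracePair` fixes one pair of denominators, and `N = 1` means `t = W`. -/
theorem braid_lengths_of_isTracePair {l n k m : ℕ} (hl : 0 < l) (hln : 2 * l < n)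
    (hc : l.Coprime n) (hk : 0 < k) (hkm : 2 * k < m) (hc' : k.Coprime m) {t W : ℝ}
    (ht : t = 2 * Real.cos (2 * (l * Real.pi / n))) (hW : W = 2 * Real.cos (2 * (k * Real.pi / m)))
    (h : IsTracePair (t : ℂ) ((1 + W - t : ℝ) : ℂ)) :
    (n, m) = (3, 4) ∨ (n, m) = (3, 5) ∨ (n, m) = (4, 3) ∨ (n, m) = (5, 4) ∨ (n, m) = (8, 6) ∨
      ∃ k : ℕ, 3 ≤ k ∧ (n, m) = (k, k) := by
  have h' : 1 + W - t = 1 ∨ (t = 0 ∧ 1 + W - t = 0) ∨ (t ^ 2 = 2 ∧ 1 + W - t = 2 - t) ∨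
      (t = -1 ∧ 1 + W - t = 2) ∨ (t = -1 ∧ (1 + W - t - 2) ^ 2 + (1 + W - t - 2) = 1) ∨
      (t ^ 2 + t = 1 ∧ 1 + W - t = t ^ 2) := by
    unfold IsTracePair at h
    exact_mod_cast h
  simp only [Prod.mk.injEq]
  rcases h' with h1 | ⟨h1, h2⟩ | ⟨h1, h2⟩ | ⟨h1, h2⟩ | ⟨h1, h2⟩ | ⟨h1, h2⟩
  · have hnm : n = m := den_eq_of_cos_eq hl hln hc hk hkm hc' (by linarith)
    right; right; right; right; right
    exact ⟨m, by omega, hnm, rfl⟩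
  · right; right; left
    exact ⟨den_eq_four hl hln hc (by rw [← ht]; exact h1),
      den_eq_three hk hkm hc' (by rw [← hW]; linarith)⟩
  · right; right; right; right; left
    exact ⟨den_eq_eight hl hln hc (by rw [← ht]; exact h1),
      den_eq_six hk hkm hc' (by rw [← hW]; linarith)⟩
  · left
    exact ⟨den_eq_three hl hln hc (by rw [← ht]; exact h1),
      den_eq_four hk hkm hc' (by rw [← hW]; linarith)⟩
  · right; left
    refine ⟨den_eq_three hl hln hc (by rw [← ht]; exact h1), den_eq_five hk hkm hc' ?_⟩
    rw [← hW, ← h2, h1]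
    ring
  · right; right; right; left
    exact ⟨den_eq_five hl hln hc (by rw [← ht]; exact h1),
      den_eq_four hk hkm hc' (by rw [← hW]; linarith)⟩

/-- The numerical part of the theorem: `ρ - 1` is a sum of three roots of unity with product one,
`2 Re ρ = 4 cos² (lπ/n)` and `|ρ| = 2 cos (kπ/m)`. -/
theorem braid_lengths_of_sum_of_roots_of_unity {l n k m : ℕ} (hl : 0 < l) (hln : 2 * l < n)
    (hc : l.Coprime n) (hk : 0 < k) (hkm : 2 * k < m) (hc' : k.Coprime m) {ρ a b c : ℂ} {N : ℕ}
    (hN : N ≠ 0) (ha : a ^ (2 * N) = 1) (hb : b ^ (2 * N) = 1) (hcN : c ^ (2 * N) = 1)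
    (habc : a * b * c = 1) (hρ : ρ - 1 = a + b + c)
    (hre : (2 * Real.cos (l * Real.pi / n)) ^ 2 = 2 * ρ.re)
    (hnorm : ‖ρ‖ = 2 * Real.cos (k * Real.pi / m)) :
    (n, m) = (3, 4) ∨ (n, m) = (3, 5) ∨ (n, m) = (4, 3) ∨ (n, m) = (5, 4) ∨ (n, m) = (8, 6) ∨
      ∃ k : ℕ, 3 ≤ k ∧ (n, m) = (k, k) := by
  have hN2 : 2 * N ≠ 0 := by omega
  have hinv : ∀ {x : ℂ}, x ^ (2 * N) = 1 → x⁻¹ = conj x := fun hx =>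
    Complex.inv_eq_conj (Complex.norm_eq_one_of_pow_eq_one hx hN2)
  set φ : ℝ := l * Real.pi / n with hφ
  -- With this choice `z + z⁻¹ = 2 cos 2φ = σ² - 2 = 2 Re (ρ - 1)`.
  set z : ℂ := Complex.exp ((2 * φ : ℝ) * Complex.I) with hz
  have hn0 : (0 : ℝ) < n := by exact_mod_cast (by omega : 0 < n)
  have hznorm : ‖z‖ = 1 := Complex.norm_exp_ofReal_mul_I _
  have hzre : z.re = Real.cos (2 * φ) := Complex.exp_ofReal_mul_I_re _
  have hzim : z.im = Real.sin (2 * φ) := Complex.exp_ofReal_mul_I_im _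
  have hzinv : z⁻¹ = conj z := Complex.inv_eq_conj hznorm
  have hsin : 0 < Real.sin (2 * φ) := by
    have h1 : (2 * l : ℝ) < n := by exact_mod_cast hln
    have hl0 : (0 : ℝ) < l := by exact_mod_cast hl
    apply Real.sin_pos_of_pos_of_lt_pi
    · positivity
    · rw [hφ, ← mul_div_assoc, div_lt_iff₀ hn0]
      nlinarith [Real.pi_pos]
  have hz1 : z ≠ 1 := by
    intro h
    rw [h, Complex.one_im] at hzim
    exact hsin.ne hzim
  have hz2 : z ≠ -1 := by
    intro h
    rw [h, Complex.neg_im, Complex.one_im, neg_zero] at hzim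
    exact hsin.ne hzim
  have hzn : z ^ n = 1 := by
    rw [hz, ← Complex.exp_nat_mul, Complex.exp_eq_one_iff]
    refine ⟨l, ?_⟩
    have : (n : ℂ) ≠ 0 := by exact_mod_cast hn0.ne'
    rw [hφ]
    push_cast
    field_simp
  have hzt : z + z⁻¹ = ((2 * Real.cos (2 * φ) : ℝ) : ℂ) := by
    rw [hzinv, Complex.add_conj, hzre]
  have hs' : a⁻¹ + b⁻¹ + c⁻¹ = conj (ρ - 1) := by
    rw [hρ, hinv ha, hinv hb, hinv hcN, map_add, map_add]
  have hQ : ∀ {x : ℂ}, x ^ (2 * N) = 1 → x ^ (2 * N * n) = 1 := by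
    intro x hx; rw [pow_mul, hx, one_pow]
  have hrel : a + a⁻¹ + (b + b⁻¹) + (c + c⁻¹) = z + z⁻¹ := by
    have h1 : a + a⁻¹ + (b + b⁻¹) + (c + c⁻¹) = (ρ - 1) + conj (ρ - 1) := by
      rw [← hs', hρ]; ring
    rw [h1, hzt, Complex.add_conj]
    congr 1
    rw [Real.cos_two_mul, Complex.sub_re, Complex.one_re]
    linear_combination -hre
  have key := isTracePair_of_roots_of_unity (2 * N * n)
    (mul_ne_zero hN2 (by omega)) ⟨N * n, by ring⟩ a b c z (hQ ha) (hQ hb) (hQ hcN)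
    (Or.inl (by rw [mul_comm, pow_mul, hzn, one_pow])) habc hz1 hz2 hrel
  refine braid_lengths_of_isTracePair hl hln hc hk hkm hc' (t := 2 * Real.cos (2 * φ))
    (W := 2 * Real.cos (2 * (k * Real.pi / m))) rfl rfl ?_
  rw [hzt, hs', ← hρ, Complex.mul_conj] at key
  convert key using 2
  have h1 : Complex.normSq ρ = (2 * Real.cos (k * Real.pi / m)) ^ 2 := by
    rw [Complex.normSq_eq_norm_sq, hnorm]
  rw [Complex.normSq_sub, h1, Real.cos_two_mul, Real.cos_two_mul]
  simp
  linear_combination -hre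

/-! ### The table -/

theorem expPi_add (x y : ℝ) : expPi (x + y) = expPi x * expPi y := by
  rw [expPi, expPi, expPi, ← Complex.exp_add]
  congr 1
  push_cast
  ring

theorem expPi_re (x : ℝ) : (expPi x).re = Real.cos (Real.pi * x) :=
  Complex.exp_ofReal_mul_I_re _

theorem expPi_im (x : ℝ) : (expPi x).im = Real.sin (Real.pi * x) :=
  Complex.exp_ofReal_mul_I_im _

theorem expPi_add_neg (x : ℝ) : expPi x + expPi (-x) = 2 * (Real.cos (Real.pi * x) : ℝ) := by
  apply Complex.ext
  · simp [expPi_re, -Complex.ofReal_cos]; ring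
  · simp [expPi_im, -Complex.ofReal_cos]

theorem expPi_zero : expPi 0 = 1 := by simp [expPi]

theorem expPi_eq (x : ℝ) :
    expPi x = (Real.cos (Real.pi * x) : ℝ) + (Real.sin (Real.pi * x) : ℝ) * Complex.I := by
  apply Complex.ext
  · simp [expPi_re, -Complex.ofReal_cos, -Complex.ofReal_sin]
  · simp [expPi_im, -Complex.ofReal_cos, -Complex.ofReal_sin]

theorem expPi_two : expPi 2 = 1 := by
  rw [expPi_eq, mul_comm Real.pi, Real.cos_two_pi, Real.sin_two_pi]
  simp

/-- The period `s = ζ + ζ² + ζ⁴` satisfies `s² + s + 2 = 0`. The sign of its imaginary part selects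
the root. -/
theorem gauss_sum_seven : (1 + Complex.I * (Real.sqrt 7 : ℝ)) / 2 - 1 =
    expPi (2 / 7) + expPi (4 / 7) + expPi (-6 / 7) := by
  set ζ := expPi (2 / 7) with hζ
  have h2 : expPi (4 / 7) = ζ ^ 2 := by
    rw [hζ, sq, ← expPi_add]; norm_num
  have h4 : expPi (-6 / 7) = ζ ^ 4 := by
    have h8 : expPi (-6 / 7) * expPi 2 = expPi (4 / 7) * expPi (4 / 7) := by
      rw [← expPi_add, ← expPi_add]; norm_num
    rw [expPi_two, mul_one, h2] at h8
    rw [h8]; ring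
  have h7 : ζ ^ 7 = 1 := by
    have h8 : ζ ^ 4 * ζ ^ 2 * ζ = 1 := by
      rw [← h4, ← h2, hζ, ← expPi_add, ← expPi_add, ← expPi_zero]; norm_num
    linear_combination h8
  have hpi := Real.pi_pos
  have s1 : 0 < Real.sin (Real.pi * (4 / 7)) :=
    Real.sin_pos_of_pos_of_lt_pi (by positivity) (by linarith)
  have s2 : Real.sin (Real.pi / 7) < Real.sin (Real.pi * (2 / 7)) :=
    Real.sin_lt_sin_of_lt_of_le_pi_div_two (by linarith) (by linarith) (by linarith)
  have s3 : Real.sin (Real.pi * (-6 / 7)) = -Real.sin (Real.pi / 7) := by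
    rw [show Real.pi * (-6 / 7) = -(Real.pi - Real.pi / 7) by ring, Real.sin_neg, Real.sin_pi_sub]
  have s4 : 0 < Real.sin (Real.pi / 7) :=
    Real.sin_pos_of_pos_of_lt_pi (by positivity) (by linarith)
  have hζ1 : ζ ≠ 1 := by
    intro h
    have := expPi_im (2 / 7)
    rw [← hζ, h, Complex.one_im] at this
    linarith
  have him : 0 < (expPi (2 / 7) + expPi (4 / 7) + expPi (-6 / 7)).im := by
    rw [Complex.add_im, Complex.add_im, expPi_im, expPi_im, expPi_im, s3]
    linarith
  rw [← hζ, h2, h4] at him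
  rw [h2, h4]
  have hs : 1 + ζ + ζ ^ 2 + ζ ^ 3 + ζ ^ 4 + ζ ^ 5 + ζ ^ 6 = 0 := by
    have : (ζ - 1) * (1 + ζ + ζ ^ 2 + ζ ^ 3 + ζ ^ 4 + ζ ^ 5 + ζ ^ 6) = 0 := by
      linear_combination h7
    exact (mul_eq_zero.1 this).resolve_left (sub_ne_zero.2 hζ1)
  set s := ζ + ζ ^ 2 + ζ ^ 4 with hsdef
  have hq : s ^ 2 + s + 2 = 0 := by
    rw [hsdef]
    linear_combination 2 * hs + ζ * h7
  have h7' : ((Real.sqrt 7 : ℝ) : ℂ) ^ 2 = 7 := by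
    have := Real.sq_sqrt (show (0 : ℝ) ≤ 7 by norm_num)
    exact_mod_cast this
  have hf : (s - ((1 + Complex.I * (Real.sqrt 7 : ℝ)) / 2 - 1)) *
      (s - ((1 - Complex.I * (Real.sqrt 7 : ℝ)) / 2 - 1)) = 0 := by
    linear_combination hq - ((Real.sqrt 7 : ℝ) : ℂ) ^ 2 * Complex.I_sq / 4 + h7' / 4
  rcases mul_eq_zero.1 hf with h | h
  · linear_combination -h
  · exfalso
    have h' : s = (1 - Complex.I * (Real.sqrt 7 : ℝ)) / 2 - 1 := by linear_combination h
    have h3 : s.im = -(Real.sqrt 7) / 2 := by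
      rw [h']
      simp
    have := Real.sqrt_nonneg 7
    linarith

theorem eq_or_conj_eq {ρ X : ℂ} (hre : ρ.re = X.re) (hn : Complex.normSq ρ = Complex.normSq X) :
    ρ = X ∨ conj ρ = X := by
  rw [Complex.normSq_apply, Complex.normSq_apply, hre] at hn
  have h : (ρ.im - X.im) * (ρ.im + X.im) = 0 := by linear_combination hn
  rcases mul_eq_zero.1 h with h | h
  · exact Or.inl (Complex.ext hre (by linarith))
  · exact Or.inr (Complex.ext (by simpa using hre) (by simp; linarith))

/-- The real part `σ²/2` and the modulus determine `ρ` up to conjugation, so each row reduces to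
checking its own entry `X`. -/
theorem isTableRow_of_eq {n m : ℕ} {ρ X : ℂ} {σ : ℝ} (hX : IsTableRow n m X (X - 1) σ)
    (hXre : σ ^ 2 = 2 * X.re) (hXn : Complex.normSq X = (2 * Real.cos (Real.pi / m)) ^ 2)
    (hre : σ ^ 2 = 2 * ρ.re) (hnorm : ‖ρ‖ = 2 * Real.cos (Real.pi / m)) :
    IsTableRow n m ρ (ρ - 1) σ ∨ IsTableRow n m (conj ρ) (conj ρ - 1) σ := by
  rcases eq_or_conj_eq (ρ := ρ) (X := X) (by linarith)
    (by rw [hXn, Complex.normSq_eq_norm_sq, hnorm]) with h | h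
  · left; rw [h]; exact hX
  · right; rw [h]; exact hX

theorem normSq_expPi (x : ℝ) : Complex.normSq (expPi x) = 1 := by
  rw [Complex.normSq_apply, expPi_re, expPi_im]
  linear_combination Real.cos_sq_add_sin_sq (Real.pi * x)

theorem isTableRow_diagonal {n : ℕ} (hn : 3 ≤ n) {ρ : ℂ} {σ : ℝ}
    (hre : σ ^ 2 = 2 * ρ.re) (hnorm : ‖ρ‖ = 2 * Real.cos (Real.pi / n))
    (hσ : σ = 2 * Real.cos (Real.pi / n)) :
    IsTableRow n n ρ (ρ - 1) σ ∨ IsTableRow n n (conj ρ) (conj ρ - 1) σ := by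
  have hpn : Real.pi * (1 / n) = Real.pi / n := by ring
  apply isTableRow_of_eq (X := 2 * expPi (1 / n) * (Real.cos (Real.pi / n) : ℝ)) _ _ _ hre hnorm
  · right; right; right; right; right
    refine ⟨hn, rfl, rfl, ?_, hσ⟩
    have h1 := expPi_add_neg (1 / n)
    rw [hpn] at h1
    have h2 : expPi (1 / n) * expPi (-(1 / n)) = 1 := by
      rw [← expPi_add, add_neg_cancel, expPi_zero]
    have h3 : expPi (2 / n) = expPi (1 / n) * expPi (1 / n) := by
      rw [← expPi_add]; congr 1; ring
    rw [h3]
    linear_combination -expPi (1 / n) * h1 + h2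
  · rw [mul_assoc, Complex.mul_re, mul_comm (expPi (1 / n)), Complex.re_ofReal_mul, expPi_re, hpn,
      hσ]
    simp
    ring
  · rw [Complex.normSq_mul, Complex.normSq_mul, normSq_expPi, Complex.normSq_ofReal]
    simp
    ring

theorem isTableRow_three_four {ρ : ℂ} {σ : ℝ} (hre : σ ^ 2 = 2 * ρ.re)
    (hnorm : ‖ρ‖ = 2 * Real.cos (Real.pi / (4 : ℕ))) (hσ : σ = 2 * Real.cos (Real.pi / (3 : ℕ))) :
    IsTableRow 3 4 ρ (ρ - 1) σ ∨ IsTableRow 3 4 (conj ρ) (conj ρ - 1) σ := by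
  have hσ1 : σ = 1 := by
    rw [hσ]; push_cast; rw [Real.cos_pi_div_three]; norm_num
  have h7 := Real.mul_self_sqrt (show (0 : ℝ) ≤ 7 by norm_num)
  have h2 := Real.sq_sqrt (show (0 : ℝ) ≤ 2 by norm_num)
  have hX : ((1 + Complex.I * (Real.sqrt 7 : ℝ)) / 2 : ℂ) = ⟨1 / 2, Real.sqrt 7 / 2⟩ := by
    apply Complex.ext <;> simp
  apply isTableRow_of_eq (X := (1 + Complex.I * (Real.sqrt 7 : ℝ)) / 2) _ _ _ hre hnorm
  · left
    exact ⟨rfl, rfl, rfl, gauss_sum_seven, hσ1⟩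
  · rw [hσ1, hX]; norm_num
  · rw [hX, Complex.normSq_mk]
    push_cast
    rw [Real.cos_pi_div_four]
    linear_combination h7 / 4 - h2

theorem isTableRow_three_five {ρ : ℂ} {σ : ℝ} (hre : σ ^ 2 = 2 * ρ.re)
    (hnorm : ‖ρ‖ = 2 * Real.cos (Real.pi / (5 : ℕ))) (hσ : σ = 2 * Real.cos (Real.pi / (3 : ℕ))) :
    IsTableRow 3 5 ρ (ρ - 1) σ ∨ IsTableRow 3 5 (conj ρ) (conj ρ - 1) σ := by
  have hσ1 : σ = 1 := by
    rw [hσ]; push_cast; rw [Real.cos_pi_div_three]; norm_num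
  have h5 := Real.sq_sqrt (show (0 : ℝ) ≤ 5 by norm_num)
  apply isTableRow_of_eq (X := 2 * expPi (2 / 5) * (Real.cos (Real.pi / 5) : ℝ)) _ _ _ hre hnorm
  · right; left
    refine ⟨rfl, rfl, rfl, ?_, hσ1⟩
    set g := expPi (1 / 5) with hg
    have e2 : expPi (2 / 5) = g ^ 2 := by rw [hg, sq, ← expPi_add]; norm_num
    have ei : g * expPi (-(1 / 5)) = 1 := by
      rw [hg, ← expPi_add, add_neg_cancel, expPi_zero]
    have e1 : 2 * (Real.cos (Real.pi / 5) : ℝ) = g + expPi (-(1 / 5)) := by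
      rw [hg, expPi_add_neg]; congr 3; ring
    -- These two terms are `e^{-πi/5}` times the two primitive cube roots of unity, whose sum is
    -- `-1`.
    have e3 : expPi (7 / 15) + expPi (-13 / 15) = -expPi (-(1 / 5)) := by
      have f1 : expPi (7 / 15) = expPi (-(1 / 5)) * expPi (2 / 3) := by
        rw [← expPi_add]; norm_num
      have f2 : expPi (-13 / 15) = expPi (-(1 / 5)) * expPi (-(2 / 3)) := by
        rw [← expPi_add]; norm_num
      have f3 := expPi_add_neg (2 / 3)
      rw [show Real.pi * (2 / 3) = Real.pi - Real.pi / 3 by ring, Real.cos_pi_sub,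
        Real.cos_pi_div_three] at f3
      rw [f1, f2, ← mul_add, f3]
      push_cast
      ring
    have e5 : g ^ 5 = -1 := by
      have : g ^ 5 = expPi 1 := by
        rw [show g ^ 5 = g * g * g * g * g by ring, hg, ← expPi_add, ← expPi_add, ← expPi_add,
          ← expPi_add]
        norm_num
      rw [this, expPi_eq]
      simp
    have hg1 : g ≠ -1 := by
      intro h
      have h1 := expPi_im (1 / 5)
      rw [← hg, h] at h1
      have h2 : 0 < Real.sin (Real.pi * (1 / 5)) :=
        Real.sin_pos_of_pos_of_lt_pi (by positivity) (by linarith [Real.pi_pos])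
      rw [Complex.neg_im, Complex.one_im, neg_zero] at h1
      exact h2.ne h1
    have hsum : 1 - g + g ^ 2 - g ^ 3 + g ^ 4 = 0 := by
      have : (g + 1) * (1 - g + g ^ 2 - g ^ 3 + g ^ 4) = 0 := by linear_combination e5
      refine (mul_eq_zero.1 this).resolve_left fun h => hg1 (by linear_combination h)
    rw [add_assoc, e3, e2]
    have hinv : expPi (-(1 / 5)) = -g ^ 4 := by
      linear_combination -g ^ 4 * ei + expPi (-(1 / 5)) * e5
    rw [hinv] at e1 ⊢
    linear_combination g ^ 2 * e1 - hsum - g * e5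
  · rw [mul_assoc, Complex.mul_re, mul_comm (expPi (2 / 5)), Complex.re_ofReal_mul, expPi_re, hσ1,
      show Real.pi * (2 / 5) = 2 * (Real.pi / 5) by ring, Real.cos_two_mul, Real.cos_pi_div_five]
    simp
    grind
  · rw [Complex.normSq_mul, Complex.normSq_mul, normSq_expPi, Complex.normSq_ofReal]
    push_cast
    simp
    ring

theorem isTableRow_four_three {ρ : ℂ} {σ : ℝ} (hre : σ ^ 2 = 2 * ρ.re)
    (hnorm : ‖ρ‖ = 2 * Real.cos (Real.pi / (3 : ℕ))) (hσ : σ = 2 * Real.cos (Real.pi / (4 : ℕ))) :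
    IsTableRow 4 3 ρ (ρ - 1) σ ∨ IsTableRow 4 3 (conj ρ) (conj ρ - 1) σ := by
  have hσ1 : σ = Real.sqrt 2 := by
    rw [hσ]; push_cast; rw [Real.cos_pi_div_four]; ring
  apply isTableRow_of_eq (X := 1) _ _ _ hre hnorm
  · right; right; left
    exact ⟨rfl, rfl, rfl, by ring, hσ1⟩
  · rw [hσ1, Real.sq_sqrt (by norm_num)]; simp
  · push_cast
    rw [Real.cos_pi_div_three]
    simp

theorem isTableRow_five_four {ρ : ℂ} {σ : ℝ} (hre : σ ^ 2 = 2 * ρ.re)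
    (hnorm : ‖ρ‖ = 2 * Real.cos (Real.pi / (4 : ℕ))) (hσ : σ = 2 * Real.cos (Real.pi / (5 : ℕ))) :
    IsTableRow 5 4 ρ (ρ - 1) σ ∨ IsTableRow 5 4 (conj ρ) (conj ρ - 1) σ := by
  have hσ1 : σ = (1 + Real.sqrt 5) / 2 := by
    rw [hσ]; push_cast; rw [Real.cos_pi_div_five]; ring
  have h5 := Real.sq_sqrt (show (0 : ℝ) ≤ 5 by norm_num)
  have h3 := Real.sq_sqrt (show (0 : ℝ) ≤ 3 by norm_num)
  have h2 := Real.sq_sqrt (show (0 : ℝ) ≤ 2 by norm_num)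
  have hX : (1 + Complex.I * (Real.sqrt 3 : ℝ)) *
      ((Real.sqrt 5 : ℝ) - Complex.I * (Real.sqrt 3 : ℝ)) / 4 =
      ⟨(Real.sqrt 5 + 3) / 4, Real.sqrt 3 * (Real.sqrt 5 - 1) / 4⟩ := by
    apply Complex.ext
    · simp
    · simp
      ring
  apply isTableRow_of_eq (X := (1 + Complex.I * (Real.sqrt 3 : ℝ)) *
      ((Real.sqrt 5 : ℝ) - Complex.I * (Real.sqrt 3 : ℝ)) / 4) _ _ _ hre hnorm
  · right; right; right; left
    refine ⟨rfl, rfl, rfl, ?_, hσ1⟩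
    have f0 : expPi (-2 / 3) = -expPi (1 / 3) := by
      have : expPi (-2 / 3) = expPi (1 / 3) * expPi (-1) := by rw [← expPi_add]; norm_num
      rw [this, expPi_eq (-1)]
      simp
    have f1 : expPi (2 / 15) = expPi (1 / 3) * expPi (-(1 / 5)) := by
      rw [← expPi_add]; norm_num
    have f2 : expPi (8 / 15) = expPi (1 / 3) * expPi (1 / 5) := by
      rw [← expPi_add]; norm_num
    have f3 := expPi_add_neg (1 / 5)
    rw [show Real.pi * (1 / 5) = Real.pi / 5 by ring, Real.cos_pi_div_five] at f3
    have f4 : expPi (1 / 3) = ⟨1 / 2, Real.sqrt 3 / 2⟩ := by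
      rw [expPi_eq, show Real.pi * (1 / 3) = Real.pi / 3 by ring, Real.cos_pi_div_three,
        Real.sin_pi_div_three]
      apply Complex.ext <;> simp
    -- The factor `e^{πi/3}` is common to all three terms and leaves `2 cos (π/5) - 1`.
    have f5 : expPi (-2 / 3) + expPi (2 / 15) + expPi (8 / 15) =
        expPi (1 / 3) * (((Real.sqrt 5 - 1) / 2 : ℝ) : ℂ) := by
      rw [f0, f1, f2]
      push_cast at f3 ⊢
      linear_combination expPi (1 / 3) * f3
    rw [f5, f4, hX]
    apply Complex.ext
    · simp; ring
    · simp; ring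
  · rw [hσ1, hX]
    simp only
    linear_combination h5 / 4
  · rw [hX, Complex.normSq_mk]
    push_cast
    rw [Real.cos_pi_div_four]
    grind

theorem isTableRow_eight_six {ρ : ℂ} {σ : ℝ} (hre : σ ^ 2 = 2 * ρ.re)
    (hnorm : ‖ρ‖ = 2 * Real.cos (Real.pi / (6 : ℕ))) (hσ : σ = 2 * Real.cos (Real.pi / (8 : ℕ))) :
    IsTableRow 8 6 ρ (ρ - 1) σ ∨ IsTableRow 8 6 (conj ρ) (conj ρ - 1) σ := by
  have hσ1 : σ = Real.sqrt (2 + Real.sqrt 2) := by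
    rw [hσ]; push_cast; rw [Real.cos_pi_div_eight]; ring
  have h3 := Real.sq_sqrt (show (0 : ℝ) ≤ 3 by norm_num)
  have h2 := Real.sq_sqrt (show (0 : ℝ) ≤ 2 by norm_num)
  have hs0 : Real.sqrt 2 ≠ 0 := by positivity
  have hi : (Real.sqrt 2)⁻¹ = Real.sqrt 2 / 2 := by
    field_simp; linarith
  have hiC : ((Real.sqrt 2 : ℝ) : ℂ)⁻¹ = ((Real.sqrt 2 / 2 : ℝ) : ℂ) := by
    rw [← hi]; push_cast; rfl
  have hX : (1 + Complex.I) * (1 - Complex.I / (Real.sqrt 2 : ℝ)) =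
      ⟨1 + Real.sqrt 2 / 2, 1 - Real.sqrt 2 / 2⟩ := by
    rw [div_eq_mul_inv, hiC]
    apply Complex.ext <;> simp
    ring
  apply isTableRow_of_eq (X := (1 + Complex.I) * (1 - Complex.I / (Real.sqrt 2 : ℝ))) _ _ _ hre
    hnorm
  · right; right; right; right; left
    refine ⟨rfl, rfl, rfl, ?_, hσ1⟩
    have f0 : expPi (1 / 2) = Complex.I := by
      rw [expPi_eq, show Real.pi * (1 / 2) = Real.pi / 2 by ring, Real.cos_pi_div_two,
        Real.sin_pi_div_two]
      simp
    have f1 : expPi (1 / 12) = expPi (-(1 / 4)) * expPi (1 / 3) := by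
      rw [← expPi_add]; norm_num
    have f2 : expPi (-7 / 12) = expPi (-(1 / 4)) * expPi (-(1 / 3)) := by
      rw [← expPi_add]; norm_num
    have f3 := expPi_add_neg (1 / 3)
    rw [show Real.pi * (1 / 3) = Real.pi / 3 by ring, Real.cos_pi_div_three] at f3
    have f4 : expPi (-(1 / 4)) = ⟨Real.sqrt 2 / 2, -(Real.sqrt 2 / 2)⟩ := by
      rw [expPi_eq, show Real.pi * (-(1 / 4)) = -(Real.pi / 4) by ring, Real.cos_neg,
        Real.sin_neg, Real.cos_pi_div_four, Real.sin_pi_div_four]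
      apply Complex.ext <;> simp
    -- The last two terms are `e^{-πi/4}` times the primitive sixth roots of unity, whose sum is
    -- `1`.
    have f5 : expPi (1 / 2) + expPi (1 / 12) + expPi (-7 / 12) =
        Complex.I + expPi (-(1 / 4)) := by
      rw [f0, f1, f2]
      push_cast at f3
      linear_combination expPi (-(1 / 4)) * f3
    rw [f5, f4, hX]
    apply Complex.ext
    · simp
    · simp; ring
  · rw [hσ1, Real.sq_sqrt (by positivity), hX]
    simp only
    ring
  · rw [hX, Complex.normSq_mk]
    push_cast
    rw [Real.cos_pi_div_six]
    linear_combination h2 / 2 - h3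

/-! ### The main theorem -/

theorem mulVec_isometry (R : SU21) (z w : Fin 3 → ℂ) :
    herm21 (R.1.1 *ᵥ z) (R.1.1 *ᵥ w) = herm21 z w := R.2 z w

/-- All consequences of the hypotheses for a given triple of parameters. -/
theorem parameters_spec {p : ℕ} (hp : 2 ≤ p) {R₁ R₂ R₃ S : SU21}
    (hS₁ : S * R₁ * S⁻¹ = R₁ * R₂ * R₁⁻¹) (hSS : S ^ 2 = R₁ * R₂ * R₃)
    {n m : ℕ} (hn : 3 ≤ n) (hm : 3 ≤ m)
    (hbn : HasBraidLength R₁ R₃ n) (hbm : HasBraidLength R₁ R₂ m)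
    (hfin : IsOfFinOrder (R₁ * R₂ * R₃)) {ρ : ℂ} {σ τ : ℝ} (hσ : 0 ≤ σ) (hτ : 0 ≤ τ)
    (h : HasParameters p R₁ R₂ R₃ ρ σ τ) :
    σ = τ ∧ σ ^ 2 = 2 * ρ.re ∧
      (∃ k : ℕ, 0 < k ∧ 2 * k < m ∧ k.Coprime m ∧ ‖ρ‖ = 2 * Real.cos (k * Real.pi / m)) ∧
      (∃ l : ℕ, 0 < l ∧ 2 * l < n ∧ l.Coprime n ∧ σ = 2 * Real.cos (l * Real.pi / n)) ∧
      ((n, m) = (3, 4) ∨ (n, m) = (3, 5) ∨ (n, m) = (4, 3) ∨ (n, m) = (5, 4) ∨ (n, m) = (8, 6) ∨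
        ∃ k : ℕ, 3 ≤ k ∧ (n, m) = (k, k)) := by
  obtain ⟨v, h₁, h₂, h₃, hH⟩ := h
  have n₁ : herm21 (v 0) (v 0) = alphaH p := hH 0 0
  have n₂ : herm21 (v 1) (v 1) = alphaH p := hH 1 1
  have n₃ : herm21 (v 2) (v 2) = alphaH p := hH 2 2
  have e21 : herm21 (v 1) (v 0) = -Complex.I * (sqrtU p)⁻¹ * ρ := by
    rw [← exp_neg_half_eq_sqrtU]; exact hH 0 1
  have e13 : herm21 (v 0) (v 2) = -Complex.I * (sqrtU p)⁻¹ * τ := by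
    rw [← exp_neg_half_eq_sqrtU]; exact hH 2 0
  have e23 : herm21 (v 1) (v 2) = Complex.I * sqrtU p * σ := by
    have h1 : herm21 (v 1) (v 2) = conj (-Complex.I * (sqrtU p)⁻¹ * σ) := by
      rw [← exp_neg_half_eq_sqrtU]; exact hH 2 1
    rw [h1]
    simp [conj_sqrtU]
  obtain ⟨h13, l, hl, hln, hlc, hlσ⟩ := exists_norm_eq_two_mul_cos hp h₁ h₃ n₁ n₃ hn hbn
  obtain ⟨-, k, hk, hkm, hkc, hkρ⟩ := exists_norm_eq_two_mul_cos hp h₁ h₂ n₁ n₂ hm hbm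
  rw [e13, norm_mul, norm_neg_I_mul_inv_sqrtU, one_mul, Complex.norm_real,
    Real.norm_of_nonneg hτ] at hlσ
  rw [← herm21_conj, RCLike.norm_conj, e21, norm_mul, norm_neg_I_mul_inv_sqrtU, one_mul] at hkρ
  have hτ0 : τ ≠ 0 := by
    rintro rfl
    apply h13
    rw [e13]
    simp
  -- The element `J = R₁⁻¹ S` conjugates `R₁` to `R₂`. Hence `S² = R₁ J R₁ J = R₁ R₂ J²`, and
  -- comparison with `S² = R₁ R₂ R₃` gives `J² = R₃`.
  have hJ₁ : (R₁⁻¹ * S) * R₁ = R₂ * (R₁⁻¹ * S) := by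
    have h1 : S * R₁ = R₁ * R₂ * R₁⁻¹ * S := by rw [← hS₁]; group
    rw [mul_assoc, h1]
    group
  have hJJ : (R₁⁻¹ * S) * (R₁⁻¹ * S) = R₃ := by
    have h1 : S * S = R₁ * R₂ * R₃ := by rw [← hSS, sq]
    have h3 : S * S = R₁ * R₂ * ((R₁⁻¹ * S) * (R₁⁻¹ * S)) := by
      calc S * S = R₁ * (((R₁⁻¹ * S) * R₁) * (R₁⁻¹ * S)) := by group
        _ = _ := by rw [hJ₁]; group
    rw [h3] at h1
    exact mul_left_cancel h1
  set J := R₁⁻¹ * S with hJ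
  have hS : S = R₁ * J := by rw [hJ]; group
  have c₁ := coe_eq_of_isComplexReflection hp h₁ n₁
  have c₂ := coe_eq_of_isComplexReflection hp h₂ n₂
  have c₃ := coe_eq_of_isComplexReflection hp h₃ n₃
  have hx : (sqrtU p)⁻¹ ^ 2 ≠ 0 := pow_ne_zero 2 (inv_ne_zero sqrtU_ne_zero)
  have hMM : J.1.1 * J.1.1 = ((sqrtU p)⁻¹ ^ 2) • (1 + reflPart p (v 2)) := by
    rw [← c₃, ← hJJ]; rfl
  have h12 : J.1.1 * (1 + reflPart p (v 0)) = (1 + reflPart p (v 1)) * J.1.1 := by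
    have h1 : J.1.1 * R₁.1.1 = R₂.1.1 * J.1.1 := congrArg su21ToMatrix hJ₁
    rw [c₁, c₂, mul_smul_comm, smul_mul_assoc] at h1
    exact smul_right_injective _ hx h1
  obtain ⟨hστ, hρ, ε, hε, hMv₃, hMv₁⟩ := parameters_of_sqrt_reflection hp n₁ n₂ n₃
    (mulVec_isometry J) hMM h12 e21 e13 e23 hσ hτ hτ0
  have hre : σ ^ 2 = 2 * ρ.re := by
    have h1 : ((σ ^ 2 : ℝ) : ℂ) = ((2 * ρ.re : ℝ) : ℂ) := by
      rw [← Complex.add_conj, hρ]; push_cast; ring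
    exact_mod_cast h1
  obtain ⟨N, hN, hSN⟩ : ∃ N : ℕ, N ≠ 0 ∧ S ^ N = 1 := by
    rw [← hSS, isOfFinOrder_iff_pow_eq_one] at hfin
    obtain ⟨N, hN, h⟩ := hfin
    exact ⟨2 * N, by omega, by rw [pow_mul]; exact h⟩
  have hSN' : S.1.1 ^ N = 1 := by
    have h1 := congrArg su21ToMatrix hSN
    rw [map_pow, map_one] at h1
    exact h1
  have hSmat : S.1.1 = ((sqrtU p)⁻¹ ^ 2) • (1 + reflPart p (v 0)) * J.1.1 := by
    rw [← c₁]; exact congrArg su21ToMatrix hS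
  obtain ⟨a, b, c, ha, hb, hc, habc, hsum⟩ := exists_sum_of_roots_of_unity hp n₃ J.1.2 hMM e21 hε
    hMv₃ hMv₁ hSmat S.1.2 hSN'
  subst hστ
  refine ⟨rfl, hre, ⟨k, hk, hkm, hkc, hkρ⟩, ⟨l, hl, hln, hlc, hlσ⟩, ?_⟩
  exact braid_lengths_of_sum_of_roots_of_unity hl hln hlc hk hkm hkc hN ha hb hc habc hsum
    (by rw [← hlσ]; exact hre) hkρ

theorem theorem2p4 (p : ℕ) (hp : 2 ≤ p) (R₁ R₂ R₃ S : SU21)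
    (hR₁ : ∃ v, IsComplexReflection p v R₁)
    (hR₂ : ∃ v, IsComplexReflection p v R₂)
    (hR₃ : ∃ v, IsComplexReflection p v R₃)
    (hS₁ : S * R₁ * S⁻¹ = R₁ * R₂ * R₁⁻¹)
    (hS₂ : S * R₂ * S⁻¹ = R₁ * R₃ * R₁ * R₃⁻¹ * R₁⁻¹)
    (hS₃ : S * R₃ * S⁻¹ = R₁ * R₃ * R₁⁻¹)
    (hSS : S ^ 2 = R₁ * R₂ * R₃)
    (n m : ℕ) (hn : 3 ≤ n) (hm : 3 ≤ m)
    (hbn : HasBraidLength R₁ R₃ n) (hbm : HasBraidLength R₁ R₂ m)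
    (hfin : IsOfFinOrder (R₁ * R₂ * R₃)) :
    ((n, m) = (3, 4) ∨ (n, m) = (3, 5) ∨ (n, m) = (4, 3) ∨ (n, m) = (5, 4) ∨ (n, m) = (8, 6) ∨
      ∃ k : ℕ, 3 ≤ k ∧ (n, m) = (k, k)) ∧
    (∃ (ρ : ℂ) (σ τ : ℝ), 0 ≤ σ ∧ 0 ≤ τ ∧ HasParameters p R₁ R₂ R₃ ρ σ τ) ∧
    ∀ (ρ : ℂ) (σ τ : ℝ), 0 ≤ σ → 0 ≤ τ → HasParameters p R₁ R₂ R₃ ρ σ τ →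
      σ = τ ∧ σ ^ 2 = 2 * ρ.re ∧
      (∃ k : ℕ, 0 < k ∧ 2 * k < m ∧ k.Coprime m ∧ ‖ρ‖ = 2 * Real.cos (k * Real.pi / m)) ∧
      (∃ l : ℕ, 0 < l ∧ 2 * l < n ∧ l.Coprime n ∧ σ = 2 * Real.cos (l * Real.pi / n)) ∧
      (‖ρ‖ = 2 * Real.cos (Real.pi / m) → σ = 2 * Real.cos (Real.pi / n) →
        IsTableRow n m ρ (ρ - 1) σ ∨ IsTableRow n m (conj ρ) (conj ρ - 1) σ) := by
  have hex := exists_parameters hp hR₁ hR₂ hR₃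
  have hlist : (n, m) = (3, 4) ∨ (n, m) = (3, 5) ∨ (n, m) = (4, 3) ∨ (n, m) = (5, 4) ∨
      (n, m) = (8, 6) ∨ ∃ k : ℕ, 3 ≤ k ∧ (n, m) = (k, k) := by
    obtain ⟨ρ, σ, τ, hσ, hτ, h⟩ := hex
    exact (parameters_spec hp hS₁ hSS hn hm hbn hbm hfin hσ hτ h).2.2.2.2
  refine ⟨hlist, hex, fun ρ σ τ hσ hτ h => ?_⟩
  obtain ⟨h1, h2, h3, h4, -⟩ := parameters_spec hp hS₁ hSS hn hm hbn hbm hfin hσ hτ h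
  refine ⟨h1, h2, h3, h4, fun hnorm hσn => ?_⟩
  simp only [Prod.mk.injEq] at hlist
  rcases hlist with ⟨rfl, rfl⟩ | ⟨rfl, rfl⟩ | ⟨rfl, rfl⟩ | ⟨rfl, rfl⟩ | ⟨rfl, rfl⟩ |
    ⟨k, hk, rfl, rfl⟩
  · exact isTableRow_three_four h2 hnorm hσn
  · exact isTableRow_three_five h2 hnorm hσn
  · exact isTableRow_four_three h2 hnorm hσn
  · exact isTableRow_five_four h2 hnorm hσn
  · exact isTableRow_eight_six h2 hnorm hσn
  · exact isTableRow_diagonal hk h2 hnorm hσn
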